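/- **Setting.** Let $1\le\alpha\le 2$, $a<b$, $T>0$, and let $K_1,K_2\ge 0$ with $K_1+K_2\neq 0$. Consider $$\frac{\partial u}{\partial t}=K_1\,{}_aD_x^\alpha u+K_2\,{}_xD_b^\alpha u+f(x,t)\quad\text{on }[a,b]\times[0,T],$$ $$u(x,0)=s_0(x),\qquad u(a,t)=\phi_1(t),\qquad u(b,t)=\phi_2(t),$$ where $\phi_1\equiv 0$ if $K_1\ne 0$ and $\phi_2\equiv 0$ if $K_2\neq 0$. The fractional derivatives are the Grünwald–Letnikov derivatives $${}_aD_x^\alpha g(x)=\lim_{h\to0^+}h^{-\alpha}\sum_{k=0}^{\lfloor (x-a)/h\rfloor}(-1)^k\tbinom{\alpha}{k}g(x-kh),\qquad {}_xD_b^\alpha g(x)=\lim_{h\to0^+}h^{-\alpha}\sum_{k=0}^{\lfloor (b-x)/h\rfloor}(-1)^k\tbinom{\alpha}{k}g(x+kh)$$ (a term with zero diffusion coefficient is omitted). **Scheme.** Let $w_k$ be the Taylor coefficients at $0$ of $$W(z)=\Big(\big(\tfrac32-\tfrac1\alpha\big)+\big(-2+\tfrac2\alpha\big)z+\big(\tfrac12-\tfrac1\alpha\big)z^2\Big)^\alpha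 .$$ For $N,M\ge1$ put $h=(b-a)/N$, $\tau=T/M$, $x_i=a+ih$, $t_m=m\tau$, $t_{m+1/2}=(t_m+t_{m+1})/2$. For a grid function $v=(v_0,\dots,v_N)$ and $1\le i\le N-1$ put $$\Delta_2v_i=h^{-\alpha}\Big(K_1\sum_{k=0}^{i+1}w_kv_{i+1-k}+K_2\sum_{k=0}^{N-i+1}w_kv_{i-1+k}\Big).$$ Let $P_hv_i=v_i$ for $p=2$, and $P_hv_i=v_i+a_2(v_{i-1}-2v_i+v_{i+1})$ with $a_2=1-\frac{\alpha}{3}-\frac1{2\alpha}$ for $p=3$. The Crank–Nicolson (CN) type scheme of order $p\in\{2,3\}$ for $\hat u_i^m$ ($0\le i\le N$, $0\le m\le M$) is $$P_h(\hat u_i^{m+1}-\hat u_i^m)=\tfrac{\tau}{2}\Delta_2(\hat u_i^{m+1}+\hat u_i^m)+\tau P_hf(x_i,t_{m+1/2}),\quad 1\le i\le N-1,\ 0\le m\le M-1,$$ with $\hat u_i^0=s_0(x_i)$, $\hat u_0^m=\phi_1(t_m)$, $\hat u_N^m=\phi_2(t_m)$. Let $\|v\|=\big(h\sum_{i=1}^{N-1}v_i^2\big)^{1/2}$.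 **Theorem.** Let $p\in\{2,3\}$, let $u$ be a solution of the problem, and assume, with $k=p+\lceil\alpha\rceil+1$: * if $K_1\ne0$, the extension of $u(\cdot,t)$ by zero to $(-\infty,b]$ is $C^k$ there for every $t\in[0,T]$, with $k$-th derivative bounded uniformly in $t$; if $K_2\ne0$, the same holds for the extension of $u(\cdot,t)$ by zero to $[a,\infty)$; * for every $x\in[a,b]$, $u(x,\cdot)\in C^3[0,T]$ and $f(x,\cdot)\in C^2[0,T]$, with $\partial_t^3u$ and $\partial_t^2f$ bounded on $[a,b]\times[0,T]$. Then: 1. for all $N,M\ge1$ the CN type scheme of order $p$ has exactly one solution $\hat u$; 2. there is a constant $C$, independent of $N$ and $M$, such that for all $N,M\ge1$ and $0\le m\le M$ $$\|u^m-\hat u^m\|\le C(\tau^2+h^p),\qquad u^m=(u(x_i,t_m))_{0\le i\le N};$$ 3. in particular the approximate solutions converge to the exact solution as $h,\tau\to0$, without any relation between $h$ and $\tau$: for every $\varepsilon>0$ there is $\delta>0$ such that $h<\delta$ and $\tau<\delta$ imply $\max_{0\le m\le M}\|u^m-\hat u^m\|<\varepsilon$. -/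

import Mathlib

open Set Filter Topology

noncomputable section

namespace FracCN

/-- The Grünwald coefficients `g_k = (-1)^k * binom(α, k)` of `(1 - z) ^ α`. -/
def glCoeff (α : ℝ) (k : ℕ) : ℝ := (-1) ^ k * Ring.choose α k

/-- `L` is the left Grünwald-Letnikov derivative of order `α` at `x`, with lower terminal `a`,
of the function `g` extended by zero to the left of `a`. -/
def IsLeftGLDeriv (α a : ℝ) (g : ℝ → ℝ) (x L : ℝ) : Prop :=
  Tendsto (fun h : ℝ => (1 / h ^ α) *
      ∑ k ∈ Finset.range (⌊(x - a) / h⌋₊ + 1), glCoeff α k * g (x - k * h))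
    (𝓝[>] 0) (𝓝 L)

/-- `L` is the right Grünwald-Letnikov derivative of order `α` at `x`, with upper terminal `b`,
of the function `g` extended by zero to the right of `b`. -/
def IsRightGLDeriv (α b : ℝ) (g : ℝ → ℝ) (x L : ℝ) : Prop :=
  Tendsto (fun h : ℝ => (1 / h ^ α) *
      ∑ k ∈ Finset.range (⌊(b - x) / h⌋₊ + 1), glCoeff α k * g (x + k * h))
    (𝓝[>] 0) (𝓝 L)

/-- `u` solves `∂u/∂t = K₁ (left derivative) + K₂ (right derivative) + f` on `[a,b] × [0,T]`,
with initial value `s₀` and boundary values `φ₁`, `φ₂`. A fractional derivative has to exist only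
if its diffusion coefficient does not vanish; the time derivative is one-sided at `0` and `T`. -/
structure IsSolution (α a b T K₁ K₂ : ℝ) (f : ℝ → ℝ → ℝ) (s₀ φ₁ φ₂ : ℝ → ℝ)
    (u : ℝ → ℝ → ℝ) : Prop where
  equation : ∀ x ∈ Icc a b, ∀ t ∈ Icc 0 T, ∃ L R : ℝ,
    (K₁ ≠ 0 → IsLeftGLDeriv α a (fun y => u y t) x L) ∧
    (K₂ ≠ 0 → IsRightGLDeriv α b (fun y => u y t) x R) ∧
    HasDerivWithinAt (fun s => u x s) (K₁ * L + K₂ * R + f x t) (Icc 0 T) t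
  initial : ∀ x ∈ Icc a b, u x 0 = s₀ x
  left_boundary : ∀ t ∈ Icc 0 T, u a t = φ₁ t
  right_boundary : ∀ t ∈ Icc 0 T, u b t = φ₂ t

/-- The functions `g(·, t)`, `t ∈ [0,T]`, on `[a,b]`, extended by zero outside `[a,b]`, are
`C^k` on `S`, with `k`-th derivative bounded uniformly in `t`. -/
def SpaceSmooth (a b T : ℝ) (k : ℕ) (S : Set ℝ) (g : ℝ → ℝ → ℝ) : Prop :=
  (∀ t ∈ Icc 0 T, ContDiffOn ℝ k ((Icc a b).indicator fun x => g x t) S) ∧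
  ∃ B : ℝ, ∀ t ∈ Icc 0 T, ∀ x ∈ S,
    |iteratedDerivWithin k ((Icc a b).indicator fun y => g y t) S x| ≤ B

/-- The functions `g(x, ·)`, `x ∈ [a,b]`, are `C^k` on `[0,T]`, with `k`-th derivative bounded
uniformly in `x`. -/
def TimeSmooth (a b T : ℝ) (k : ℕ) (g : ℝ → ℝ → ℝ) : Prop :=
  (∀ x ∈ Icc a b, ContDiffOn ℝ k (fun t => g x t) (Icc 0 T)) ∧
  ∃ B : ℝ, ∀ x ∈ Icc a b, ∀ t ∈ Icc 0 T,
    |iteratedDerivWithin k (fun s => g x s) (Icc 0 T) t| ≤ B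

/-- The generating function `W_{2,r}(z) = (β₀ + β₁ z + β₂ z²)^α` of the second order
approximation with shift `r`. -/
def genW (α r z : ℝ) : ℝ :=
  ((3 / 2 - r / α) + (-2 + 2 * r / α) * z + (1 / 2 - r / α) * z ^ 2) ^ α

/-- The weights `w_{k,r}`: the Taylor coefficients at `0` of `W_{2,r}`. -/
def weight (α r : ℝ) (k : ℕ) : ℝ :=
  iteratedDeriv k (genW α r) 0 / (Nat.factorial k : ℝ)

/-- The coefficient `a₂(r)` of `z²` in `z^(-α) W_{2,r}(e^(-z)) e^(r z)`. -/
def a₂ (α r : ℝ) : ℝ := -α / 3 + r - r ^ 2 / (2 * α)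

/-- The matrix, on the nodes `0, …, N`, of the left operator with weights `w_{k,1}`, shift `1` and
mesh size `h`: `(Δ v)_i = h^(-α) ∑_{k=0}^{i+1} w_{k,1} v_{i+1-k}`.
The right operator has the transposed matrix. -/
def leftMatrix (α h : ℝ) (N : ℕ) : Matrix (Fin (N + 1)) (Fin (N + 1)) ℝ :=
  Matrix.of fun i j =>
    if (j : ℕ) ≤ (i : ℕ) + 1 then (1 / h ^ α) * weight α 1 ((i : ℕ) + 1 - (j : ℕ)) else 0

/-- The matrix of `Δ₂ = K₁ Δ_{2,+1} + K₂ Δ_{2,-1}`. -/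
def diffusionMatrix (α K₁ K₂ h : ℝ) (N : ℕ) : Matrix (Fin (N + 1)) (Fin (N + 1)) ℝ :=
  K₁ • leftMatrix α h N + K₂ • (leftMatrix α h N).transpose

/-- The tridiagonal matrix with diagonal entries `1 - 2 c` and off-diagonal entries `c`. At the
interior nodes it is `1 + c h² δ_h²`, with `δ_h²` the central second difference quotient. -/
def triMatrix (c : ℝ) (N : ℕ) : Matrix (Fin (N + 1)) (Fin (N + 1)) ℝ :=
  Matrix.of fun i j =>
    if i = j then 1 - 2 * c
    else if (i : ℕ) = (j : ℕ) + 1 ∨ (j : ℕ) = (i : ℕ) + 1 then c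
    else 0

/-- The matrix of `P_h`: the identity for the scheme of order `p = 2`, and
`1 + a₂(1) h² δ_h²` for the scheme of order `p = 3`. -/
def precMatrix (α : ℝ) (p N : ℕ) : Matrix (Fin (N + 1)) (Fin (N + 1)) ℝ :=
  if p = 2 then 1 else triMatrix (a₂ α 1) N

/-- The mesh size of the uniform partition of `[a,b]` into `N` intervals (and, with `a = 0`, the
step size in time). -/
def meshSize (a b : ℝ) (N : ℕ) : ℝ := (b - a) / N

/-- The `i`-th node of the uniform partition of `[a,b]` into `N` intervals. -/
def node (a b : ℝ) (N i : ℕ) : ℝ := a + i * meshSize a b N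

/-- `U m i`, `0 ≤ m ≤ M`, `0 ≤ i ≤ N`, solves the Crank-Nicolson type scheme (of order `p` in
space) with the given source, initial and boundary values:
`P_h (U_i^{m+1} - U_i^m) = (τ/2) Δ₂ (U_i^{m+1} + U_i^m) + τ P_h f_i^{m+1/2}` at the interior
nodes. -/
structure IsCNSolution (p : ℕ) (α a b T K₁ K₂ : ℝ) (f : ℝ → ℝ → ℝ) (s₀ φ₁ φ₂ : ℝ → ℝ)
    (N M : ℕ) (U : Fin (M + 1) → Fin (N + 1) → ℝ) : Prop where
  step : ∀ (m : Fin M) (i : Fin (N + 1)), i ≠ 0 → i ≠ Fin.last N →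
    (precMatrix α p N).mulVec (U m.succ - U m.castSucc) i =
      meshSize 0 T M / 2 *
          (diffusionMatrix α K₁ K₂ (meshSize a b N) N).mulVec (U m.succ + U m.castSucc) i
        + meshSize 0 T M * (precMatrix α p N).mulVec
            (fun j => f (node a b N j) ((node 0 T M (m + 1) + node 0 T M m) / 2)) i
  initial : ∀ i : Fin (N + 1), U 0 i = s₀ (node a b N i)
  left_boundary : ∀ m : Fin (M + 1), U m 0 = φ₁ (node 0 T M m)
  right_boundary : ∀ m : Fin (M + 1), U m (Fin.last N) = φ₂ (node 0 T M m)

/-- The discrete norm `‖v‖ = (h ∑_{i=1}^{N-1} v_i²)^(1/2)`. -/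
def gridNorm (h : ℝ) (N : ℕ) (v : Fin (N + 1) → ℝ) : ℝ :=
  Real.sqrt (h * ∑ i : Fin (N + 1), if i ≠ 0 ∧ i ≠ Fin.last N then v i ^ 2 else 0)

/-- The norm of the error at time level `m`. -/
def errorNorm (a b T : ℝ) (u : ℝ → ℝ → ℝ) (N M : ℕ) (U : Fin (M + 1) → Fin (N + 1) → ℝ)
    (m : Fin (M + 1)) : ℝ :=
  gridNorm (meshSize a b N) N fun i => u (node a b N i) (node 0 T M m) - U m i

end FracCN

end

noncomputable section

namespace FracCN

/-! The error of the scheme satisfies the scheme with the truncation error as source and zero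
initial and boundary values. Convergence without a mesh restriction therefore needs only
consistency, O(τ² + h^p), and an energy estimate.

Stability. With q = 1/α − 1/2 ∈ [0, 1/2] the generating function factors as W(z) = (1 − z)^α (1 − q
+ qz)^α. On the unit circle, the arguments of the two factors are such that e^(−iθ) W(e^(iθ)) has
nonpositive real part (`symbolRe_nonpos`). The quadratic form of the Toeplitz matrix of the weights
is an integral of this symbol against |∑ v_j e^(ijθ)|², so it is nonpositive
(`sum_toeplitzEntry_nonpos`). P_h is bounded below by 1/5 because 0 ≤ a₂ ≤ 1/5 (`a₂_mem`,
`le_dotProduct_triMatrix_mulVec`). Testing one time step with e₁ + e₀ then bounds the growth of the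
P_h-energy (`sqrt_energy_step`), and the same two signs make each step uniquely solvable
(`existsUnique_step`).

Consistency in space avoids Fourier transforms. A difference formula on a grid is a coefficient of a
product of formal power series. Put V = 1 − X. The series (1 − X)^α (1 + (α/2) V + ((3α² + 5α)/24)
V²), which truncates (−log X)^α at X = 1, changes under mesh halving only by a multiple of V^(α+3)
with absolutely summable cofactor (`exists_evenPS_sub`). Summing over dyadic refinements compares it
with its limit, which is the Grünwald–Letnikov derivative, with error O(h³)
(`exists_abs_corrGL_sub_le`). W agrees with this series, shifted by one node and preconditioned by
P_h, up to V^(α+p) (`exists_weightPS_eq`). Remainders V^(α+r) R are of size h^r: they are fractional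
sums of k-th differences, which smoothness of the zero extension bounds by h^k (`DiffBound.abs_le`,
`diffBound_of_contDiffOn`).

Consistency in time combines the trapezoidal rule for ∂u/∂t with the midpoint rule for f
(`trapezoid_le`, `midpoint_le`). -/

/-! ### Binomial power series. -/

/-- The power series of `(1 + ρ X) ^ β`. -/
def binomPS (ρ β : ℝ) : PowerSeries ℝ := PowerSeries.mk fun n => Ring.choose β n * ρ ^ n

@[simp] lemma coeff_binomPS (ρ β : ℝ) (n : ℕ) :
    PowerSeries.coeff n (binomPS ρ β) = Ring.choose β n * ρ ^ n := by
  simp [binomPS]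

lemma binomPS_eq_rescale (ρ β : ℝ) :
    binomPS ρ β = PowerSeries.rescale ρ (PowerSeries.binomialSeries ℝ β) := by
  ext n
  simp [mul_comm]

lemma binomPS_add (ρ β γ : ℝ) : binomPS ρ (β + γ) = binomPS ρ β * binomPS ρ γ := by
  simp [binomPS_eq_rescale]

lemma binomPS_natCast (ρ : ℝ) (k : ℕ) :
    binomPS ρ k = (1 + PowerSeries.C ρ * PowerSeries.X) ^ k := by
  simp [binomPS_eq_rescale, PowerSeries.rescale_X]

lemma binomPS_neg_one_natCast (k : ℕ) :
    binomPS (-1) k = (1 - PowerSeries.X) ^ k := by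
  simp [binomPS_natCast, sub_eq_add_neg]

lemma coeff_binomPS_neg_one (α : ℝ) (k : ℕ) :
    PowerSeries.coeff k (binomPS (-1) α) = glCoeff α k := by
  simp [glCoeff, mul_comm]

lemma succ_mul_choose_succ (β : ℝ) (n : ℕ) :
    (n + 1 : ℝ) * Ring.choose β (n + 1) = (β - n) * Ring.choose β n := by
  rw [Ring.choose_eq_smul, Ring.choose_eq_smul, descPochhammer_succ_right,
    Polynomial.smeval_mul, Nat.factorial_succ]
  simp [Polynomial.smeval_natCast]
  field_simp

lemma succ_mul_choose_succ' (β : ℝ) (n : ℕ) :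
    (n + 1 : ℝ) * Ring.choose β (n + 1) = β * Ring.choose (β - 1) n := by
  induction n with
  | zero => simp
  | succ n ih =>
    have h1 := succ_mul_choose_succ β (n + 1)
    have h2 := succ_mul_choose_succ (β - 1) n
    push_cast at *
    have h3 : (n + 1 : ℝ) ≠ 0 := by positivity
    apply mul_left_cancel₀ h3
    linear_combination (n + 1 : ℝ) * h1 + (β - (n + 1)) * ih - β * h2

/-! ### Absolute summability of coefficients. -/

/-- Absolute summability of the coefficients. -/
def AbsSummable (P : PowerSeries ℝ) : Prop := Summable fun n => |PowerSeries.coeff n P|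

/-- The sum of the absolute values of the coefficients. -/
def absSum (P : PowerSeries ℝ) : ℝ := ∑' n, |PowerSeries.coeff n P|

lemma absSum_nonneg (P : PowerSeries ℝ) : 0 ≤ absSum P := tsum_nonneg fun _ => abs_nonneg _

lemma AbsSummable.add {P Q : PowerSeries ℝ} (hP : AbsSummable P) (hQ : AbsSummable Q) :
    AbsSummable (P + Q) :=
  Summable.of_nonneg_of_le (fun _ => abs_nonneg _)
    (fun n => by simpa using abs_add_le _ _) (Summable.add hP hQ)

lemma AbsSummable.mul {P Q : PowerSeries ℝ} (hP : AbsSummable P) (hQ : AbsSummable Q) :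
    AbsSummable (P * Q) := by
  have := summable_norm_sum_mul_antidiagonal_of_summable_norm (R := ℝ) hP hQ
  simpa only [AbsSummable, PowerSeries.coeff_mul, Real.norm_eq_abs] using this

lemma absSummable_of_forall_ge {P : PowerSeries ℝ} (N : ℕ)
    (h : ∀ n, N ≤ n → PowerSeries.coeff n P = 0) : AbsSummable P :=
  summable_of_ne_finset_zero (s := Finset.range N) fun n hn => by
    rw [h n (by simpa using hn), abs_zero]

lemma absSummable_C (r : ℝ) : AbsSummable (PowerSeries.C r) :=
  absSummable_of_forall_ge 1 fun n hn => by
    rw [PowerSeries.coeff_C, if_neg (by omega)]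

lemma absSummable_X : AbsSummable PowerSeries.X :=
  absSummable_of_forall_ge 2 fun n hn => by
    rw [PowerSeries.coeff_X, if_neg (by omega)]

lemma AbsSummable.C_mul {P : PowerSeries ℝ} (r : ℝ) (hP : AbsSummable P) :
    AbsSummable (PowerSeries.C r * P) := (absSummable_C r).mul hP

lemma AbsSummable.sub {P Q : PowerSeries ℝ} (hP : AbsSummable P) (hQ : AbsSummable Q) :
    AbsSummable (P - Q) := by
  have : P - Q = P + PowerSeries.C (-1) * Q := by simp [sub_eq_add_neg]
  rw [this]
  exact hP.add (hQ.C_mul _)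

lemma absSummable_one : AbsSummable 1 := by simpa using absSummable_C 1

lemma AbsSummable.pow {P : PowerSeries ℝ} (hP : AbsSummable P) (n : ℕ) : AbsSummable (P ^ n) := by
  induction n with
  | zero => simpa using absSummable_one
  | succ n ih => simpa [pow_succ] using ih.mul hP

lemma absSummable_one_sub_X : AbsSummable (1 - PowerSeries.X) := absSummable_one.sub absSummable_X

/-- Beyond N ≥ β the ratio recursion has a fixed sign and reads β|c_n| = n|c_n| − (n+1)|c_(n+1)|.
The right side telescopes, so the partial sums stay below N|c_N|/β. -/
lemma summable_abs_choose {β : ℝ} (hβ : 0 < β) : Summable fun n => |Ring.choose β n| := by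
  obtain ⟨N, hN⟩ := exists_nat_ge β
  rw [← summable_nat_add_iff N]
  have key : ∀ n : ℕ, β * |Ring.choose β (n + N)| =
      (n + N : ℕ) * |Ring.choose β (n + N)| - (n + 1 + N : ℕ) * |Ring.choose β (n + 1 + N)| := by
    intro n
    have h := congrArg abs (succ_mul_choose_succ β (n + N))
    rw [abs_mul, abs_mul, abs_of_nonneg (by positivity), abs_of_nonpos (a := β - _) (by
      push_cast; linarith [(Nat.cast_nonneg n : (0 : ℝ) ≤ n)])] at h
    rw [show n + 1 + N = n + N + 1 by omega]
    push_cast at *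
    linarith
  have hb : ∀ n : ℕ, ∑ i ∈ Finset.range n, |Ring.choose β (i + N)| ≤
      N * |Ring.choose β N| / β := by
    intro n
    rw [le_div_iff₀ hβ, mul_comm, Finset.mul_sum]
    have := Finset.sum_range_sub' (fun n : ℕ => (n + N : ℕ) * |Ring.choose β (n + N)|) n
    simp only [key]
    rw [this]
    simp only [zero_add]
    have : 0 ≤ ((n + N : ℕ) : ℝ) * |Ring.choose β (n + N)| := by positivity
    linarith
  exact summable_of_sum_range_le (fun _ => abs_nonneg _) hb

lemma absSummable_binomPS {ρ β : ℝ} (hρ : |ρ| ≤ 1) (hβ : 0 < β) : AbsSummable (binomPS ρ β) :=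
  Summable.of_nonneg_of_le (fun _ => abs_nonneg _) (fun n => by
    rw [coeff_binomPS, abs_mul, abs_pow]
    exact mul_le_of_le_one_right (abs_nonneg _) (pow_le_one₀ (abs_nonneg _) hρ))
    (summable_abs_choose hβ)

/-- The recursion `succ_mul_choose_succ'` trades one power of n for one unit of β. -/
lemma summable_pow_mul_abs_choose (p : ℕ) {β : ℝ} (hβ : p < β) :
    Summable fun n : ℕ => (n + 1 : ℝ) ^ p * |Ring.choose β n| := by
  induction p generalizing β with
  | zero => simpa using summable_abs_choose (by simpa using hβ)
  | succ p ih =>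
    have hβ0 : 0 < β := lt_of_le_of_lt (by positivity) hβ
    have h := ih (β := β - 1) (by push_cast at hβ; linarith)
    rw [← summable_nat_add_iff 1]
    refine Summable.of_nonneg_of_le (fun _ => by positivity) (fun n => ?_)
      (h.mul_left (2 ^ (p + 1) * β))
    have h2 := congrArg abs (succ_mul_choose_succ' β n)
    rw [abs_mul, abs_mul, abs_of_nonneg (by positivity), abs_of_pos hβ0] at h2
    have h3 : ((n + 1 : ℕ) + 1 : ℝ) ^ (p + 1) ≤ (2 * (n + 1)) ^ (p + 1) := by
      gcongr
      push_cast
      linarith [(Nat.cast_nonneg n : (0 : ℝ) ≤ n)]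
    calc ((n + 1 : ℕ) + 1 : ℝ) ^ (p + 1) * |Ring.choose β (n + 1)|
        ≤ (2 * (n + 1)) ^ (p + 1) * |Ring.choose β (n + 1)| := by gcongr
      _ = 2 ^ (p + 1) * (n + 1) ^ p * ((n + 1) * |Ring.choose β (n + 1)|) := by rw [mul_pow]; ring
      _ = _ := by rw [h2]; ring

lemma abs_tsum_tail_le {f : ℕ → ℝ} {q : ℕ}
    (hf : Summable fun n : ℕ => (n + 1 : ℝ) ^ q * |f n|) (n : ℕ) :
    |∑' i, f (i + (n + 1))| ≤ (∑' m : ℕ, (m + 1 : ℝ) ^ q * |f m|) / (n + 1 : ℝ) ^ q := by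
  have hf1 : Summable fun m => |f m| :=
    Summable.of_nonneg_of_le (fun _ => abs_nonneg _) (fun m => by
      have : (1 : ℝ) ≤ (m + 1 : ℝ) ^ q := one_le_pow₀ (by simp)
      exact le_mul_of_one_le_left (abs_nonneg _) this) hf
  obtain ⟨w, hw⟩ : ∃ w : ℕ → ℝ, w = fun m : ℕ => (m + 1 : ℝ) ^ q * |f m| := ⟨_, rfl⟩
  have hw0 : ∀ m, 0 ≤ w m := fun m => by rw [hw]; positivity
  rw [← hw] at hf ⊢
  have hs : Summable fun i => |f (i + (n + 1))| :=
    (summable_nat_add_iff (f := fun i => |f i|) (n + 1)).2 hf1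
  have h1 : |∑' i, f (i + (n + 1))| ≤ ∑' i, |f (i + (n + 1))| := by
    simp only [← Real.norm_eq_abs] at hs ⊢
    exact norm_tsum_le_tsum_norm hs
  have hpos : (0 : ℝ) < (n + 1 : ℝ) ^ q := by positivity
  have hs2 : Summable fun i => w (i + (n + 1)) :=
    (summable_nat_add_iff (f := w) (n + 1)).2 hf
  have hle : _ = ∑' m, w m := hf.sum_add_tsum_nat_add (n + 1)
  have h0 : 0 ≤ ∑ i ∈ Finset.range (n + 1), w i := Finset.sum_nonneg fun i _ => hw0 i
  have h2 : ∑' i, (n + 1 : ℝ) ^ q * |f (i + (n + 1))| ≤ ∑' i, w (i + (n + 1)) := by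
    refine Summable.tsum_le_tsum (fun i => ?_) (hs.mul_left _) hs2
    rw [hw]
    refine mul_le_mul_of_nonneg_right (pow_le_pow_left₀ (by positivity) ?_ _) (abs_nonneg _)
    push_cast
    linarith [(Nat.cast_nonneg i : (0 : ℝ) ≤ i)]
  rw [tsum_mul_left] at h2
  rw [le_div_iff₀ hpos, mul_comm]
  exact (mul_le_mul_of_nonneg_left h1 hpos.le).trans (h2.trans (by linarith))

/-- The constant is P(1) and the quotient by 1 − X consists of the negated tail sums. A tail decays
like (n+1)^(−p−2), so two powers of the weight are lost: one would not leave a summable bound. -/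
lemma exists_div_one_sub_X {p : ℕ} {P : PowerSeries ℝ}
    (hP : Summable fun n : ℕ => (n + 1 : ℝ) ^ (p + 2) * |PowerSeries.coeff n P|) :
    ∃ (c : ℝ) (R : PowerSeries ℝ), P = PowerSeries.C c + (1 - PowerSeries.X) * R ∧
      Summable fun n : ℕ => (n + 1 : ℝ) ^ p * |PowerSeries.coeff n R| := by
  set f : ℕ → ℝ := fun n => PowerSeries.coeff n P with hf
  have hf1 : Summable fun n => |f n| :=
    Summable.of_nonneg_of_le (fun _ => abs_nonneg _) (fun n => by
      have : (1 : ℝ) ≤ (n + 1 : ℝ) ^ (p + 2) := one_le_pow₀ (by simp)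
      exact le_mul_of_one_le_left (abs_nonneg _) this) hP
  have hf2 : Summable f := hf1.of_abs
  set S := ∑' n : ℕ, (n + 1 : ℝ) ^ (p + 2) * |f n| with hS
  refine ⟨∑' n, f n, PowerSeries.mk fun n => -∑' i, f (i + (n + 1)), ?_, ?_⟩
  · ext n
    have hsum := hf2.sum_add_tsum_nat_add n
    have hsum' := hf2.sum_add_tsum_nat_add (n + 1)
    rw [Finset.sum_range_succ] at hsum'
    change f n = _
    cases n with
    | zero =>
      simp at hsum'
      simp [sub_mul]
      linarith
    | succ n =>
      simp [sub_mul, PowerSeries.coeff_succ_X_mul]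
      linarith
  · refine Summable.of_nonneg_of_le (fun _ => by positivity) (fun n => ?_)
      (((summable_nat_add_iff 1).2 ((Real.summable_one_div_nat_pow (p := 2)).2
        (by norm_num))).mul_left S)
    have htail := abs_tsum_tail_le (q := p + 2) hP n
    simp only [PowerSeries.coeff_mk, abs_neg]
    calc (n + 1 : ℝ) ^ p * |∑' i, f (i + (n + 1))|
        ≤ (n + 1 : ℝ) ^ p * (S / (n + 1 : ℝ) ^ (p + 2)) := by gcongr
      _ = S * (1 / ((n + 1 : ℕ) : ℝ) ^ 2) := by
        push_cast
        rw [pow_add]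
        field_simp

lemma choose_neg_nonneg {s : ℝ} (hs : 0 ≤ s) (n : ℕ) :
    0 ≤ Ring.choose (-s) n * (-1) ^ n := by
  induction n with
  | zero => simp
  | succ n ih =>
    have h := succ_mul_choose_succ (-s) n
    have h1 : (n + 1 : ℝ) * (Ring.choose (-s) (n + 1) * (-1) ^ (n + 1)) =
        (s + n) * (Ring.choose (-s) n * (-1) ^ n) := by
      linear_combination (-1) ^ (n + 1) * h
    have h2 : 0 ≤ (s + n) * (Ring.choose (-s) n * (-1) ^ n) := by positivity
    rw [← h1] at h2
    exact nonneg_of_mul_nonneg_right h2 (by positivity)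

/-- Partial summation is division by 1 − X. -/
lemma sum_range_succ_coeff_binomPS_neg (s : ℝ) (n : ℕ) :
    ∑ i ∈ Finset.range (n + 1), PowerSeries.coeff i (binomPS (-1) (-s)) =
      PowerSeries.coeff n (binomPS (-1) (-(s + 1))) := by
  have h : binomPS (-1) (-s) = (1 - PowerSeries.X) * binomPS (-1) (-(s + 1)) := by
    have := binomPS_neg_one_natCast 1
    rw [pow_one, Nat.cast_one] at this
    rw [← this, ← binomPS_add]
    ring_nf
  rw [h]
  induction n with
  | zero => simp [sub_mul]
  | succ n ih =>
    rw [Finset.sum_range_succ, ih, sub_mul, one_mul, map_sub, PowerSeries.coeff_succ_X_mul]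
    ring

/-- The coefficient is the product of the factors 1 + s/j, j ≤ n, hence at most exp(s H_n) with the
harmonic number H_n ≤ 1 + log(n+1). -/
lemma coeff_binomPS_neg_le {s : ℝ} (hs : 0 ≤ s) (n : ℕ) :
    PowerSeries.coeff n (binomPS (-1) (-(s + 1))) ≤ Real.exp s * (n + 1 : ℝ) ^ s := by
  rw [coeff_binomPS]
  have h1 : Ring.choose (-(s + 1)) n * (-1) ^ n ≤ Real.exp (s * (harmonic n : ℝ)) := by
    induction n with
    | zero => simp
    | succ n ih =>
      have h := succ_mul_choose_succ (-(s + 1)) n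
      have h1 : Ring.choose (-(s + 1)) (n + 1) * (-1) ^ (n + 1) =
          (s * (n + 1 : ℝ)⁻¹ + 1) * (Ring.choose (-(s + 1)) n * (-1) ^ n) := by
        field_simp
        linear_combination (-1) ^ (n + 1) * h
      rw [h1, harmonic_succ]
      push_cast
      rw [mul_add, add_comm (s * (harmonic n : ℝ)), Real.exp_add]
      have h3 := choose_neg_nonneg (s := s + 1) (by linarith) n
      gcongr
      exact Real.add_one_le_exp _
  refine h1.trans ?_
  have h2 : (harmonic n : ℝ) ≤ 1 + Real.log (n + 1) := by
    refine (harmonic_le_one_add_log n).trans ?_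
    rcases Nat.eq_zero_or_pos n with rfl | hn
    · simp
    · gcongr
      linarith
  calc Real.exp (s * (harmonic n : ℝ)) ≤ Real.exp (s * (1 + Real.log (n + 1))) := by gcongr
    _ = Real.exp s * (n + 1 : ℝ) ^ s := by
      rw [Real.rpow_def_of_pos (by positivity), ← Real.exp_add]
      ring_nf

/-! ### Evaluation in the closed unit disc. -/

/-- The value of a power series at `z`. -/
def evalPS {𝕜 : Type*} [RCLike 𝕜] (z : 𝕜) (P : PowerSeries ℝ) : 𝕜 :=
  ∑' n, ((PowerSeries.coeff n P : ℝ) : 𝕜) * z ^ n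

section eval
variable {𝕜 : Type*} [RCLike 𝕜] {z : 𝕜}

lemma AbsSummable.norm_eval {P : PowerSeries ℝ} (hP : AbsSummable P) (hz : ‖z‖ ≤ 1) :
    Summable fun n => ‖((PowerSeries.coeff n P : ℝ) : 𝕜) * z ^ n‖ :=
  Summable.of_nonneg_of_le (fun _ => norm_nonneg _) (fun n => by
    rw [norm_mul, norm_pow, RCLike.norm_ofReal]
    exact mul_le_of_le_one_right (abs_nonneg _) (pow_le_one₀ (norm_nonneg _) hz)) hP

lemma norm_evalPS_le {P : PowerSeries ℝ} (hP : AbsSummable P) (hz : ‖z‖ ≤ 1) :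
    ‖evalPS z P‖ ≤ absSum P := by
  have h := hP.norm_eval hz
  have h1 : ‖evalPS z P‖ ≤ ∑' n, ‖((PowerSeries.coeff n P : ℝ) : 𝕜) * z ^ n‖ := by
    rw [evalPS]
    exact norm_tsum_le_tsum_norm h
  refine h1.trans (Summable.tsum_le_tsum (fun n => ?_) h hP)
  rw [norm_mul, norm_pow, RCLike.norm_ofReal]
  exact mul_le_of_le_one_right (abs_nonneg _) (pow_le_one₀ (norm_nonneg _) hz)

lemma evalPS_add {P Q : PowerSeries ℝ} (hP : AbsSummable P) (hQ : AbsSummable Q)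
    (hz : ‖z‖ ≤ 1) : evalPS z (P + Q) = evalPS z P + evalPS z Q := by
  have h1 := (hP.norm_eval hz).of_norm
  have h2 := (hQ.norm_eval hz).of_norm
  simp only [evalPS]
  rw [← Summable.tsum_add h1 h2]
  simp [add_mul]

lemma evalPS_mul {P Q : PowerSeries ℝ} (hP : AbsSummable P) (hQ : AbsSummable Q)
    (hz : ‖z‖ ≤ 1) : evalPS z (P * Q) = evalPS z P * evalPS z Q := by
  have h1 := hP.norm_eval hz
  have h2 := hQ.norm_eval hz
  simp only [evalPS]
  rw [tsum_mul_tsum_eq_tsum_sum_antidiagonal_of_summable_norm h1 h2]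
  congr 1
  ext n
  rw [PowerSeries.coeff_mul]
  push_cast
  rw [Finset.sum_mul]
  refine Finset.sum_congr rfl fun x hx => ?_
  rw [← Finset.HasAntidiagonal.mem_antidiagonal.1 hx, pow_add]
  ring

lemma evalPS_C (r : ℝ) : evalPS z (PowerSeries.C r) = r := by
  rw [evalPS, tsum_eq_single 0]
  · simp
  · intro n hn
    simp [PowerSeries.coeff_C, hn]

lemma evalPS_one : evalPS z 1 = 1 := by simpa using evalPS_C (z := z) 1

lemma evalPS_X : evalPS z PowerSeries.X = z := by
  rw [evalPS, tsum_eq_single 1]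
  · simp
  · intro n hn
    simp [PowerSeries.coeff_X, hn]

lemma evalPS_one_sub_X (hz : ‖z‖ ≤ 1) : evalPS z (1 - PowerSeries.X) = 1 - z := by
  have h : (1 - PowerSeries.X : PowerSeries ℝ) = 1 + PowerSeries.C (-1) * PowerSeries.X := by
    simp [sub_eq_add_neg]
  rw [h, evalPS_add absSummable_one (absSummable_X.C_mul _) hz,
    evalPS_mul (absSummable_C _) absSummable_X hz, evalPS_one, evalPS_X, evalPS_C]
  simp [sub_eq_add_neg]

lemma evalPS_pow {P : PowerSeries ℝ} (hP : AbsSummable P) (hz : ‖z‖ ≤ 1) (n : ℕ) :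
    evalPS z (P ^ n) = evalPS z P ^ n := by
  induction n with
  | zero => simp [evalPS_one]
  | succ n ih => rw [pow_succ, evalPS_mul (hP.pow n) hP hz, ih, pow_succ]

end eval

lemma evalPS_binomPS_complex {ρ β : ℝ} {z : ℂ} (h : ‖(ρ : ℂ) * z‖ < 1) :
    evalPS z (binomPS ρ β) = (1 + ρ * z) ^ (β : ℂ) := by
  have h1 := (Complex.one_add_cpow_hasFPowerSeriesOnBall_zero (a := (β : ℂ))).hasSum
    (y := ρ * z) (by
      rw [Metric.mem_eball, edist_zero_right, enorm_eq_nnnorm]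
      exact_mod_cast h)
  rw [zero_add] at h1
  rw [← h1.tsum_eq, evalPS]
  congr 1
  ext n
  rw [binomialSeries_apply]
  simp [mul_pow, mul_assoc, Complex.ofReal_choose]

lemma evalPS_binomPS_real {ρ β r : ℝ} (h : |ρ * r| < 1) :
    evalPS r (binomPS ρ β) = (1 + ρ * r) ^ β := by
  have h1 := (Real.one_add_rpow_hasFPowerSeriesOnBall_zero (a := β)).hasSum
    (y := ρ * r) (by
      rw [Metric.mem_eball, edist_zero_right, enorm_eq_nnnorm]
      exact_mod_cast h)
  rw [zero_add] at h1
  rw [← h1.tsum_eq, evalPS]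
  congr 1
  ext n
  rw [binomialSeries_apply]
  simp [mul_pow, mul_assoc]

/-! ### Expansion of (1 + ρX)^α at X = 1 with absolutely summable remainder. -/

lemma choose_two (α : ℝ) : Ring.choose α 2 = α * (α - 1) / 2 := by
  have h := succ_mul_choose_succ α 1
  norm_num at h
  linarith

lemma isBigO_one_add_rpow (α : ℝ) :
    (fun x : ℝ => (1 + x) ^ α - (1 + α * x + α * (α - 1) / 2 * x ^ 2)) =O[𝓝 0]
      fun x => |x| ^ 3 := by
  have h := (Real.one_add_rpow_hasFPowerSeriesAt_zero (a := α)).isBigO_sub_partialSum_pow 3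
  simp only [zero_add, Real.norm_eq_abs] at h
  refine h.congr_left fun x => ?_
  simp only [FormalMultilinearSeries.partialSum, Finset.sum_range_succ, binomialSeries_apply]
  simp [choose_two, pow_two]

lemma quadratic_eq_zero_of_le {K δ₀ δ₁ δ₂ : ℝ}
    (h : ∀ᶠ ε : ℝ in 𝓝[>] 0, |δ₀ + δ₁ * ε + δ₂ * ε ^ 2| ≤ K * ε ^ 3) :
    δ₀ = 0 ∧ δ₁ = 0 ∧ δ₂ = 0 := by
  have key : ∀ f g : ℝ → ℝ, Continuous f → Continuous g → g 0 = 0 →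
      (∀ᶠ ε : ℝ in 𝓝[>] 0, |f ε| ≤ g ε) → f 0 = 0 := by
    intro f g hf hg h0 hle
    have h1 : |f 0| ≤ g 0 := le_of_tendsto_of_tendsto
      ((hf.abs.tendsto 0).mono_left nhdsWithin_le_nhds)
      ((hg.tendsto 0).mono_left nhdsWithin_le_nhds) hle
    rw [h0] at h1
    exact abs_nonpos_iff.1 h1
  have hpos : ∀ᶠ ε : ℝ in 𝓝[>] 0, 0 < ε := self_mem_nhdsWithin
  have e0 : δ₀ = 0 := by
    simpa using key _ _ (by fun_prop) (by fun_prop) (by simp) h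
  subst e0
  have h1 : ∀ᶠ ε : ℝ in 𝓝[>] 0, |δ₁ + δ₂ * ε| ≤ K * ε ^ 2 := by
    filter_upwards [h, hpos] with ε h hε
    have : (0 + δ₁ * ε + δ₂ * ε ^ 2) = ε * (δ₁ + δ₂ * ε) := by ring
    rw [this, abs_mul, abs_of_pos hε] at h
    exact le_of_mul_le_mul_left (by linarith) hε
  have e1 : δ₁ = 0 := by
    simpa using key _ _ (by fun_prop) (by fun_prop) (by simp) h1
  subst e1
  have h2 : ∀ᶠ ε : ℝ in 𝓝[>] 0, |δ₂| ≤ K * ε := by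
    filter_upwards [h1, hpos] with ε h hε
    have : (0 + δ₂ * ε) = ε * δ₂ := by ring
    rw [this, abs_mul, abs_of_pos hε] at h
    exact le_of_mul_le_mul_left (by linarith) hε
  have e2 : δ₂ = 0 := by
    simpa using key (fun _ => δ₂) _ (by fun_prop) (by fun_prop) (by simp) h2
  exact ⟨rfl, rfl, e2⟩

/-- `P` has an expansion of order three at `1` with absolutely summable remainder. -/
def HasExpansion (P : PowerSeries ℝ) (c₀ c₁ c₂ : ℝ) (R : PowerSeries ℝ) : Prop :=
  AbsSummable R ∧ P = PowerSeries.C c₀ + PowerSeries.C c₁ * (1 - PowerSeries.X) +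
    PowerSeries.C c₂ * (1 - PowerSeries.X) ^ 2 + (1 - PowerSeries.X) ^ 3 * R

/-- Three divisions by 1 − X cost two powers of n each, and β > 6 pays for all six. -/
lemma exists_hasExpansion_of_large {ρ β : ℝ} (hρ : |ρ| ≤ 1) (hβ : 6 < β) :
    ∃ c₀ c₁ c₂ R, HasExpansion (binomPS ρ β) c₀ c₁ c₂ R := by
  have h6 : Summable fun n : ℕ => (n + 1 : ℝ) ^ (4 + 2) * |PowerSeries.coeff n (binomPS ρ β)| :=
    Summable.of_nonneg_of_le (fun _ => by positivity) (fun n => by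
      rw [coeff_binomPS, abs_mul, abs_pow]
      gcongr
      exact mul_le_of_le_one_right (abs_nonneg _) (pow_le_one₀ (abs_nonneg _) hρ))
      (summable_pow_mul_abs_choose 6 (by norm_num [hβ]))
  obtain ⟨c₀, R₀, e₀, h4⟩ := exists_div_one_sub_X h6
  obtain ⟨c₁, R₁, e₁, h2⟩ := exists_div_one_sub_X (p := 2) h4
  obtain ⟨c₂, R₂, e₂, h0⟩ := exists_div_one_sub_X (p := 0) h2
  refine ⟨c₀, c₁, c₂, R₂, ?_, ?_⟩
  · simpa [AbsSummable] using h0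
  · rw [e₀, e₁, e₂]
    ring

/-- With V = 1 − X and κ = 1/(1+ρ) one has 1 + ρX = (1+ρ)(1 − κρV). Hence F = (1+ρX)^β and G =
(1+ρX)^(β+1) satisfy F = κG + κρVF. Three substitutions move the unexpanded F behind V³, where its
absolute summability is enough. -/
lemma exists_hasExpansion_of_add_one {ρ β : ℝ} (hρ₀ : 0 ≤ ρ) (hρ : ρ ≤ 1) (hβ : 0 < β)
    (h : ∃ c₀ c₁ c₂ R, HasExpansion (binomPS ρ (β + 1)) c₀ c₁ c₂ R) :
    ∃ c₀ c₁ c₂ R, HasExpansion (binomPS ρ β) c₀ c₁ c₂ R := by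
  obtain ⟨c₀, c₁, c₂, R, hR, e⟩ := h
  have hF : AbsSummable (binomPS ρ β) := absSummable_binomPS (by rwa [abs_of_nonneg hρ₀]) hβ
  set F := binomPS ρ β with hFdef
  set V : PowerSeries ℝ := 1 - PowerSeries.X with hV
  set κ : ℝ := (1 + ρ)⁻¹ with hκ
  have hκ1 : PowerSeries.C κ * (1 + PowerSeries.C ρ) = 1 := by
    rw [← map_one PowerSeries.C, ← map_add, ← map_mul, hκ, inv_mul_cancel₀ (by positivity)]
  have e1 : binomPS ρ (β + 1) = F * (1 + PowerSeries.C ρ * PowerSeries.X) := by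
    rw [binomPS_add]
    have := binomPS_natCast ρ 1
    rw [Nat.cast_one, pow_one] at this
    rw [this]
  rw [e] at e1
  set k := PowerSeries.C κ
  set r := PowerSeries.C ρ
  set a₀ := PowerSeries.C c₀ with ha₀
  set a₁ := PowerSeries.C c₁
  set a₂ := PowerSeries.C c₂
  set G := a₀ + a₁ * V + a₂ * V ^ 2 + V ^ 3 * R with hG
  have e2 : F = k * G + k * r * V * F := by
    have hX : PowerSeries.X = 1 - V := by rw [hV]; ring
    rw [hX] at e1
    linear_combination (-F) * hκ1 - k * e1
  have e3 : F = k * G + k ^ 2 * r * V * G + k ^ 3 * r ^ 2 * V ^ 2 * G +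
      k ^ 3 * r ^ 3 * V ^ 3 * F := by
    linear_combination (1 + k * r * V + k ^ 2 * r ^ 2 * V ^ 2) * e2
  have sV : AbsSummable V := absSummable_one_sub_X
  have sk : AbsSummable k := absSummable_C _
  have sr : AbsSummable r := absSummable_C _
  have s1 : AbsSummable a₁ := absSummable_C _
  have s2 : AbsSummable a₂ := absSummable_C _
  refine ⟨κ * c₀, κ * c₁ + κ ^ 2 * ρ * c₀, κ * c₂ + κ ^ 2 * ρ * c₁ + κ ^ 3 * ρ ^ 2 * c₀,
    k * R + k ^ 2 * r * (a₂ + V * R) + k ^ 3 * r ^ 2 * (a₁ + V * a₂ + V ^ 2 * R) +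
      k ^ 3 * r ^ 3 * F, ?_, ?_⟩
  · exact (((sk.mul hR).add (((sk.pow 2).mul sr).mul (s2.add (sV.mul hR)))).add
      (((sk.pow 3).mul (sr.pow 2)).mul ((s1.add (sV.mul s2)).add ((sV.pow 2).mul hR)))).add
      (((sk.pow 3).mul (sr.pow 3)).mul hF)
  · simp only [map_add, map_mul, map_pow, show PowerSeries.C κ = k from rfl,
      show PowerSeries.C ρ = r from rfl, show PowerSeries.C c₀ = a₀ from rfl,
      show PowerSeries.C c₁ = a₁ from rfl, show PowerSeries.C c₂ = a₂ from rfl, ← hV]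
    refine e3.trans ?_
    rw [hG]
    ring

lemma exists_hasExpansion {ρ β : ℝ} (hρ₀ : 0 ≤ ρ) (hρ : ρ ≤ 1) (hβ : 0 < β) :
    ∃ c₀ c₁ c₂ R, HasExpansion (binomPS ρ β) c₀ c₁ c₂ R := by
  have key : ∀ n : ℕ, ∀ β : ℝ, 0 < β → 6 < β + n →
      ∃ c₀ c₁ c₂ R, HasExpansion (binomPS ρ β) c₀ c₁ c₂ R := by
    intro n
    induction n with
    | zero =>
      intro β _ h
      exact exists_hasExpansion_of_large (by rwa [abs_of_nonneg hρ₀]) (by simpa using h)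
    | succ n ih =>
      intro β hβ h
      refine exists_hasExpansion_of_add_one hρ₀ hρ hβ (ih (β + 1) (by linarith) ?_)
      push_cast at h
      linarith
  exact key 7 β hβ (by norm_num; linarith)

/-- The coefficients of the abstract expansion are identified by evaluation at X = 1 − ε, ε → 0+,
where 1 + ρX = (1+ρ)(1 − σε) with σ = ρ/(1+ρ). Both expansions hold up to O(ε³), so they agree. -/
lemma hasExpansion_binomPS {ρ α : ℝ} (hρ₀ : 0 ≤ ρ) (hρ : ρ ≤ 1) (hα : 0 < α) :
    ∃ R, AbsSummable R ∧ binomPS ρ α = PowerSeries.C ((1 + ρ) ^ α) *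
      (1 - PowerSeries.C (α * (ρ / (1 + ρ))) * (1 - PowerSeries.X) +
        PowerSeries.C (α * (α - 1) / 2 * (ρ / (1 + ρ)) ^ 2) * (1 - PowerSeries.X) ^ 2 +
        (1 - PowerSeries.X) ^ 3 * R) := by
  obtain ⟨c₀, c₁, c₂, R, hR, e⟩ := exists_hasExpansion hρ₀ hρ hα
  set σ := ρ / (1 + ρ) with hσ
  set A := (1 + ρ) ^ α with hA
  have hA0 : 0 < A := by positivity
  have heval : ∀ ε : ℝ, 0 < ε → ε < 1 → (1 + ρ * (1 - ε)) ^ α =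
      c₀ + c₁ * ε + c₂ * ε ^ 2 + ε ^ 3 * evalPS (1 - ε) R := by
    intro ε h0 h1
    have hz : ‖(1 - ε : ℝ)‖ ≤ 1 := by rw [Real.norm_eq_abs, abs_of_pos (by linarith)]; linarith
    have hlt : |ρ * (1 - ε)| < 1 := by
      rw [abs_of_nonneg (mul_nonneg hρ₀ (by linarith))]
      nlinarith
    rw [← evalPS_binomPS_real hlt, e]
    have sV := absSummable_one_sub_X
    have s1 := sV.C_mul c₁
    have s2 := (sV.pow 2).C_mul c₂
    have s3 := (sV.pow 3).mul hR
    rw [evalPS_add (((absSummable_C _).add s1).add s2) s3 hz,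
      evalPS_add ((absSummable_C _).add s1) s2 hz, evalPS_add (absSummable_C _) s1 hz,
      evalPS_mul (sV.pow 3) hR hz, evalPS_mul (absSummable_C _) (sV.pow 2) hz,
      evalPS_mul (absSummable_C _) sV hz, evalPS_pow sV hz, evalPS_pow sV hz,
      evalPS_one_sub_X hz, evalPS_C, evalPS_C, evalPS_C]
    simp
  have hT := isBigO_one_add_rpow α
  have htend : Tendsto (fun ε : ℝ => -σ * ε) (𝓝[>] 0) (𝓝 0) := by
    have : Tendsto (fun ε : ℝ => -σ * ε) (𝓝 0) (𝓝 (-σ * 0)) :=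
      (continuous_const.mul continuous_id).tendsto 0
    rw [mul_zero] at this
    exact this.mono_left nhdsWithin_le_nhds
  obtain ⟨K, hK⟩ := (hT.comp_tendsto htend).bound
  have hpos : ∀ᶠ ε : ℝ in 𝓝[>] 0, 0 < ε := self_mem_nhdsWithin
  have hlt1 : ∀ᶠ ε : ℝ in 𝓝[>] 0, ε < 1 := nhdsWithin_le_nhds (gt_mem_nhds one_pos)
  have hσ0 : 0 ≤ σ := by positivity
  have hq := quadratic_eq_zero_of_le (K := absSum R + A * (K * σ ^ 3)) (δ₀ := A - c₀)
    (δ₁ := -(A * (α * σ)) - c₁) (δ₂ := A * (α * (α - 1) / 2 * σ ^ 2) - c₂) (by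
      filter_upwards [hK, hpos, hlt1] with ε hK h0 h1
      simp only [Function.comp, Real.norm_eq_abs] at hK
      have hz : ‖(1 - ε : ℝ)‖ ≤ 1 := by rw [Real.norm_eq_abs, abs_of_pos (by linarith)]; linarith
      have hE : |evalPS (1 - ε) R| ≤ absSum R := norm_evalPS_le hR hz
      have hσ1 : 1 + -σ * ε = (1 + ρ * (1 - ε)) / (1 + ρ) := by
        rw [hσ]
        field_simp
        ring
      have hm : (1 + ρ * (1 - ε)) ^ α = A * (1 + -σ * ε) ^ α := by
        rw [hσ1, Real.div_rpow (by nlinarith) (by linarith), hA]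
        field_simp
      rw [heval ε h0 h1] at hm
      have hid : A - c₀ + (-(A * (α * σ)) - c₁) * ε + (A * (α * (α - 1) / 2 * σ ^ 2) - c₂) * ε ^ 2
          = ε ^ 3 * evalPS (1 - ε) R - A * ((1 + -σ * ε) ^ α -
            (1 + α * (-σ * ε) + α * (α - 1) / 2 * (-σ * ε) ^ 2)) := by
        linear_combination -hm
      rw [hid]
      refine (abs_sub _ _).trans ?_
      rw [abs_mul, abs_mul, abs_of_pos hA0, abs_of_pos (pow_pos h0 3)]
      have h3 : |(|-σ * ε| ^ 3)| = σ ^ 3 * ε ^ 3 := by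
        rw [abs_pow, abs_abs, abs_mul, abs_neg, abs_of_nonneg hσ0, abs_of_pos h0, mul_pow]
      rw [h3] at hK
      calc _ ≤ ε ^ 3 * absSum R + A * (K * (σ ^ 3 * ε ^ 3)) := by gcongr
        _ = _ := by ring)
  obtain ⟨h0, h1, h2⟩ := hq
  refine ⟨PowerSeries.C A⁻¹ * R, hR.C_mul _, ?_⟩
  have hAA : PowerSeries.C A * PowerSeries.C A⁻¹ = (1 : PowerSeries ℝ) := by
    rw [← map_mul, mul_inv_cancel₀ hA0.ne', map_one]
  rw [e, show c₀ = A by linarith, show c₁ = A * -(α * σ) by linarith,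
    show c₂ = A * (α * (α - 1) / 2 * σ ^ 2) by linarith, map_mul, map_neg, map_mul _ A]
  linear_combination (-(1 - PowerSeries.X) ^ 3 * R) * hAA

/-! ### Mesh halving: the substitution X ↦ X². -/

/-- The power series `P(X²)`. -/
def evenPS (P : PowerSeries ℝ) : PowerSeries ℝ :=
  PowerSeries.mk fun n => if Even n then PowerSeries.coeff (n / 2) P else 0

lemma evenPS_add (P Q : PowerSeries ℝ) : evenPS (P + Q) = evenPS P + evenPS Q := by
  ext n
  simp only [evenPS, PowerSeries.coeff_mk, map_add]
  split_ifs <;> simp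

lemma evenPS_C_mul (r : ℝ) (P : PowerSeries ℝ) :
    evenPS (PowerSeries.C r * P) = PowerSeries.C r * evenPS P := by
  ext n
  simp only [evenPS, PowerSeries.coeff_mk, PowerSeries.coeff_C_mul]
  split_ifs <;> simp

lemma derivative_binomPS (ρ β : ℝ) :
    PowerSeries.derivative ℝ (binomPS ρ β) * (1 + PowerSeries.C ρ * PowerSeries.X) =
      PowerSeries.C (β * ρ) * binomPS ρ β := by
  ext n
  rw [mul_add, mul_one, map_add, PowerSeries.coeff_derivative, PowerSeries.coeff_C_mul]
  rw [show PowerSeries.derivative ℝ (binomPS ρ β) * (PowerSeries.C ρ * PowerSeries.X) =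
    PowerSeries.C ρ * (PowerSeries.derivative ℝ (binomPS ρ β) * PowerSeries.X) by ring,
    PowerSeries.coeff_C_mul]
  have h := succ_mul_choose_succ β n
  cases n with
  | zero => simp
  | succ n =>
    rw [PowerSeries.coeff_succ_mul_X, PowerSeries.coeff_derivative]
    simp only [coeff_binomPS]
    push_cast at *
    linear_combination ρ ^ (n + 2) * h

/-- The product Q satisfies (1 − X²) Q' = −2β X Q, the differential equation of (1 − X²)^β; the
recursion is read off from it. -/
lemma coeff_binomPS_mul_recursion (β : ℝ) (n : ℕ) :
    (n + 2 : ℝ) * PowerSeries.coeff (n + 2) (binomPS (-1) β * binomPS 1 β) =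
      (n - 2 * β) * PowerSeries.coeff n (binomPS (-1) β * binomPS 1 β) := by
  set Q := binomPS (-1) β * binomPS 1 β with hQ
  have h1 := derivative_binomPS (-1) β
  have h2 := derivative_binomPS 1 β
  have h3 : PowerSeries.derivative ℝ Q - PowerSeries.X * (PowerSeries.X *
      PowerSeries.derivative ℝ Q) = PowerSeries.C (-2 * β) * (PowerSeries.X * Q) := by
    have hC : PowerSeries.C (-2 * β) = (-2 : PowerSeries ℝ) * PowerSeries.C β := by
      rw [map_mul, map_neg, map_ofNat]
    rw [hQ, Derivation.leibniz, hC]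
    simp only [smul_eq_mul, map_mul, map_neg, map_one] at *
    linear_combination (binomPS 1 β) * (1 + PowerSeries.X) * h1 +
      (binomPS (-1) β) * (1 - PowerSeries.X) * h2
  have h4 := congrArg (PowerSeries.coeff (n + 1)) h3
  rw [map_sub, PowerSeries.coeff_succ_X_mul, PowerSeries.coeff_C_mul,
    PowerSeries.coeff_succ_X_mul, PowerSeries.coeff_derivative] at h4
  have h5 : PowerSeries.coeff n (PowerSeries.X * PowerSeries.derivative ℝ Q) =
      n * PowerSeries.coeff n Q := by
    cases n with
    | zero => simp
    | succ n =>
      rw [PowerSeries.coeff_succ_X_mul, PowerSeries.coeff_derivative]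
      push_cast
      ring
  rw [h5] at h4
  push_cast at h4
  linear_combination h4

/-- This is (1 − X²)^β = (1 − X)^β (1 + X)^β. The two-step recursion determines the even and odd
coefficients from those of index 0 and 1. -/
lemma evenPS_binomPS (β : ℝ) : evenPS (binomPS (-1) β) = binomPS (-1) β * binomPS 1 β := by
  have key : ∀ j : ℕ,
      PowerSeries.coeff (2 * j) (binomPS (-1) β * binomPS 1 β) = Ring.choose β j * (-1) ^ j ∧
      PowerSeries.coeff (2 * j + 1) (binomPS (-1) β * binomPS 1 β) = 0 := by
    intro j
    induction j with
    | zero =>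
      constructor
      · simp [PowerSeries.coeff_mul]
      · simp [PowerSeries.coeff_mul, Finset.Nat.antidiagonal_succ]
    | succ j ih =>
      have h0 := coeff_binomPS_mul_recursion β (2 * j)
      have h1 := coeff_binomPS_mul_recursion β (2 * j + 1)
      rw [ih.1] at h0
      rw [ih.2, mul_zero] at h1
      constructor
      · have h := succ_mul_choose_succ β j
        have hj : (2 * j + 2 : ℝ) ≠ 0 := by positivity
        rw [show 2 * (j + 1) = 2 * j + 2 by ring]
        apply mul_left_cancel₀ hj
        push_cast at h0
        linear_combination h0 + 2 * (-1) ^ j * h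
      · rw [show 2 * (j + 1) + 1 = 2 * j + 1 + 2 by ring]
        refine (mul_eq_zero.1 h1).resolve_left ?_
        positivity
  ext n
  rw [evenPS, PowerSeries.coeff_mk]
  rcases Nat.even_or_odd' n with ⟨j, rfl | rfl⟩
  · rw [(key j).1, if_pos (even_two_mul j)]
    simp
  · rw [(key j).2, if_neg (by simp)]

lemma sum_range_two_mul_of_odd {f : ℕ → ℝ} (hf : ∀ j, f (2 * j + 1) = 0) (n : ℕ) :
    ∑ i ∈ Finset.range (2 * n + 1), f i = ∑ j ∈ Finset.range (n + 1), f (2 * j) := by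
  induction n with
  | zero => simp
  | succ n ih =>
    rw [Finset.sum_range_succ _ (n + 1), ← ih, show 2 * (n + 1) + 1 = 2 * n + 1 + 1 + 1 by ring,
      Finset.sum_range_succ, Finset.sum_range_succ, hf, add_zero]
    rfl

/-- P(X²) meets only every second grid value, so a formula on the coarse grid becomes one on the
grid of half the mesh size. -/
lemma coeff_evenPS_mul (P G : PowerSeries ℝ) (n : ℕ) :
    PowerSeries.coeff (2 * n) (evenPS P * G) =
      PowerSeries.coeff n (P * PowerSeries.mk fun j => PowerSeries.coeff (2 * j) G) := by
  rw [PowerSeries.coeff_mul, PowerSeries.coeff_mul,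
    Finset.Nat.sum_antidiagonal_eq_sum_range_succ
      (fun i j => PowerSeries.coeff i (evenPS P) * PowerSeries.coeff j G),
    Finset.Nat.sum_antidiagonal_eq_sum_range_succ (fun i j => PowerSeries.coeff i P *
      PowerSeries.coeff j (PowerSeries.mk fun j => PowerSeries.coeff (2 * j) G)),
    Nat.succ_eq_add_one, sum_range_two_mul_of_odd]
  · refine Finset.sum_congr rfl fun j _ => ?_
    simp [evenPS, Nat.mul_sub]
  · intro j
    simp [evenPS]

lemma abs_coeff_mul_le {P H : PowerSeries ℝ} {D : ℝ} {n : ℕ}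
    (hH : ∀ m ≤ n, |PowerSeries.coeff m H| ≤ D) :
    |PowerSeries.coeff n (P * H)| ≤
      (∑ i ∈ Finset.range (n + 1), |PowerSeries.coeff i P|) * D := by
  rw [PowerSeries.coeff_mul, Finset.Nat.sum_antidiagonal_eq_sum_range_succ
    (fun i j => PowerSeries.coeff i P * PowerSeries.coeff j H), Nat.succ_eq_add_one,
    Finset.sum_mul]
  refine (Finset.abs_sum_le_sum_abs _ _).trans (Finset.sum_le_sum fun i _ => ?_)
  rw [abs_mul]
  exact mul_le_mul_of_nonneg_left (hH _ (Nat.sub_le _ _)) (abs_nonneg _)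

/-- The coefficients of (1 − X)^(−s) are nonnegative, so the sum of their absolute values is a
coefficient of (1 − X)^(−s−1), which grows only like n^s. -/
lemma abs_coeff_binomPS_mul_le {s : ℝ} (hs : 0 ≤ s) {R H : PowerSeries ℝ} (hR : AbsSummable R)
    {D : ℝ} {n : ℕ} (hH : ∀ m ≤ n, |PowerSeries.coeff m H| ≤ D) :
    |PowerSeries.coeff n (binomPS (-1) (-s) * (R * H))| ≤
      Real.exp s * (n + 1 : ℝ) ^ s * (absSum R * D) := by
  have hD : 0 ≤ D := (abs_nonneg _).trans (hH 0 (Nat.zero_le _))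
  have h1 : ∀ m ≤ n, |PowerSeries.coeff m (R * H)| ≤ absSum R * D := by
    intro m hm
    refine (abs_coeff_mul_le fun l hl => hH l (hl.trans hm)).trans ?_
    exact mul_le_mul_of_nonneg_right (hR.sum_le_tsum _ fun _ _ => abs_nonneg _) hD
  refine (abs_coeff_mul_le h1).trans ?_
  refine mul_le_mul_of_nonneg_right ?_ (mul_nonneg (absSum_nonneg R) hD)
  rw [Finset.sum_congr rfl fun i _ => abs_of_nonneg (a := PowerSeries.coeff i (binomPS (-1) (-s)))
    (by rw [coeff_binomPS]; exact choose_neg_nonneg hs i), sum_range_succ_coeff_binomPS_neg]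
  exact coeff_binomPS_neg_le hs n

/-! ### Third order approximation of the Grünwald–Letnikov derivative. -/

/-- The power series whose coefficients are the values of `γ` on the grid `η ℕ`. -/
def gridPS (γ : ℝ → ℝ) (η : ℝ) : PowerSeries ℝ := PowerSeries.mk fun n => γ (n * η)

/-- The backward differences of order `k` of `γ`, extended by zero to the left of `0`, are bounded
by `B η ^ k` on `[0, X]`. -/
def DiffBound (k : ℕ) (B X : ℝ) (γ : ℝ → ℝ) : Prop :=
  ∀ η : ℝ, 0 < η → ∀ n : ℕ, n * η ≤ X →
    |PowerSeries.coeff n ((1 - PowerSeries.X) ^ k * gridPS γ η)| ≤ B * η ^ k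

/-- A difference of order α + r is a fractional sum of order s = k − α − r ≥ 0 of k-th differences.
Of the factor η^k, the part η^α cancels the prefactor, η^s turns the growth (n+1)^s into at most
(2X)^s, and η^r remains. -/
lemma DiffBound.abs_le {k : ℕ} {B X : ℝ} {γ : ℝ → ℝ} (h : DiffBound k B X γ) {α : ℝ} {r : ℕ}
    (hr : α + r ≤ k) {R : PowerSeries ℝ} (hR : AbsSummable R) {η : ℝ} (hη : 0 < η) {n : ℕ}
    (hn : n * η ≤ X) (hn2 : (n + 1) * η ≤ 2 * X) :
    |1 / η ^ α * PowerSeries.coeff n (binomPS (-1) (α + r) * (R * gridPS γ η))| ≤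
      Real.exp (k - (α + r)) * (2 * X) ^ (k - (α + r)) * absSum R * B * η ^ r := by
  set s : ℝ := k - (α + r) with hs
  have hs0 : 0 ≤ s := by linarith
  have hB : ∀ m ≤ n, |PowerSeries.coeff m ((1 - PowerSeries.X) ^ k * gridPS γ η)| ≤ B * η ^ k :=
    fun m hm => h η hη m (le_trans (by gcongr) hn)
  have hB0 : 0 ≤ B * η ^ k := (abs_nonneg _).trans (hB 0 (Nat.zero_le _))
  have e : binomPS (-1) (α + r) * (R * gridPS γ η) =
      binomPS (-1) (-s) * (R * ((1 - PowerSeries.X) ^ k * gridPS γ η)) := by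
    rw [show α + r = -s + k by rw [hs]; ring, binomPS_add, binomPS_neg_one_natCast]
    ring
  have h1 := abs_coeff_binomPS_mul_le hs0 hR hB
  have hpow : η ^ k = η ^ s * η ^ α * η ^ r := by
    rw [← Real.rpow_natCast, ← Real.rpow_natCast, ← Real.rpow_add hη, ← Real.rpow_add hη, hs]
    ring_nf
  have hαpos : 0 < η ^ α := Real.rpow_pos_of_pos hη α
  rw [e, abs_mul, abs_of_pos (by positivity)]
  calc _ ≤ 1 / η ^ α * (Real.exp s * (n + 1 : ℝ) ^ s * (absSum R * (B * η ^ k))) := by gcongr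
    _ = Real.exp s * ((n + 1) * η) ^ s * absSum R * B * η ^ r := by
      rw [Real.mul_rpow (by positivity) hη.le, hpow]
      field_simp
    _ ≤ _ := by
      have hBB : 0 ≤ B := nonneg_of_mul_nonneg_left hB0 (by positivity)
      have := absSum_nonneg R
      gcongr

/-- The factor which makes the Grünwald formula third order accurate. -/
def corrPS (α : ℝ) : PowerSeries ℝ :=
  1 + PowerSeries.C (α / 2) * (1 - PowerSeries.X) +
    PowerSeries.C ((3 * α ^ 2 + 5 * α) / 24) * (1 - PowerSeries.X) ^ 2

/-- The unshifted third order approximation of the derivative of order `α` at `n η`. -/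
def corrGL (α : ℝ) (γ : ℝ → ℝ) (η : ℝ) (n : ℕ) : ℝ :=
  1 / η ^ α * PowerSeries.coeff n (binomPS (-1) α * (corrPS α * gridPS γ η))

lemma binomPS_neg_one_add_natCast (α : ℝ) (r : ℕ) :
    binomPS (-1) (α + r) = (1 - PowerSeries.X) ^ r * binomPS (-1) α := by
  rw [binomPS_add, binomPS_neg_one_natCast, mul_comm]

lemma evenPS_binomPS_mul_corrPS (α : ℝ) :
    evenPS (binomPS (-1) α * corrPS α) = binomPS (-1) α * binomPS 1 α *
      (1 + PowerSeries.C (α / 2) * (1 - PowerSeries.X) * (1 + PowerSeries.X) +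
        PowerSeries.C ((3 * α ^ 2 + 5 * α) / 24) *
          ((1 - PowerSeries.X) * (1 + PowerSeries.X)) ^ 2) := by
  have e : binomPS (-1) α * corrPS α = binomPS (-1) α +
      PowerSeries.C (α / 2) * binomPS (-1) (α + (1 : ℕ)) +
      PowerSeries.C ((3 * α ^ 2 + 5 * α) / 24) * binomPS (-1) (α + (2 : ℕ)) := by
    rw [binomPS_neg_one_add_natCast, binomPS_neg_one_add_natCast, corrPS]
    ring
  rw [e, evenPS_add, evenPS_add, evenPS_C_mul, evenPS_C_mul, evenPS_binomPS, evenPS_binomPS,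
    evenPS_binomPS, binomPS_neg_one_add_natCast, binomPS_neg_one_add_natCast,
    binomPS_add 1, binomPS_add 1, binomPS_natCast, binomPS_natCast, map_one]
  ring

/-- Factoring (1 − X²)^α leaves (1+X)^α, which is expanded at X = 1; since 1 + X = 2 − V, everything
is a polynomial in V plus V³ times a summable series. The correction factor is chosen so that the
terms up to V² are reproduced. -/
lemma exists_evenPS_sub {α : ℝ} (hα : 0 < α) : ∃ R, AbsSummable R ∧
    evenPS (binomPS (-1) α * corrPS α) =
      PowerSeries.C (2 ^ α) * (binomPS (-1) α * corrPS α + binomPS (-1) (α + (3 : ℕ)) * R) := by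
  obtain ⟨R, hR, e⟩ := hasExpansion_binomPS (ρ := 1) zero_le_one le_rfl hα
  rw [show (1 : ℝ) + 1 = 2 by norm_num, show ((1 : ℝ) / 2) ^ 2 = 1 / 4 by norm_num] at e
  rw [evenPS_binomPS_mul_corrPS, e, binomPS_neg_one_add_natCast, corrPS]
  set V : PowerSeries ℝ := 1 - PowerSeries.X with hV
  have hX : (1 + PowerSeries.X : PowerSeries ℝ) = 2 - V := by rw [hV]; ring
  rw [hX]
  set a := PowerSeries.C (α * (1 / 2)) with ha
  set b := PowerSeries.C (α * (α - 1) / 2 * (1 / 4)) with hb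
  set d := PowerSeries.C ((3 * α ^ 2 + 5 * α) / 24) with hd
  have e1 : PowerSeries.C (α / 2) = a := by rw [ha]; ring_nf
  -- Equality of the V² coefficients; this fixes d = (3α² + 5α)/24. The V coefficients agree because
  -- −a + 2a = a.
  have e2 : b - 2 * a * a - a + 3 * d = 0 := by
    have h : α * (α - 1) / 2 * (1 / 4) - 2 * (α * (1 / 2)) * (α * (1 / 2)) - α * (1 / 2) +
      3 * ((3 * α ^ 2 + 5 * α) / 24) = 0 := by ring
    have h2 := congrArg (PowerSeries.C (R := ℝ)) h
    rw [map_add, map_sub, map_sub, map_mul _ (2 * _), map_mul _ 2, map_mul _ 3, map_zero,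
      map_ofNat, map_ofNat] at h2
    exact h2
  rw [e1]
  have sV : AbsSummable V := absSummable_one_sub_X
  have sa : AbsSummable a := absSummable_C _
  have sb : AbsSummable b := absSummable_C _
  have sd : AbsSummable d := absSummable_C _
  have s2 : AbsSummable (2 : PowerSeries ℝ) := by
    rw [← map_ofNat (PowerSeries.C (R := ℝ)) 2]
    exact absSummable_C _
  refine ⟨R * (1 + a * V * (2 - V) + d * (V * (2 - V)) ^ 2) +
    (a * (a - 2 * 2 * d) + b * (2 * a - a * V + d * V * (2 - V) ^ 2)) +
      d * (V - 2 * 2) + a * d * (2 * 2 * V - V * V), ?_, ?_⟩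
  · have t2V := s2.sub sV
    have s22 := s2.mul s2
    exact (((hR.mul ((absSummable_one.add ((sa.mul sV).mul t2V)).add
      (sd.mul ((sV.mul t2V).pow 2)))).add
      ((sa.mul (sa.sub (s22.mul sd))).add (sb.mul (((s2.mul sa).sub (sa.mul sV)).add
      ((sd.mul sV).mul (t2V.pow 2)))))).add (sd.mul (sV.sub s22))).add
      ((sa.mul sd).mul ((s22.mul sV).sub (sV.mul sV)))
  · linear_combination (PowerSeries.C (2 ^ α) * binomPS (-1) α * V ^ 2) * e2

lemma gridPS_half (γ : ℝ → ℝ) (h : ℝ) :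
    (PowerSeries.mk fun j => PowerSeries.coeff (2 * j) (gridPS γ (h / 2))) = gridPS γ h := by
  ext j
  simp only [gridPS, PowerSeries.coeff_mk]
  congr 1
  push_cast
  ring

/-- Written on the finer grid, both formulas have the same leading series: the factor 2^α from the
expansion cancels against (η/2)^α. Only the V^(α+3) remainder survives. -/
lemma exists_abs_corrGL_sub_half_le {α : ℝ} (hα : 0 < α) {k : ℕ} (hk : α + 3 ≤ k) {X : ℝ} :
    ∃ C : ℝ, 0 ≤ C ∧ ∀ (γ : ℝ → ℝ) (B : ℝ), DiffBound k B X γ → ∀ η : ℝ, 0 < η → η ≤ X →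
      ∀ n : ℕ, n * η ≤ X →
        |corrGL α γ η n - corrGL α γ (η / 2) (2 * n)| ≤ C * B * η ^ 3 := by
  obtain ⟨R, hR, e⟩ := exists_evenPS_sub hα
  refine ⟨|Real.exp (k - (α + 3)) * (2 * X) ^ (k - (α + 3)) * absSum R|, abs_nonneg _, ?_⟩
  intro γ B hB η hη hηX n hn
  have hB0 : 0 ≤ B := by
    have := (abs_nonneg _).trans (hB η hη 0 (by simpa using hη.le.trans hηX))
    exact nonneg_of_mul_nonneg_left this (by positivity)
  have h1 := hB.abs_le (α := α) (r := 3) (by exact_mod_cast hk) hR (η := η / 2) (by linarith)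
    (n := 2 * n) (by push_cast; linarith) (by push_cast; linarith)
  have e1 : corrGL α γ η n - corrGL α γ (η / 2) (2 * n) =
      1 / (η / 2) ^ α * PowerSeries.coeff (2 * n)
        (binomPS (-1) (α + (3 : ℕ)) * (R * gridPS γ (η / 2))) := by
    rw [corrGL, corrGL, ← mul_assoc, ← gridPS_half, ← coeff_evenPS_mul, e, mul_assoc,
      PowerSeries.coeff_C_mul, add_mul, map_add,
      ← mul_assoc (binomPS (-1) α), Real.div_rpow hη.le zero_le_two]
    have : (0:ℝ) < η ^ α := Real.rpow_pos_of_pos hη α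
    have : (0:ℝ) < 2 ^ α := Real.rpow_pos_of_pos two_pos α
    field_simp
    rw [mul_assoc (binomPS (-1) (α + (3:ℕ)))]
    ring
  rw [e1]
  refine h1.trans ?_
  push_cast
  have h2 : (η / 2) ^ 3 ≤ η ^ 3 := by gcongr; linarith
  gcongr
  exact le_abs_self _

/-- The correction factor minus 1 is divisible by 1 − X, which gains one order. This suffices to
identify the limit under refinement. -/
lemma exists_abs_corrGL_sub_GL_le {α : ℝ} {k : ℕ} (hk : α + 3 ≤ k) {X : ℝ} :
    ∃ C : ℝ, ∀ (γ : ℝ → ℝ) (B : ℝ), DiffBound k B X γ → ∀ η : ℝ, 0 < η → η ≤ X →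
      ∀ n : ℕ, n * η ≤ X →
        |corrGL α γ η n - 1 / η ^ α * PowerSeries.coeff n (binomPS (-1) α * gridPS γ η)| ≤
          C * B * η := by
  set R : PowerSeries ℝ := PowerSeries.C (α / 2) +
    PowerSeries.C ((3 * α ^ 2 + 5 * α) / 24) * (1 - PowerSeries.X) with hRdef
  have hR : AbsSummable R := (absSummable_C _).add ((absSummable_C _).mul absSummable_one_sub_X)
  refine ⟨Real.exp (k - (α + 1)) * (2 * X) ^ (k - (α + 1)) * absSum R, ?_⟩
  intro γ B hB η hη hηX n hn
  have h1 := hB.abs_le (α := α) (r := 1) (by push_cast; linarith) hR hη (n := n) hn (by linarith)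
  have e1 : corrGL α γ η n - 1 / η ^ α * PowerSeries.coeff n (binomPS (-1) α * gridPS γ η) =
      1 / η ^ α * PowerSeries.coeff n (binomPS (-1) (α + (1 : ℕ)) * (R * gridPS γ η)) := by
    rw [corrGL, ← mul_sub, ← map_sub, binomPS_neg_one_add_natCast, hRdef, corrPS]
    congr 2
    ring
  rw [e1]
  simpa using h1

lemma IsLeftGLDeriv.tendsto_grid {α h L : ℝ} {γ : ℝ → ℝ} {i : ℕ} (hh : 0 < h)
    (hL : IsLeftGLDeriv α 0 γ (i * h) L) :
    Tendsto (fun m : ℕ => 1 / (h / 2 ^ m) ^ α * PowerSeries.coeff (2 ^ m * i)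
      (binomPS (-1) α * gridPS γ (h / 2 ^ m))) atTop (𝓝 L) := by
  have ht : Tendsto (fun m : ℕ => h / 2 ^ m) atTop (𝓝[>] 0) := by
    refine tendsto_nhdsWithin_iff.2 ⟨?_, Eventually.of_forall fun m => ?_⟩
    · exact tendsto_const_nhds.div_atTop (tendsto_pow_atTop_atTop_of_one_lt one_lt_two)
    · exact div_pos hh (by positivity)
  refine (hL.comp ht).congr fun m => ?_
  have hfl : ⌊(i * h - 0) / (h / 2 ^ m)⌋₊ = 2 ^ m * i := by
    have : (i * h - 0) / (h / 2 ^ m) = ((2 ^ m * i : ℕ) : ℝ) := by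
      push_cast
      field_simp
      ring
    rw [this, Nat.floor_natCast]
  simp only [Function.comp]
  rw [hfl, PowerSeries.coeff_mul, Finset.Nat.sum_antidiagonal_eq_sum_range_succ
    (fun i j => PowerSeries.coeff i (binomPS (-1) α) * PowerSeries.coeff j (gridPS γ (h / 2 ^ m)))]
  congr 1
  refine Finset.sum_congr rfl fun j hj => ?_
  rw [coeff_binomPS_neg_one, gridPS, PowerSeries.coeff_mk]
  congr 2
  rw [Nat.cast_sub (by simpa [Nat.lt_succ_iff] using hj)]
  push_cast
  field_simp

/-- The halving errors at the mesh sizes h/2^m form a convergent series of size h³, and the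
corrected formula has the same limit as the plain Grünwald sums. Existence of the derivative is a
hypothesis, so only its value has to be matched. -/
lemma exists_abs_corrGL_sub_le {α : ℝ} (hα : 0 < α) {k : ℕ} (hk : α + 3 ≤ k) {X : ℝ} :
    ∃ C : ℝ, 0 ≤ C ∧ ∀ (γ : ℝ → ℝ) (B : ℝ), DiffBound k B X γ → ∀ h : ℝ, 0 < h → h ≤ X →
      ∀ (i : ℕ) (L : ℝ), i * h ≤ X → IsLeftGLDeriv α 0 γ (i * h) L →
        |corrGL α γ h i - L| ≤ C * B * h ^ 3 := by
  obtain ⟨C₁, hC₁, h1⟩ := exists_abs_corrGL_sub_half_le (X := X) hα hk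
  obtain ⟨C₂, h2⟩ := exists_abs_corrGL_sub_GL_le (X := X) hk
  refine ⟨2 * C₁, by positivity, ?_⟩
  intro γ B hB h hh hhX i L hi hL
  have hB0 : 0 ≤ B := by
    have := (abs_nonneg _).trans (hB h hh 0 (by simpa using hh.le.trans hhX))
    exact nonneg_of_mul_nonneg_left this (by positivity)
  set a : ℕ → ℝ := fun m => corrGL α γ (h / 2 ^ m) (2 ^ m * i) with ha
  have hη : ∀ m : ℕ, 0 < h / 2 ^ m ∧ h / 2 ^ m ≤ h := fun m =>
    ⟨by positivity, div_le_self hh.le (one_le_pow₀ one_le_two)⟩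
  have hn : ∀ m : ℕ, ((2 ^ m * i : ℕ) : ℝ) * (h / 2 ^ m) ≤ X := fun m => by
    push_cast
    rw [show (2 : ℝ) ^ m * i * (h / 2 ^ m) = i * h by field_simp]
    exact hi
  have hstep : ∀ m, dist (a m) (a (m + 1)) ≤ 2 * C₁ * B * h ^ 3 / 2 / 2 ^ m := by
    intro m
    have := h1 γ B hB (h / 2 ^ m) (hη m).1 ((hη m).2.trans hhX) (2 ^ m * i) (hn m)
    rw [Real.dist_eq, ha]
    simp only
    rw [show h / 2 ^ (m + 1) = h / 2 ^ m / 2 by rw [pow_succ]; field_simp,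
      show 2 ^ (m + 1) * i = 2 * (2 ^ m * i) by ring]
    refine this.trans ?_
    -- The true decay is 8^(−m); the weaker 2^(−m) already gives a geometric series.
    have h3 : (h / 2 ^ m) ^ 3 ≤ h ^ 3 / 2 ^ m := by
      rw [div_pow]
      refine div_le_div_of_nonneg_left (by positivity) (by positivity) ?_
      exact le_self_pow₀ (one_le_pow₀ one_le_two) (by norm_num)
    calc C₁ * B * (h / 2 ^ m) ^ 3 ≤ C₁ * B * (h ^ 3 / 2 ^ m) := by gcongr
      _ = _ := by ring
  have hlim : Tendsto a atTop (𝓝 L) := by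
    have hA := hL.tendsto_grid hh
    have hz : Tendsto (fun m : ℕ => C₂ * B * (h / 2 ^ m)) atTop (𝓝 0) := by
      have : Tendsto (fun m : ℕ => h / 2 ^ m) atTop (𝓝 0) :=
        tendsto_const_nhds.div_atTop (tendsto_pow_atTop_atTop_of_one_lt one_lt_two)
      simpa using this.const_mul (C₂ * B)
    have hd : Tendsto (fun m : ℕ => a m - 1 / (h / 2 ^ m) ^ α * PowerSeries.coeff (2 ^ m * i)
        (binomPS (-1) α * gridPS γ (h / 2 ^ m))) atTop (𝓝 0) :=
      squeeze_zero_norm (fun m => by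
        rw [Real.norm_eq_abs]
        exact h2 γ B hB (h / 2 ^ m) (hη m).1 ((hη m).2.trans hhX) (2 ^ m * i) (hn m)) hz
    simpa using hd.add hA
  have := dist_le_of_le_geometric_two_of_tendsto₀ hstep hlim
  simpa [ha, Real.dist_eq] using this

/-! ### The weights and their order of consistency. -/

/-- The parameter `q` in `W(z) = (1 - z) ^ α * (1 - q + q z) ^ α`. -/
def shiftParam (α : ℝ) : ℝ := 1 / α - 1 / 2

lemma shiftParam_nonneg {α : ℝ} (h₁ : 1 ≤ α) (h₂ : α ≤ 2) : 0 ≤ shiftParam α := by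
  have : 1 / 2 ≤ 1 / α := one_div_le_one_div_of_le (by linarith) h₂
  rw [shiftParam]
  linarith

lemma shiftParam_le {α : ℝ} (h₁ : 1 ≤ α) : shiftParam α ≤ 1 / 2 := by
  have : 1 / α ≤ 1 / 1 := one_div_le_one_div_of_le one_pos h₁
  rw [shiftParam]
  linarith

/-- The power series of `W`. -/
def weightPS (α : ℝ) : PowerSeries ℝ :=
  PowerSeries.C ((1 - shiftParam α) ^ α) *
    (binomPS (-1) α * binomPS (shiftParam α / (1 - shiftParam α)) α)

lemma shiftRatio_nonneg {α : ℝ} (h₁ : 1 ≤ α) (h₂ : α ≤ 2) : 0 ≤ shiftParam α / (1 - shiftParam α) :=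
  div_nonneg (shiftParam_nonneg h₁ h₂) (by linarith [shiftParam_le h₁])

lemma shiftRatio_le_one {α : ℝ} (h₁ : 1 ≤ α) : shiftParam α / (1 - shiftParam α) ≤ 1 := by
  have := shiftParam_le h₁
  rw [div_le_one (by linarith)]
  linarith

lemma absSummable_weightPS {α : ℝ} (h₁ : 1 ≤ α) (h₂ : α ≤ 2) : AbsSummable (weightPS α) := by
  refine AbsSummable.C_mul _ (AbsSummable.mul ?_ ?_)
  · exact absSummable_binomPS (by simp) (by linarith)
  · exact absSummable_binomPS
      (by rw [abs_of_nonneg (shiftRatio_nonneg h₁ h₂)]; exact shiftRatio_le_one h₁)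
      (by linarith)

lemma genW_eq_evalPS {α : ℝ} (h₁ : 1 ≤ α) (h₂ : α ≤ 2) {z : ℝ} (hz : |z| < 1) :
    genW α 1 z = evalPS z (weightPS α) := by
  have hq0 := shiftParam_nonneg h₁ h₂
  have hq1 := shiftParam_le h₁
  have hr0 := shiftRatio_nonneg h₁ h₂
  have hr1 := shiftRatio_le_one h₁
  set q := shiftParam α with hq
  have hzn : ‖z‖ ≤ 1 := hz.le
  have s1 : AbsSummable (binomPS (-1) α) := absSummable_binomPS (by simp) (by linarith)
  have s2 : AbsSummable (binomPS (q / (1 - q)) α) :=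
    absSummable_binomPS (by rwa [abs_of_nonneg hr0]) (by linarith)
  have hz2 := abs_lt.1 hz
  have hrz : |q / (1 - q) * z| < 1 := by
    rw [abs_mul, abs_of_nonneg hr0]
    exact lt_of_le_of_lt (mul_le_of_le_one_left (abs_nonneg _) hr1) hz
  have hrz2 := abs_lt.1 hrz
  rw [weightPS, evalPS_mul (absSummable_C _) (s1.mul s2) hzn, evalPS_mul s1 s2 hzn, evalPS_C,
    evalPS_binomPS_real (by simpa using hz), evalPS_binomPS_real hrz, genW,
    RCLike.ofReal_real_eq_id,
    id, ← Real.mul_rpow (by linarith) (by linarith), ← Real.mul_rpow (by linarith)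
      (mul_nonneg (by linarith) (by linarith))]
  have hq1' : 1 - q ≠ 0 := by linarith
  congr 1
  have e : (1 - q) * ((1 + -1 * z) * (1 + q / (1 - q) * z)) = (1 - z) * ((1 - q) + q * z) := by
    field_simp
    ring
  rw [← hq, e, hq, shiftParam]
  ring

lemma weight_eq_coeff {α : ℝ} (h₁ : 1 ≤ α) (h₂ : α ≤ 2) (k : ℕ) :
    weight α 1 k = PowerSeries.coeff k (weightPS α) := by
  set p : FormalMultilinearSeries ℝ ℝ ℝ :=
    FormalMultilinearSeries.ofScalars ℝ fun n => PowerSeries.coeff n (weightPS α) with hp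
  have hW := absSummable_weightPS h₁ h₂
  have hball : HasFPowerSeriesOnBall (genW α 1) p 0 1 := by
    refine ⟨?_, one_pos, fun {y} hy => ?_⟩
    · have := p.le_radius_of_summable_norm (r := 1) (by
        simpa [AbsSummable, hp, FormalMultilinearSeries.ofScalars_norm] using hW)
      simpa using this
    · have hy1 : |y| < 1 := by
        rw [Metric.mem_eball, edist_zero_right, enorm_eq_nnnorm] at hy
        exact_mod_cast hy
      rw [zero_add, genW_eq_evalPS h₁ h₂ hy1, evalPS]
      have := (hW.norm_eval (z := y) hy1.le).of_norm.hasSum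
      convert this using 2 with n
      simp [hp]
      try ring
  have h2 := hball.hasFPowerSeriesAt.analyticAt.hasFPowerSeriesAt.eq_formalMultilinearSeries
    hball.hasFPowerSeriesAt
  have h3 := congrFun ((FormalMultilinearSeries.ofScalars_series_eq_iff ℝ _ _).1 h2) k
  exact h3

/-- In powers of V = 1 − X, the factor (1 − q + qX)^α begins 1 − αqV + bV², and X = 1 − V times the
correction factor begins 1 + (α/2 − 1)V + (d − α/2)V². The choice of q makes αq = 1 − α/2, so they
agree to first order. The V² terms differ by b − d + α/2 = a₂, which P_h supplies when p = 3 and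
which is left in the remainder when p = 2. -/
lemma exists_weightPS_eq {α : ℝ} (h₁ : 1 ≤ α) (h₂ : α ≤ 2) {p : ℕ} {c : ℝ}
    (hpc : (p = 2 ∧ c = 0) ∨ (p = 3 ∧ c = a₂ α 1)) :
    ∃ R, AbsSummable R ∧ weightPS α = binomPS (-1) α *
      ((PowerSeries.X + PowerSeries.C c * (1 - PowerSeries.X) ^ 2) * corrPS α) +
        binomPS (-1) (α + p) * R := by
  have hr0 := shiftRatio_nonneg h₁ h₂
  have hr1 := shiftRatio_le_one h₁
  have hq1 := shiftParam_le h₁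
  obtain ⟨R, hR, e⟩ := hasExpansion_binomPS hr0 hr1 (show 0 < α by linarith)
  set q := shiftParam α with hq
  have hq1' : 1 - q ≠ 0 := by linarith
  have e1 : 1 + q / (1 - q) = 1 / (1 - q) := by field_simp; ring
  have e2 : q / (1 - q) / (1 / (1 - q)) = q := by field_simp
  rw [e1, e2] at e
  have e3 : PowerSeries.C ((1 - q) ^ α) * PowerSeries.C ((1 / (1 - q)) ^ α) =
      (1 : PowerSeries ℝ) := by
    rw [← map_mul, ← Real.mul_rpow (by linarith) (by simp; linarith), mul_one_div_cancel hq1',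
      Real.one_rpow, map_one]
  have e4 : PowerSeries.C (α * q) = 1 - PowerSeries.C (α / 2) := by
    rw [← map_one (PowerSeries.C (R := ℝ)), ← map_sub, hq, shiftParam]
    congr 1
    field_simp
  rw [weightPS, ← hq, e, e4, corrPS, binomPS_neg_one_add_natCast]
  set V : PowerSeries ℝ := 1 - PowerSeries.X with hV
  have hX : (PowerSeries.X : PowerSeries ℝ) = 1 - V := by rw [hV]; ring
  rw [hX]
  have sV : AbsSummable V := absSummable_one_sub_X
  set b := α * (α - 1) / 2 * q ^ 2 with hb
  set d := (3 * α ^ 2 + 5 * α) / 24 with hd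
  have sa : AbsSummable (PowerSeries.C (α / 2)) := absSummable_C _
  have sb : AbsSummable (PowerSeries.C b) := absSummable_C _
  have sd : AbsSummable (PowerSeries.C d) := absSummable_C _
  have sc : AbsSummable (PowerSeries.C c) := absSummable_C _
  rcases hpc with ⟨rfl, rfl⟩ | ⟨rfl, rfl⟩
  · refine ⟨PowerSeries.C b - PowerSeries.C d + PowerSeries.C (α / 2) +
      V * (R + PowerSeries.C d), ((sb.sub sd).add sa).add (sV.mul (hR.add sd)), ?_⟩
    rw [map_zero]
    linear_combination (binomPS (-1) α * (1 - (1 - PowerSeries.C (α / 2)) * V +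
      PowerSeries.C b * V ^ 2 + V ^ 3 * R)) * e3
  · have e5 : PowerSeries.C b - PowerSeries.C d + PowerSeries.C (α / 2) -
        PowerSeries.C (a₂ α 1) = 0 := by
      rw [← map_sub, ← map_add, ← map_sub, ← map_zero (PowerSeries.C (R := ℝ))]
      congr 1
      rw [hb, hd, hq, shiftParam, a₂]
      field_simp
      ring
    refine ⟨R + PowerSeries.C d - PowerSeries.C (a₂ α 1) * PowerSeries.C (α / 2) -
      PowerSeries.C (a₂ α 1) * PowerSeries.C d * V,
      ((hR.add sd).sub (sc.mul sa)).sub ((sc.mul sd).mul sV), ?_⟩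
    linear_combination (binomPS (-1) α * (1 - (1 - PowerSeries.C (α / 2)) * V +
      PowerSeries.C b * V ^ 2 + V ^ 3 * R)) * e3 + (binomPS (-1) α * V ^ 2) * e5

/-- In coefficient l + 2, multiplication by X selects the node l + 1, and cV² forms c times the
second difference over the nodes l, l + 1, l + 2. The corrected formula is third order accurate at
each of them. -/
lemma exists_spatial_consistency {α : ℝ} (h₁ : 1 ≤ α) (h₂ : α ≤ 2) {p : ℕ} {c : ℝ}
    (hpc : (p = 2 ∧ c = 0) ∨ (p = 3 ∧ c = a₂ α 1)) {k : ℕ} (hk : α + 3 ≤ k) {X : ℝ}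
    (hX : 0 < X) :
    ∃ C : ℝ, 0 ≤ C ∧ ∀ (γ : ℝ → ℝ) (B : ℝ), DiffBound k B X γ → ∀ h : ℝ, 0 < h → h ≤ X →
      ∀ (l : ℕ) (L₀ L₁ L₂ : ℝ), (l + 2 : ℕ) * h ≤ X → IsLeftGLDeriv α 0 γ (l * h) L₀ →
        IsLeftGLDeriv α 0 γ ((l + 1 : ℕ) * h) L₁ → IsLeftGLDeriv α 0 γ ((l + 2 : ℕ) * h) L₂ →
        |1 / h ^ α * PowerSeries.coeff (l + 2) (weightPS α * gridPS γ h) -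
          (L₁ + c * (L₀ - 2 * L₁ + L₂))| ≤ C * B * h ^ p := by
  obtain ⟨R, hR, e⟩ := exists_weightPS_eq h₁ h₂ hpc
  obtain ⟨C₁, hC₁, hD⟩ := exists_abs_corrGL_sub_le (X := X) (show 0 < α by linarith) hk
  have hp3 : p ≤ 3 := by omega
  have hpk : α + p ≤ k := by
    have : (p : ℝ) ≤ 3 := by exact_mod_cast hp3
    linarith
  set C₂ := Real.exp (k - (α + p)) * (2 * X) ^ (k - (α + p)) * absSum R with hC₂
  have hC₂0 : 0 ≤ C₂ := by
    have := absSum_nonneg R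
    positivity
  refine ⟨C₂ + (1 + 4 * |c|) * (C₁ * X ^ (3 - p)), by positivity, ?_⟩
  intro γ B hB h hh hhX l L₀ L₁ L₂ hl hL₀ hL₁ hL₂
  have hB0 : 0 ≤ B := by
    have := (abs_nonneg _).trans (hB h hh 0 (by simpa using hh.le.trans hhX))
    exact nonneg_of_mul_nonneg_left this (by positivity)
  have b3 := hB.abs_le hpk hR hh hl (by linarith)
  have hl1 : ((l + 1 : ℕ) : ℝ) * h ≤ X := by push_cast at *; linarith
  have hl0 : (l : ℝ) * h ≤ X := by push_cast at *; linarith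
  have d0 := hD γ B hB h hh hhX l L₀ hl0 hL₀
  have d1 := hD γ B hB h hh hhX (l + 1) L₁ hl1 hL₁
  have d2 := hD γ B hB h hh hhX (l + 2) L₂ hl hL₂
  have e1 : 1 / h ^ α * PowerSeries.coeff (l + 2) (weightPS α * gridPS γ h) =
      corrGL α γ h (l + 1) + c * (corrGL α γ h l - 2 * corrGL α γ h (l + 1) +
        corrGL α γ h (l + 2)) + 1 / h ^ α * PowerSeries.coeff (l + 2)
          (binomPS (-1) (α + p) * (R * gridPS γ h)) := by
    simp only [corrGL]
    set Q := binomPS (-1) α * (corrPS α * gridPS γ h) with hQ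
    have e2 : weightPS α * gridPS γ h = PowerSeries.X * Q + PowerSeries.C c *
        (Q - PowerSeries.C 2 * (PowerSeries.X * Q) + PowerSeries.X * (PowerSeries.X * Q)) +
        binomPS (-1) (α + p) * (R * gridPS γ h) := by
      rw [e, hQ, map_ofNat]
      ring
    rw [e2, map_add, map_add, PowerSeries.coeff_C_mul, map_add, map_sub, PowerSeries.coeff_C_mul,
      PowerSeries.coeff_succ_X_mul, PowerSeries.coeff_succ_X_mul, PowerSeries.coeff_succ_X_mul]
    ring
  have hpow : h ^ 3 ≤ X ^ (3 - p) * h ^ p := by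
    rw [show h ^ 3 = h ^ (3 - p) * h ^ p by rw [← pow_add, Nat.sub_add_cancel hp3]]
    gcongr
  set E := C₁ * B * h ^ 3 with hE
  have hEle : E ≤ C₁ * X ^ (3 - p) * B * h ^ p := by
    calc E ≤ C₁ * B * (X ^ (3 - p) * h ^ p) := by rw [hE]; gcongr
      _ = _ := by ring
  rw [e1]
  set d₀ := corrGL α γ h l - L₀
  set d₁ := corrGL α γ h (l + 1) - L₁
  set d₂ := corrGL α γ h (l + 2) - L₂
  set Z := 1 / h ^ α * PowerSeries.coeff (l + 2) (binomPS (-1) (α + p) * (R * gridPS γ h))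
  have e6 : corrGL α γ h (l + 1) + c * (corrGL α γ h l - 2 * corrGL α γ h (l + 1) +
        corrGL α γ h (l + 2)) + Z - (L₁ + c * (L₀ - 2 * L₁ + L₂)) =
      d₁ + c * (d₀ - 2 * d₁ + d₂) + Z := by
    ring
  rw [e6]
  have t1 : |d₀ - 2 * d₁ + d₂| ≤ 4 * E := by
    rw [abs_le] at *
    constructor <;> linarith
  calc |d₁ + c * (d₀ - 2 * d₁ + d₂) + Z|
      ≤ |d₁| + |c| * |d₀ - 2 * d₁ + d₂| + |Z| := by
        rw [← abs_mul]
        exact (abs_add_le _ _).trans (add_le_add_left (abs_add_le _ _) _)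
    _ ≤ E + |c| * (4 * E) + C₂ * B * h ^ p := by gcongr
    _ = (1 + 4 * |c|) * E + C₂ * B * h ^ p := by ring
    _ ≤ (1 + 4 * |c|) * (C₁ * X ^ (3 - p) * B * h ^ p) + C₂ * B * h ^ p := by gcongr
    _ = _ := by ring

/-! ### Difference bounds from smoothness of the zero extension. -/

/-- The backward difference with (signed) step `σ`. -/
def bdiff (σ : ℝ) (f : ℝ → ℝ) : ℝ → ℝ := fun x => f x - f (x - σ)

/-- Truncation of the power series at index 0 agrees with true backward differences because the
function vanishes at the grid points before x₀. -/
lemma one_sub_X_pow_mul_mk {σ x₀ : ℝ} (k : ℕ) {f : ℝ → ℝ}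
    (hf : ∀ m : ℕ, f (x₀ - (m + 1) * σ) = 0) :
    (1 - PowerSeries.X) ^ k * (PowerSeries.mk fun n => f (x₀ + n * σ)) =
      PowerSeries.mk fun n => (bdiff σ)^[k] f (x₀ + n * σ) := by
  induction k generalizing f with
  | zero => simp
  | succ k ih =>
    have h1 : (1 - PowerSeries.X) * (PowerSeries.mk fun n => f (x₀ + n * σ)) =
        PowerSeries.mk fun n => bdiff σ f (x₀ + n * σ) := by
      ext n
      cases n with
      | zero =>
        have := hf 0
        simp at this
        simp [sub_mul, bdiff, this]
      | succ n =>
        simp only [sub_mul, one_mul, map_sub, PowerSeries.coeff_succ_X_mul, PowerSeries.coeff_mk,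
          bdiff]
        congr 2
        push_cast
        ring
    rw [pow_succ, mul_assoc, h1, ih]
    · simp only [Function.iterate_succ_apply]
    · intro m
      have h2 := hf (m + 1)
      rw [bdiff, hf m, show x₀ - (m + 1) * σ - σ = x₀ - ((m + 1 : ℕ) + 1) * σ by push_cast; ring,
        h2, sub_zero]

lemma hasDerivWithinAt_iterate_bdiff {σ : ℝ} {S : Set ℝ} (hS : ∀ x ∈ S, x - σ ∈ S) (k : ℕ)
    {f f' : ℝ → ℝ} (hf : ∀ x ∈ S, HasDerivWithinAt f (f' x) S x) :
    ∀ x ∈ S, HasDerivWithinAt ((bdiff σ)^[k] f) ((bdiff σ)^[k] f' x) S x := by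
  induction k generalizing f f' with
  | zero => simpa using hf
  | succ k ih =>
    simp only [Function.iterate_succ_apply]
    refine ih fun x hx => ?_
    refine (hf x hx).sub ?_
    have h1 : HasDerivWithinAt (fun y : ℝ => y - σ) 1 S x :=
      (hasDerivWithinAt_id x S).sub_const σ
    have h2 := (hf (x - σ) (hS x hx)).comp x h1 hS
    rw [mul_one] at h2
    exact h2

/-- Differences commute with differentiation, so the derivative of the k-th difference of f is the
k-th difference of f'. The mean value inequality then adds one factor |σ|. -/
lemma abs_iterate_bdiff_le {σ B : ℝ} {S : Set ℝ} (hS : ∀ x ∈ S, x - σ ∈ S) (hc : Convex ℝ S)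
    (hu : UniqueDiffOn ℝ S) (k : ℕ) {f : ℝ → ℝ} (hf : ContDiffOn ℝ k f S)
    (hB : ∀ x ∈ S, |iteratedDerivWithin k f S x| ≤ B) :
    ∀ x ∈ S, |(bdiff σ)^[k] f x| ≤ B * |σ| ^ k := by
  induction k generalizing f with
  | zero => simpa using hB
  | succ k ih =>
    intro x hx
    have hf' : ContDiffOn ℝ ((k : WithTop ℕ∞) + 1) f S := by exact_mod_cast hf
    have h1 := (contDiffOn_succ_iff_derivWithin hu).1 hf'
    have h2 := ih h1.2.2 fun y hy => by
      rw [← iteratedDerivWithin_succ']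
      exact hB y hy
    have h3 := hasDerivWithinAt_iterate_bdiff hS k fun y hy => (h1.1 y hy).hasDerivWithinAt
    have h4 := hc.norm_image_sub_le_of_norm_hasDerivWithin_le h3 h2 (hS x hx) hx
    rw [Function.iterate_succ_apply']
    simp only [Real.norm_eq_abs] at h4
    rw [sub_sub_cancel] at h4
    rw [bdiff, pow_succ, ← mul_assoc]
    exact h4

lemma diffBound_of_contDiffOn {σ₀ B X x₀ : ℝ} (hσ₀ : |σ₀| = 1) {S : Set ℝ} (hc : Convex ℝ S)
    (hu : UniqueDiffOn ℝ S) (hS : ∀ η : ℝ, 0 < η → ∀ x ∈ S, x - η * σ₀ ∈ S)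
    (hX : ∀ y ≤ X, 0 ≤ y → x₀ + y * σ₀ ∈ S) {k : ℕ} {f : ℝ → ℝ} (hf : ContDiffOn ℝ k f S)
    (hB : ∀ x ∈ S, |iteratedDerivWithin k f S x| ≤ B) (hf0 : ∀ y, 0 < y → f (x₀ - y * σ₀) = 0) :
    DiffBound k B X fun y => f (x₀ + y * σ₀) := by
  intro η hη n hn
  have e : gridPS (fun y => f (x₀ + y * σ₀)) η =
      PowerSeries.mk fun n => f (x₀ + n * (η * σ₀)) := by
    ext n
    simp [gridPS, mul_assoc]
  rw [e, one_sub_X_pow_mul_mk, PowerSeries.coeff_mk]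
  · have h := abs_iterate_bdiff_le (hS η hη) hc hu k hf hB (x₀ + n * (η * σ₀))
      (by rw [← mul_assoc]; exact hX _ hn (by positivity))
    rwa [abs_mul, hσ₀, mul_one, abs_of_pos hη] at h
  · intro m
    rw [← mul_assoc]
    exact hf0 _ (by positivity)

lemma SpaceSmooth.exists_diffBound_left {a b T : ℝ} {k : ℕ} {g : ℝ → ℝ → ℝ}
    (h : SpaceSmooth a b T k (Iic b) g) : ∃ B, ∀ t ∈ Icc 0 T,
      DiffBound k B (b - a) fun y => (Icc a b).indicator (fun x => g x t) (a + y) := by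
  obtain ⟨h1, B, hB⟩ := h
  refine ⟨B, fun t ht => ?_⟩
  have := diffBound_of_contDiffOn (σ₀ := 1) (X := b - a) (x₀ := a) (by simp) (convex_Iic b)
    (uniqueDiffOn_Iic b) (fun η hη x hx => by simp at *; linarith)
    (fun y hy _ => by simp at *; linarith) (h1 t ht) (hB t ht)
    (fun y hy => indicator_of_notMem (by simp [hy]) _)
  simpa using this

lemma SpaceSmooth.exists_diffBound_right {a b T : ℝ} {k : ℕ} {g : ℝ → ℝ → ℝ}
    (h : SpaceSmooth a b T k (Ici a) g) : ∃ B, ∀ t ∈ Icc 0 T,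
      DiffBound k B (b - a) fun y => (Icc a b).indicator (fun x => g x t) (b - y) := by
  obtain ⟨h1, B, hB⟩ := h
  refine ⟨B, fun t ht => ?_⟩
  have := diffBound_of_contDiffOn (σ₀ := -1) (X := b - a) (x₀ := b) (by simp) (convex_Ici a)
    (uniqueDiffOn_Ici a) (fun η hη x hx => by simp at *; linarith)
    (fun y hy _ => by simp at *; linarith) (h1 t ht) (hB t ht)
    (fun y hy => indicator_of_notMem (by simp [hy]) _)
  simpa [sub_eq_add_neg] using this

/-- The floor keeps every sample point in [a, b], so the extension by zero is invisible to the sum.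
-/
lemma IsLeftGLDeriv.indicator {α a b x L : ℝ} {g : ℝ → ℝ} (h : IsLeftGLDeriv α a g x L)
    (hx : x ∈ Icc a b) :
    IsLeftGLDeriv α 0 (fun y => (Icc a b).indicator g (a + y)) (x - a) L := by
  refine Tendsto.congr' ?_ h
  filter_upwards [self_mem_nhdsWithin] with η hη
  have hη' : 0 < η := hη
  rw [sub_zero]
  congr 1
  refine Finset.sum_congr rfl fun k hk => ?_
  have h1 : (k : ℝ) ≤ (x - a) / η :=
    (Nat.le_floor_iff (div_nonneg (by linarith [hx.1]) hη'.le)).1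
      (Nat.lt_succ_iff.1 (Finset.mem_range.1 hk))
  rw [le_div_iff₀ hη'] at h1
  have h2 : 0 ≤ k * η := by positivity
  have h3 : x - k * η ∈ Icc a b := ⟨by linarith, by linarith [hx.2]⟩
  rw [show a + (x - a - k * η) = x - k * η by ring, indicator_of_mem h3]

/-- The reflection y ↦ b − y reduces the right derivative to the left one, so the consistency
analysis is needed only once. -/
lemma IsRightGLDeriv.indicator {α a b x L : ℝ} {g : ℝ → ℝ} (h : IsRightGLDeriv α b g x L)
    (hx : x ∈ Icc a b) :
    IsLeftGLDeriv α 0 (fun y => (Icc a b).indicator g (b - y)) (b - x) L := by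
  refine Tendsto.congr' ?_ h
  filter_upwards [self_mem_nhdsWithin] with η hη
  have hη' : 0 < η := hη
  rw [sub_zero]
  congr 1
  refine Finset.sum_congr rfl fun k hk => ?_
  have h1 : (k : ℝ) ≤ (b - x) / η :=
    (Nat.le_floor_iff (div_nonneg (by linarith [hx.2]) hη'.le)).1
      (Nat.lt_succ_iff.1 (Finset.mem_range.1 hk))
  rw [le_div_iff₀ hη'] at h1
  have h2 : 0 ≤ k * η := by positivity
  have h3 : x + k * η ∈ Icc a b := ⟨by linarith [hx.1], by linarith⟩
  rw [show b - (b - x - k * η) = x + k * η by ring, indicator_of_mem h3]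

/-! ### Sign of the symbol on the unit circle. -/

/-- Radial limit r → 1− of the identity inside the disc: the series converges by domination, the
power by continuity off the branch cut. -/
lemma evalPS_binomPS_of_norm_eq_one {ρ β : ℝ} {z : ℂ} (hρ : |ρ| ≤ 1) (hβ : 0 < β)
    (hz : ‖z‖ = 1) (hs : 1 + ρ * z ∈ Complex.slitPlane) :
    evalPS z (binomPS ρ β) = (1 + ρ * z) ^ (β : ℂ) := by
  have hS := absSummable_binomPS hρ hβ
  have hlt : ∀ᶠ r : ℝ in 𝓝[<] 1, r < 1 := self_mem_nhdsWithin
  have hgt : ∀ᶠ r : ℝ in 𝓝[<] 1, 0 < r := nhdsWithin_le_nhds (lt_mem_nhds one_pos)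
  have hr : Tendsto (fun r : ℝ => (r : ℂ)) (𝓝[<] 1) (𝓝 1) := by
    have := Complex.continuous_ofReal.tendsto 1
    rw [Complex.ofReal_one] at this
    exact this.mono_left nhdsWithin_le_nhds
  have hrz : Tendsto (fun r : ℝ => (r : ℂ) * z) (𝓝[<] 1) (𝓝 z) := by
    simpa using hr.mul_const z
  have t1 : Tendsto (fun r : ℝ => evalPS ((r : ℂ) * z) (binomPS ρ β)) (𝓝[<] 1)
      (𝓝 (evalPS z (binomPS ρ β))) := by
    refine tendsto_tsum_of_dominated_convergence hS (fun k => (hrz.pow k).const_mul _) ?_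
    filter_upwards [hlt, hgt] with r h1 h0 k
    have hn : ‖(r : ℂ) * z‖ ≤ 1 := by
      rw [norm_mul, hz, mul_one, Complex.norm_real, Real.norm_eq_abs, abs_of_pos h0]
      exact h1.le
    rw [norm_mul, norm_pow, RCLike.norm_ofReal]
    exact mul_le_of_le_one_right (abs_nonneg _) (pow_le_one₀ (norm_nonneg _) hn)
  have t2 : Tendsto (fun r : ℝ => (1 + ρ * ((r : ℂ) * z)) ^ (β : ℂ)) (𝓝[<] 1)
      (𝓝 ((1 + ρ * z) ^ (β : ℂ))) :=
    ((hrz.const_mul (ρ : ℂ)).const_add 1).cpow tendsto_const_nhds hs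
  refine tendsto_nhds_unique t1 (t2.congr' ?_)
  filter_upwards [hlt, hgt] with r h1 h0
  refine (evalPS_binomPS_complex ?_).symm
  rw [norm_mul, norm_mul, hz, mul_one, Complex.norm_real, Complex.norm_real, Real.norm_eq_abs,
    Real.norm_eq_abs, abs_of_pos h0]
  exact lt_of_le_of_lt (mul_le_of_le_one_left h0.le hρ) h1

lemma cpow_ofReal_eq {w : ℂ} (hw : w ≠ 0) (α : ℝ) :
    w ^ (α : ℂ) = ((‖w‖ ^ α : ℝ) : ℂ) * Complex.exp ((α * w.arg : ℝ) * Complex.I) := by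
  rw [Complex.cpow_def_of_ne_zero hw, Complex.log, Real.rpow_def_of_pos (norm_pos_iff.2 hw),
    Complex.ofReal_exp, ← Complex.exp_add]
  congr 1
  push_cast
  ring

lemma arg_one_sub_exp {θ : ℝ} (h0 : 0 < θ) (hπ : θ < Real.pi) :
    (1 - Complex.exp (θ * Complex.I)).arg = (θ - Real.pi) / 2 := by
  have hs : 0 < 2 * Real.sin (θ / 2) := by
    have := Real.sin_pos_of_pos_of_lt_pi (x := θ / 2) (by linarith) (by linarith)
    linarith
  have e : 1 - Complex.exp (θ * Complex.I) = ((2 * Real.sin (θ / 2) : ℝ) : ℂ) *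
      (Complex.cos ((θ - Real.pi) / 2 : ℝ) + Complex.sin ((θ - Real.pi) / 2 : ℝ) * Complex.I) := by
    have hc : Real.cos ((θ - Real.pi) / 2) = Real.sin (θ / 2) := by
      rw [show (θ - Real.pi) / 2 = θ / 2 - Real.pi / 2 by ring, Real.cos_sub_pi_div_two]
    have hss : Real.sin ((θ - Real.pi) / 2) = -Real.cos (θ / 2) := by
      rw [show (θ - Real.pi) / 2 = θ / 2 - Real.pi / 2 by ring, Real.sin_sub_pi_div_two]
    have h1 : Real.cos θ = 1 - 2 * Real.sin (θ / 2) ^ 2 := by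
      have := Real.cos_two_mul (θ / 2)
      rw [mul_div_cancel₀ _ two_ne_zero] at this
      rw [this, Real.cos_sq']
      ring
    have h2 : Real.sin θ = 2 * Real.sin (θ / 2) * Real.cos (θ / 2) := by
      have := Real.sin_two_mul (θ / 2)
      rwa [mul_div_cancel₀ _ two_ne_zero] at this
    rw [Complex.exp_mul_I, ← Complex.ofReal_cos, ← Complex.ofReal_sin, ← Complex.ofReal_cos,
      ← Complex.ofReal_sin, hc, hss, h1, h2]
    push_cast
    ring
  rw [e]
  exact Complex.arg_mul_cos_add_sin_mul_I hs ⟨by linarith [Real.pi_pos], by linarith [Real.pi_pos]⟩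

lemma re_one_add_mul_exp_pos {ρ θ : ℝ} (hρ₀ : 0 ≤ ρ) (hρ : ρ ≤ 1) (h0 : 0 < θ)
    (hπ : θ < Real.pi) : 0 < 1 + ρ * Real.cos θ := by
  have h1 : -1 < Real.cos θ := by
    rw [← Real.cos_pi]
    exact Real.cos_lt_cos_of_nonneg_of_le_pi h0.le le_rfl hπ
  rcases hρ₀.eq_or_lt with rfl | h
  · simp
  · nlinarith [mul_pos h (show 0 < 1 + Real.cos θ by linarith)]

/-- Put w = 1 + ρe^(iθ), y = θ/(1+ρ) and φ = ρy. Then |w| sin(arg w − φ) = ρ sin y − sin(ρy), which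
is nonpositive by concavity of the sine on [0, π]; arg w > φ would make it positive. -/
lemma arg_one_add_mul_exp_mem {ρ θ : ℝ} (hρ₀ : 0 ≤ ρ) (hρ : ρ ≤ 1) (h0 : 0 < θ)
    (hπ : θ < Real.pi) :
    0 ≤ (1 + ρ * Complex.exp (θ * Complex.I)).arg ∧
      (1 + ρ * Complex.exp (θ * Complex.I)).arg ≤ ρ / (1 + ρ) * θ := by
  set w := 1 + ρ * Complex.exp (θ * Complex.I) with hw
  have hre : w.re = 1 + ρ * Real.cos θ := by
    simp [hw, Complex.exp_mul_I, ← Complex.ofReal_cos, ← Complex.ofReal_sin]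
  have him : w.im = ρ * Real.sin θ := by
    simp [hw, Complex.exp_mul_I, ← Complex.ofReal_cos, ← Complex.ofReal_sin]
  have hpos := re_one_add_mul_exp_pos hρ₀ hρ h0 hπ
  have hsin : 0 < Real.sin θ := Real.sin_pos_of_pos_of_lt_pi h0 hπ
  have harg0 : 0 ≤ w.arg := Complex.arg_nonneg_iff.2 (by rw [him]; positivity)
  refine ⟨harg0, ?_⟩
  have hargπ : w.arg < Real.pi / 2 := (abs_lt.1 (Complex.abs_arg_lt_pi_div_two_iff.2
    (Or.inl (by rw [hre]; exact hpos)))).2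
  by_contra! hlt
  set φ := ρ / (1 + ρ) * θ with hφ
  have hφ0 : 0 ≤ φ := by positivity
  have hpos2 : 0 < Real.sin (w.arg - φ) :=
    Real.sin_pos_of_pos_of_lt_pi (by linarith) (by linarith [Real.pi_pos])
  have hn : 0 < ‖w‖ := norm_pos_iff.2 fun h => by
    rw [h, Complex.zero_re] at hre
    linarith
  have e : ‖w‖ * Real.sin (w.arg - φ) = ρ * Real.sin (θ - φ) - Real.sin φ := by
    rw [Real.sin_sub, Real.sin_sub]
    have e1 := Complex.norm_mul_cos_arg w
    have e2 := Complex.norm_mul_sin_arg w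
    rw [hre] at e1
    rw [him] at e2
    linear_combination Real.cos φ * e2 - Real.sin φ * e1
  have hy : θ - φ = θ / (1 + ρ) := by
    rw [hφ]
    field_simp
    ring
  have hφy : φ = ρ * (θ / (1 + ρ)) := by
    rw [hφ]
    ring
  have hy1 : θ / (1 + ρ) ≤ Real.pi := (div_le_self h0.le (by linarith)).trans hπ.le
  have hconc := strictConcaveOn_sin_Icc.concaveOn.2
    (show θ / (1 + ρ) ∈ Icc 0 Real.pi from ⟨by positivity, hy1⟩)
    (show (0 : ℝ) ∈ Icc 0 Real.pi from ⟨le_rfl, Real.pi_pos.le⟩) hρ₀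
    (show 0 ≤ 1 - ρ by linarith) (by ring)
  simp only [smul_eq_mul, Real.sin_zero, mul_zero, add_zero] at hconc
  rw [hy, hφy] at e
  have := mul_pos hn hpos2
  rw [hφy] at this
  linarith

/-- The real part of `e^(-iθ) W(e^(iθ))`. -/
def symbolRe (α θ : ℝ) : ℝ :=
  ∑' k : ℕ, PowerSeries.coeff k (weightPS α) * Real.cos ((k - 1) * θ)

lemma symbolRe_eq_re {α : ℝ} (h₁ : 1 ≤ α) (h₂ : α ≤ 2) (θ : ℝ) :
    symbolRe α θ =
      (Complex.exp (-θ * Complex.I) * evalPS (Complex.exp (θ * Complex.I)) (weightPS α)).re := by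
  have hz : ‖Complex.exp (θ * Complex.I)‖ ≤ 1 := (Complex.norm_exp_ofReal_mul_I θ).le
  have h := ((absSummable_weightPS h₁ h₂).norm_eval hz).of_norm.hasSum.mul_left
    (Complex.exp (-θ * Complex.I))
  refine Eq.trans ?_ (Complex.hasSum_re h).tsum_eq
  rw [symbolRe]
  congr 1
  ext k
  have e : Complex.exp (-θ * Complex.I) * (((PowerSeries.coeff k (weightPS α) : ℝ) : ℂ) *
      Complex.exp (θ * Complex.I) ^ k) = ((PowerSeries.coeff k (weightPS α) : ℝ) : ℂ) *
        Complex.exp (((k - 1) * θ : ℝ) * Complex.I) := by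
    rw [← Complex.exp_nat_mul, mul_left_comm, ← Complex.exp_add]
    congr 2
    push_cast
    ring
  refine Eq.trans ?_ (congrArg Complex.re e).symm
  rw [Complex.re_ofReal_mul, Complex.exp_ofReal_mul_I_re]

/-- The total argument is α(θ − π)/2 + αψ − θ with 0 ≤ ψ ≤ qθ. Since αq = 1 − α/2, it is at most
−απ/2 ≤ −π/2, and dropping αψ shows that it is at least −π. The cosine is nonpositive there. -/
lemma symbolRe_nonpos {α θ : ℝ} (h₁ : 1 ≤ α) (h₂ : α ≤ 2) (h0 : 0 < θ) (hπ : θ < Real.pi) :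
    symbolRe α θ ≤ 0 := by
  have hr0 := shiftRatio_nonneg h₁ h₂
  have hr1 := shiftRatio_le_one h₁
  have hq1 := shiftParam_le h₁
  rw [symbolRe_eq_re h₁ h₂, weightPS]
  set q := shiftParam α with hq
  set ρ := q / (1 - q) with hρ
  set z := Complex.exp (θ * Complex.I) with hz
  have hzn : ‖z‖ = 1 := Complex.norm_exp_ofReal_mul_I θ
  have hα : 0 < α := by linarith
  have s1 : AbsSummable (binomPS (-1) α) := absSummable_binomPS (by simp) hα
  have s2 : AbsSummable (binomPS ρ α) := absSummable_binomPS (by rwa [abs_of_nonneg hr0]) hα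
  have hcos : Real.cos θ < 1 := by
    rw [← Real.cos_zero]
    exact Real.cos_lt_cos_of_nonneg_of_le_pi le_rfl hπ.le h0
  have hre1 : 0 < (1 + ((-1 : ℝ) : ℂ) * z).re := by
    simp [hz, Complex.exp_ofReal_mul_I_re]
    exact hcos
  have hre2 : 0 < (1 + (ρ : ℂ) * z).re := by
    have := re_one_add_mul_exp_pos hr0 hr1 h0 hπ
    simpa [hz, Complex.exp_ofReal_mul_I_re, Complex.exp_ofReal_mul_I_im] using this
  have hne : ∀ w : ℂ, 0 < w.re → w ≠ 0 := fun w hw h => by simp [h] at hw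
  rw [evalPS_mul (absSummable_C _) (s1.mul s2) hzn.le, evalPS_mul s1 s2 hzn.le, evalPS_C,
    evalPS_binomPS_of_norm_eq_one (by simp) hα hzn (Or.inl hre1),
    evalPS_binomPS_of_norm_eq_one (by rwa [abs_of_nonneg hr0]) hα hzn (Or.inl hre2),
    cpow_ofReal_eq (hne _ hre1), cpow_ofReal_eq (hne _ hre2)]
  obtain ⟨ha0, ha1⟩ := arg_one_add_mul_exp_mem hr0 hr1 h0 hπ
  have ha2 := arg_one_sub_exp h0 hπ
  rw [← hz] at ha0 ha1 ha2
  have hqρ : ρ / (1 + ρ) = q := by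
    have : 1 - q ≠ 0 := by linarith
    rw [hρ]
    field_simp
    ring
  rw [hqρ] at ha1
  have e1 : 1 + ((-1 : ℝ) : ℂ) * z = 1 - z := by push_cast; ring
  rw [e1, ha2]
  set ψ := (1 + (ρ : ℂ) * z).arg
  set A := ‖1 - z‖ ^ α with hA
  set B := ‖1 + (ρ : ℂ) * z‖ ^ α with hB
  have e2 : Complex.exp (-θ * Complex.I) * ((((1 - q) ^ α : ℝ) : ℂ) *
      (((A : ℝ) : ℂ) * Complex.exp ((α * ((θ - Real.pi) / 2) : ℝ) * Complex.I) *
        (((B : ℝ) : ℂ) * Complex.exp ((α * ψ : ℝ) * Complex.I)))) =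
      (((1 - q) ^ α * A * B : ℝ) : ℂ) *
        Complex.exp ((α * ((θ - Real.pi) / 2) + α * ψ - θ : ℝ) * Complex.I) := by
    have e3 : ((α * ((θ - Real.pi) / 2) + α * ψ - θ : ℝ) : ℂ) * Complex.I =
        -θ * Complex.I + ((α * ((θ - Real.pi) / 2) : ℝ) * Complex.I +
          (α * ψ : ℝ) * Complex.I) := by
      push_cast
      ring
    rw [e3, Complex.exp_add, Complex.exp_add]
    push_cast
    ring
  have hαq : α * q = 1 - α / 2 := by
    rw [hq, shiftParam]
    field_simp
  have hup : α * ψ ≤ (1 - α / 2) * θ := by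
    rw [← hαq, mul_assoc]
    exact mul_le_mul_of_nonneg_left ha1 hα.le
  have hαψ : 0 ≤ α * ψ := by positivity
  refine (congrArg Complex.re e2).trans_le ?_
  rw [Complex.re_ofReal_mul, Complex.exp_ofReal_mul_I_re, ← Real.cos_neg]
  refine mul_nonpos_of_nonneg_of_nonpos ?_ (Real.cos_nonpos_of_pi_div_two_le_of_le ?_ ?_)
  · have : 0 ≤ 1 - q := by linarith
    positivity
  · nlinarith [Real.pi_pos]
  · nlinarith [Real.pi_pos]

/-! ### Negativity of the Toeplitz form. -/

/-- The entry `w_{i+1-j}` of the Toeplitz matrix of the shifted weights. -/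
def toeplitzEntry (α : ℝ) (i j : ℕ) : ℝ :=
  if j ≤ i + 1 then PowerSeries.coeff (i + 1 - j) (weightPS α) else 0

lemma integral_cos_int_mul (n : ℤ) :
    ∫ θ in (0 : ℝ)..Real.pi, Real.cos (n * θ) = if n = 0 then Real.pi else 0 := by
  split_ifs with h
  · simp [h]
  · have hn : (n : ℝ) ≠ 0 := by exact_mod_cast h
    rw [intervalIntegral.integral_comp_mul_left (fun x => Real.cos x) hn, integral_cos]
    simp [Real.sin_int_mul_pi]

lemma abs_coeff_mul_cos_le (α : ℝ) (k : ℕ) (x : ℝ) :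
    ‖PowerSeries.coeff k (weightPS α) * Real.cos x‖ ≤ |PowerSeries.coeff k (weightPS α)| := by
  rw [norm_mul, Real.norm_eq_abs, Real.norm_eq_abs]
  exact mul_le_of_le_one_right (abs_nonneg _) (Real.abs_cos_le_one _)

lemma continuous_symbolRe {α : ℝ} (h₁ : 1 ≤ α) (h₂ : α ≤ 2) : Continuous (symbolRe α) :=
  continuous_tsum (fun k => by fun_prop) (absSummable_weightPS h₁ h₂)
    fun k θ => abs_coeff_mul_cos_le α k _

/-- Continuity covers the end points, where a factor of W may vanish and have no argument. -/
lemma symbolRe_nonpos_of_mem_Icc {α θ : ℝ} (h₁ : 1 ≤ α) (h₂ : α ≤ 2) (hθ : θ ∈ Icc 0 Real.pi) :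
    symbolRe α θ ≤ 0 := by
  rw [← closure_Ioo Real.pi_pos.ne] at hθ
  have hcl : IsClosed {x | symbolRe α x ≤ 0} :=
    isClosed_le (continuous_symbolRe h₁ h₂) continuous_const
  exact closure_minimal (fun x hx => symbolRe_nonpos h₁ h₂ hx.1 hx.2) hcl hθ

lemma toeplitzEntry_eq_tsum (α : ℝ) (i j : ℕ) :
    toeplitzEntry α i j = ∑' k : ℕ,
      if (k : ℤ) - 1 - (i - j) = 0 then PowerSeries.coeff k (weightPS α) else 0 := by
  rw [toeplitzEntry]
  split_ifs with h
  · rw [tsum_eq_single (i + 1 - j)]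
    · rw [if_pos (by omega)]
    · intro k hk
      rw [if_neg (by omega)]
  · have h0 : ∀ k : ℕ, (if (k : ℤ) - 1 - (i - j) = 0 then PowerSeries.coeff k (weightPS α)
        else 0) = 0 := fun k => if_neg (by omega)
    simp only [h0, tsum_zero]

/-- Orthogonality of cosines on [0, π] picks out the weights with k − 1 = ±(i − j), hence the
symmetrised matrix entry. -/
lemma integral_symbolRe_mul_cos {α : ℝ} (h₁ : 1 ≤ α) (h₂ : α ≤ 2) (i j : ℕ) :
    ∫ θ in (0 : ℝ)..Real.pi, symbolRe α θ * Real.cos (((i : ℝ) - j) * θ) =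
      Real.pi / 2 * (toeplitzEntry α i j + toeplitzEntry α j i) := by
  have hW := absSummable_weightPS h₁ h₂
  set w : ℕ → ℝ := fun k => PowerSeries.coeff k (weightPS α) with hw
  have hsumm : ∀ θ, Summable fun k : ℕ => w k * Real.cos ((k - 1) * θ) := fun θ =>
    Summable.of_norm_bounded hW fun k => abs_coeff_mul_cos_le α k _
  have h := intervalIntegral.hasSum_integral_of_dominated_convergence (μ := MeasureTheory.volume)
    (a := 0) (b := Real.pi)
    (F := fun (k : ℕ) θ => w k * Real.cos ((k - 1) * θ) * Real.cos (((i : ℝ) - j) * θ))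
    (f := fun θ => symbolRe α θ * Real.cos (((i : ℝ) - j) * θ))
    (fun k _ => |w k|) (fun k => by
      refine Continuous.aestronglyMeasurable ?_
      fun_prop)
    (fun k => Eventually.of_forall fun θ _ => by
      rw [norm_mul]
      refine (mul_le_of_le_one_right (norm_nonneg _) ?_).trans (abs_coeff_mul_cos_le α k _)
      exact Real.abs_cos_le_one _)
    (Eventually.of_forall fun _ _ => hW)
    intervalIntegrable_const
    (Eventually.of_forall fun θ _ => (hsumm θ).hasSum.mul_right _)
  have hk : ∀ k : ℕ, ∫ θ in (0 : ℝ)..Real.pi,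
      w k * Real.cos ((k - 1) * θ) * Real.cos (((i : ℝ) - j) * θ) =
      Real.pi / 2 * ((if (k : ℤ) - 1 - (i - j) = 0 then w k else 0) +
        if (k : ℤ) - 1 - (j - i) = 0 then w k else 0) := by
    intro k
    have e : ∀ θ : ℝ, w k * Real.cos ((k - 1) * θ) * Real.cos (((i : ℝ) - j) * θ) =
        w k / 2 * (Real.cos (((k : ℤ) - 1 - (i - j) : ℤ) * θ) +
          Real.cos (((k : ℤ) - 1 - (j - i) : ℤ) * θ)) := by
      intro θ
      push_cast
      rw [show ((k : ℝ) - 1 - (i - j)) * θ = (k - 1) * θ - (i - j) * θ by ring,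
        show ((k : ℝ) - 1 - (j - i)) * θ = (k - 1) * θ + (i - j) * θ by ring,
        Real.cos_add, Real.cos_sub]
      ring
    simp only [e]
    rw [intervalIntegral.integral_const_mul, intervalIntegral.integral_add
      (Continuous.intervalIntegrable (by fun_prop) _ _)
      (Continuous.intervalIntegrable (by fun_prop) _ _), integral_cos_int_mul,
      integral_cos_int_mul]
    split_ifs <;> ring
  rw [← h.tsum_eq]
  simp only [hk]
  have hs : ∀ c : ℤ, Summable fun k : ℕ => if (k : ℤ) - 1 - c = 0 then w k else 0 := fun c =>
    Summable.of_norm_bounded hW fun k => by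
      split_ifs
      · exact le_rfl
      · simp
  rw [tsum_mul_left, (hs _).tsum_add (hs _), toeplitzEntry_eq_tsum, toeplitzEntry_eq_tsum]

/-- Up to the factor π the form is the integral over [0, π] of the symbol times |∑ v_j e^(ijθ)|². -/
lemma sum_toeplitzEntry_nonpos {α : ℝ} (h₁ : 1 ≤ α) (h₂ : α ≤ 2) {n : ℕ} (v : Fin n → ℝ) :
    ∑ i, ∑ j, v i * v j * toeplitzEntry α i j ≤ 0 := by
  have hint : ∫ θ in (0 : ℝ)..Real.pi, symbolRe α θ *
      ((∑ i, v i * Real.cos ((i : ℕ) * θ)) ^ 2 + (∑ i, v i * Real.sin ((i : ℕ) * θ)) ^ 2) ≤ 0 := by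
    rw [← neg_nonneg, ← intervalIntegral.integral_neg]
    refine intervalIntegral.integral_nonneg Real.pi_pos.le fun θ hθ => ?_
    rw [neg_nonneg]
    exact mul_nonpos_of_nonpos_of_nonneg (symbolRe_nonpos_of_mem_Icc h₁ h₂ hθ) (by positivity)
  have hexp : ∀ θ : ℝ, symbolRe α θ *
      ((∑ i, v i * Real.cos ((i : ℕ) * θ)) ^ 2 + (∑ i, v i * Real.sin ((i : ℕ) * θ)) ^ 2) =
      ∑ i, ∑ j, v i * v j * (symbolRe α θ * Real.cos ((((i : ℕ) : ℝ) - (j : ℕ)) * θ)) := by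
    intro θ
    rw [sq, sq, Finset.sum_mul_sum, Finset.sum_mul_sum, ← Finset.sum_add_distrib, Finset.mul_sum]
    refine Finset.sum_congr rfl fun i _ => ?_
    rw [← Finset.sum_add_distrib, Finset.mul_sum]
    refine Finset.sum_congr rfl fun j _ => ?_
    rw [sub_mul, Real.cos_sub]
    ring
  have hc := continuous_symbolRe h₁ h₂
  simp only [hexp] at hint
  rw [intervalIntegral.integral_finsetSum fun i _ =>
    Continuous.intervalIntegrable (by fun_prop) _ _] at hint
  have hrow : ∀ i : Fin n, ∫ θ in (0 : ℝ)..Real.pi,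
      ∑ j : Fin n, v i * v j * (symbolRe α θ * Real.cos ((((i : ℕ) : ℝ) - (j : ℕ)) * θ)) =
      ∑ j : Fin n, v i * v j * (Real.pi / 2 * (toeplitzEntry α i j + toeplitzEntry α j i)) := by
    intro i
    rw [intervalIntegral.integral_finsetSum fun i _ =>
      Continuous.intervalIntegrable (by fun_prop) _ _]
    refine Finset.sum_congr rfl fun j _ => ?_
    rw [intervalIntegral.integral_const_mul, integral_symbolRe_mul_cos h₁ h₂]
  simp only [hrow] at hint
  have hsymm : ∑ i : Fin n, ∑ j : Fin n, v i * v j * toeplitzEntry α j i =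
      ∑ i : Fin n, ∑ j : Fin n, v i * v j * toeplitzEntry α i j := by
    rw [Finset.sum_comm]
    refine Finset.sum_congr rfl fun i _ => Finset.sum_congr rfl fun j _ => ?_
    ring
  have hfin : ∑ i : Fin n, ∑ j : Fin n,
      v i * v j * (Real.pi / 2 * (toeplitzEntry α i j + toeplitzEntry α j i)) =
      Real.pi * ∑ i : Fin n, ∑ j : Fin n, v i * v j * toeplitzEntry α i j := by
    have : ∀ i j : Fin n, v i * v j * (Real.pi / 2 * (toeplitzEntry α i j + toeplitzEntry α j i)) =
        Real.pi / 2 * (v i * v j * toeplitzEntry α i j) +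
          Real.pi / 2 * (v i * v j * toeplitzEntry α j i) := fun i j => by ring
    simp only [this, Finset.sum_add_distrib, ← Finset.mul_sum]
    rw [hsymm]
    ring
  rw [hfin] at hint
  exact nonpos_of_mul_nonpos_right hint Real.pi_pos

/-! ### Definiteness of the matrices of the scheme. -/

open Matrix

lemma leftMatrix_apply {α : ℝ} (h₁ : 1 ≤ α) (h₂ : α ≤ 2) (h : ℝ) (N : ℕ) (i j : Fin (N + 1)) :
    leftMatrix α h N i j = 1 / h ^ α * toeplitzEntry α i j := by
  rw [leftMatrix, Matrix.of_apply, toeplitzEntry, weight_eq_coeff h₁ h₂]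
  split_ifs <;> simp

lemma dotProduct_leftMatrix_mulVec_nonpos {α : ℝ} (h₁ : 1 ≤ α) (h₂ : α ≤ 2) {h : ℝ} (hh : 0 ≤ h)
    (N : ℕ) (v : Fin (N + 1) → ℝ) : v ⬝ᵥ leftMatrix α h N *ᵥ v ≤ 0 := by
  have e : v ⬝ᵥ leftMatrix α h N *ᵥ v =
      1 / h ^ α * ∑ i, ∑ j, v i * v j * toeplitzEntry α i j := by
    simp only [dotProduct, mulVec, leftMatrix_apply h₁ h₂, Finset.mul_sum]
    refine Finset.sum_congr rfl fun i _ => Finset.sum_congr rfl fun j _ => ?_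
    ring
  rw [e]
  exact mul_nonpos_of_nonneg_of_nonpos (by positivity) (sum_toeplitzEntry_nonpos h₁ h₂ v)

lemma dotProduct_transpose_mulVec_self {n : Type*} [Fintype n] (A : Matrix n n ℝ) (v : n → ℝ) :
    v ⬝ᵥ Aᵀ *ᵥ v = v ⬝ᵥ A *ᵥ v := by
  rw [mulVec_transpose, dotProduct_comm, ← dotProduct_mulVec]

lemma dotProduct_diffusionMatrix_mulVec_nonpos {α K₁ K₂ : ℝ} (h₁ : 1 ≤ α) (h₂ : α ≤ 2)
    (hK₁ : 0 ≤ K₁) (hK₂ : 0 ≤ K₂) {h : ℝ} (hh : 0 ≤ h) (N : ℕ) (v : Fin (N + 1) → ℝ) :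
    v ⬝ᵥ diffusionMatrix α K₁ K₂ h N *ᵥ v ≤ 0 := by
  have hl := dotProduct_leftMatrix_mulVec_nonpos h₁ h₂ hh N v
  rw [diffusionMatrix, add_mulVec, smul_mulVec, smul_mulVec, dotProduct_add, dotProduct_smul,
    dotProduct_smul, dotProduct_transpose_mulVec_self, smul_eq_mul, smul_eq_mul]
  nlinarith [mul_nonneg hK₁ (neg_nonneg.2 hl), mul_nonneg hK₂ (neg_nonneg.2 hl)]

lemma triMatrix_zero (N : ℕ) : triMatrix 0 N = 1 := by
  ext i j
  rw [triMatrix, Matrix.of_apply, Matrix.one_apply]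
  split_ifs <;> simp

lemma triMatrix_transpose (c : ℝ) (N : ℕ) : (triMatrix c N)ᵀ = triMatrix c N := by
  ext i j
  simp only [triMatrix, transpose_apply, Matrix.of_apply]
  simp only [eq_comm (a := j) (b := i), or_comm]

lemma sum_ite_le_of_subsingleton {n : Type*} [Fintype n] {c : ℝ} (hc : 0 ≤ c) (P : n → Prop)
    [DecidablePred P] (hP : ∀ i j, P i → P j → i = j) : ∑ j, (if P j then c else 0) ≤ c := by
  rw [← Finset.sum_filter, Finset.sum_const, nsmul_eq_mul]
  have : (Finset.univ.filter P).card ≤ 1 := Finset.card_le_one.2 fun i hi j hj =>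
    hP i j (Finset.mem_filter.1 hi).2 (Finset.mem_filter.1 hj).2
  have h2 : ((Finset.univ.filter P).card : ℝ) ≤ 1 := by exact_mod_cast this
  exact mul_le_of_le_one_left hc h2

/-- A Gershgorin bound: (v_i + v_j)² ≥ 0 for neighbours bounds the off-diagonal part below by minus
its row sums, which are at most 2c. -/
lemma le_dotProduct_triMatrix_mulVec {c : ℝ} (hc : 0 ≤ c) (N : ℕ) (v : Fin (N + 1) → ℝ) :
    (1 - 4 * c) * (v ⬝ᵥ v) ≤ v ⬝ᵥ triMatrix c N *ᵥ v := by
  set A : Fin (N + 1) → Fin (N + 1) → ℝ := fun i j =>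
    if (i : ℕ) = (j : ℕ) + 1 ∨ (j : ℕ) = (i : ℕ) + 1 then c else 0 with hA
  have hA0 : ∀ i j, 0 ≤ A i j := fun i j => by
    simp only [hA]
    split_ifs
    · exact hc
    · exact le_rfl
  have hAs : ∀ i j, A i j = A j i := fun i j => by simp only [hA, or_comm]
  have hrow : ∀ i, ∑ j, A i j ≤ 2 * c := by
    intro i
    have h1 := sum_ite_le_of_subsingleton hc (fun j : Fin (N + 1) => (i : ℕ) = (j : ℕ) + 1)
      fun j k hj hk => Fin.ext (by omega)
    have h2 := sum_ite_le_of_subsingleton hc (fun j : Fin (N + 1) => (j : ℕ) = (i : ℕ) + 1)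
      fun j k hj hk => Fin.ext (by omega)
    have h3 : ∑ j, A i j ≤ ∑ j : Fin (N + 1), ((if (i : ℕ) = (j : ℕ) + 1 then c else 0) +
        if (j : ℕ) = (i : ℕ) + 1 then c else 0) := by
      refine Finset.sum_le_sum fun j _ => ?_
      simp only [hA]
      split_ifs <;> first | omega | linarith
    rw [Finset.sum_add_distrib] at h3
    linarith
  have hT : ∀ i j, triMatrix c N i j = (if i = j then 1 - 2 * c else 0) + A i j := by
    intro i j
    simp only [triMatrix, Matrix.of_apply, hA]
    by_cases h : i = j
    · subst h
      simp
    · simp [h]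
  have e : v ⬝ᵥ triMatrix c N *ᵥ v =
      (1 - 2 * c) * (v ⬝ᵥ v) + ∑ i, ∑ j, A i j * (v i * v j) := by
    simp only [dotProduct, mulVec, hT, add_mul, Finset.sum_add_distrib, mul_add, Finset.mul_sum,
      ite_mul, zero_mul]
    congr 1
    · refine Finset.sum_congr rfl fun i _ => ?_
      simp
      ring
    · refine Finset.sum_congr rfl fun i _ => Finset.sum_congr rfl fun j _ => ?_
      ring
  have hlow : -∑ i, ∑ j, A i j * v i ^ 2 ≤ ∑ i, ∑ j, A i j * (v i * v j) := by
    have hsw : ∑ i, ∑ j, A i j * v j ^ 2 = ∑ i, ∑ j, A i j * v i ^ 2 := by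
      rw [Finset.sum_comm]
      exact Finset.sum_congr rfl fun i _ => Finset.sum_congr rfl fun j _ => by rw [hAs]
    have hsq : 0 ≤ ∑ i, ∑ j, A i j * (v i + v j) ^ 2 :=
      Finset.sum_nonneg fun i _ => Finset.sum_nonneg fun j _ => mul_nonneg (hA0 i j) (sq_nonneg _)
    have hex : ∑ i, ∑ j, A i j * (v i + v j) ^ 2 = ∑ i, ∑ j, A i j * v i ^ 2 +
        ∑ i, ∑ j, A i j * v j ^ 2 + 2 * ∑ i, ∑ j, A i j * (v i * v j) := by
      simp only [Finset.mul_sum, ← Finset.sum_add_distrib]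
      exact Finset.sum_congr rfl fun i _ => Finset.sum_congr rfl fun j _ => by ring
    linarith
  have hup : ∑ i, ∑ j, A i j * v i ^ 2 ≤ 2 * c * (v ⬝ᵥ v) := by
    rw [dotProduct, Finset.mul_sum]
    refine Finset.sum_le_sum fun i _ => ?_
    rw [← Finset.sum_mul, ← sq]
    exact mul_le_mul_of_nonneg_right (hrow i) (sq_nonneg _)
  rw [e]
  linarith

lemma a₂_mem {α : ℝ} (h₁ : 1 ≤ α) (h₂ : α ≤ 2) : 0 ≤ a₂ α 1 ∧ a₂ α 1 ≤ 1 / 5 := by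
  have hα : 0 < α := by linarith
  have e : a₂ α 1 = (-2 * α ^ 2 + 6 * α - 3) / (6 * α) := by
    rw [a₂]
    field_simp
    ring
  rw [e]
  constructor
  · refine div_nonneg ?_ (by linarith)
    nlinarith
  · rw [div_le_div_iff₀ (by linarith) (by norm_num)]
    -- The inequality is 10α² − 24α + 15 ≥ 0, and 6/5 is the minimiser.
    nlinarith [sq_nonneg (α - 6 / 5)]

lemma exists_precMatrix_eq {α : ℝ} (h₁ : 1 ≤ α) (h₂ : α ≤ 2) {p : ℕ} (hp : p = 2 ∨ p = 3) :
    ∃ c : ℝ, ((p = 2 ∧ c = 0) ∨ (p = 3 ∧ c = a₂ α 1)) ∧ 0 ≤ c ∧ c ≤ 1 / 5 ∧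
      ∀ N, precMatrix α p N = triMatrix c N := by
  rcases hp with rfl | rfl
  · exact ⟨0, Or.inl ⟨rfl, rfl⟩, le_rfl, by norm_num, fun N => by
      rw [precMatrix, if_pos rfl, triMatrix_zero]⟩
  · exact ⟨a₂ α 1, Or.inr ⟨rfl, rfl⟩, (a₂_mem h₁ h₂).1, (a₂_mem h₁ h₂).2, fun N => by
      rw [precMatrix, if_neg (by norm_num)]⟩

/-! ### Energy estimate and solvability of one time step. -/

section energy
variable {N : ℕ} {P D : Matrix (Fin (N + 1)) (Fin (N + 1)) ℝ}

/-- Testing with e₁ + e₀ makes the left side telescope, by symmetry of P, and the diffusion term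
nonpositive. -/
lemma energy_step (hPs : Pᵀ = P) (hD : ∀ v, v ⬝ᵥ D *ᵥ v ≤ 0) {τ : ℝ} (hτ : 0 ≤ τ)
    {e₀ e₁ R : Fin (N + 1) → ℝ} (hb₀ : e₀ 0 = 0 ∧ e₀ (Fin.last N) = 0)
    (hb₁ : e₁ 0 = 0 ∧ e₁ (Fin.last N) = 0)
    (hstep : ∀ i, i ≠ 0 → i ≠ Fin.last N →
      (P *ᵥ (e₁ - e₀)) i = τ / 2 * (D *ᵥ (e₁ + e₀)) i + τ * R i) :
    e₁ ⬝ᵥ P *ᵥ e₁ - e₀ ⬝ᵥ P *ᵥ e₀ ≤ τ * ((e₁ + e₀) ⬝ᵥ R) := by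
  have e1 : (e₁ + e₀) ⬝ᵥ P *ᵥ (e₁ - e₀) = e₁ ⬝ᵥ P *ᵥ e₁ - e₀ ⬝ᵥ P *ᵥ e₀ := by
    have hsym : e₀ ⬝ᵥ P *ᵥ e₁ = e₁ ⬝ᵥ P *ᵥ e₀ := by
      rw [dotProduct_mulVec, ← mulVec_transpose, hPs, dotProduct_comm]
    rw [add_dotProduct, mulVec_sub, dotProduct_sub, dotProduct_sub, hsym]
    ring
  -- The equation is known only at interior nodes; at the end points the test vector vanishes.
  have e2 : (e₁ + e₀) ⬝ᵥ P *ᵥ (e₁ - e₀) =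
      τ / 2 * ((e₁ + e₀) ⬝ᵥ D *ᵥ (e₁ + e₀)) + τ * ((e₁ + e₀) ⬝ᵥ R) := by
    simp only [dotProduct, Finset.mul_sum, ← Finset.sum_add_distrib]
    refine Finset.sum_congr rfl fun i _ => ?_
    by_cases h0 : i = 0
    · simp [h0, hb₀.1, hb₁.1]
    · by_cases hl : i = Fin.last N
      · simp [hl, hb₀.2, hb₁.2]
      · rw [hstep i h0 hl]
        ring
  rw [← e1, e2]
  have := hD (e₁ + e₀)
  nlinarith

lemma sqrt_dotProduct_le (hP : ∀ v : Fin (N + 1) → ℝ, 1 / 5 * (v ⬝ᵥ v) ≤ v ⬝ᵥ P *ᵥ v)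
    (v : Fin (N + 1) → ℝ) : √(v ⬝ᵥ v) ≤ √5 * √(v ⬝ᵥ P *ᵥ v) := by
  rw [← Real.sqrt_mul (by norm_num)]
  exact Real.sqrt_le_sqrt (by linarith [hP v])

lemma dotProduct_le_sqrt_mul_sqrt {n : Type*} [Fintype n] (v w : n → ℝ) :
    v ⬝ᵥ w ≤ √(v ⬝ᵥ v) * √(w ⬝ᵥ w) := by
  simpa [dotProduct, sq] using Real.sum_mul_le_sqrt_mul_sqrt Finset.univ v w

/-- The difference of squared energies is (x₁ − x₀)(x₁ + x₀), and Cauchy–Schwarz bounds the source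
by a multiple of the same x₁ + x₀, which cancels. Arguing by contradiction ensures that it is
positive. -/
lemma sqrt_energy_step (hPs : Pᵀ = P)
    (hP : ∀ v : Fin (N + 1) → ℝ, 1 / 5 * (v ⬝ᵥ v) ≤ v ⬝ᵥ P *ᵥ v)
    (hD : ∀ v, v ⬝ᵥ D *ᵥ v ≤ 0) {τ : ℝ} (hτ : 0 ≤ τ)
    {e₀ e₁ R : Fin (N + 1) → ℝ} (hb₀ : e₀ 0 = 0 ∧ e₀ (Fin.last N) = 0)
    (hb₁ : e₁ 0 = 0 ∧ e₁ (Fin.last N) = 0)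
    (hstep : ∀ i, i ≠ 0 → i ≠ Fin.last N →
      (P *ᵥ (e₁ - e₀)) i = τ / 2 * (D *ᵥ (e₁ + e₀)) i + τ * R i) :
    √(e₁ ⬝ᵥ P *ᵥ e₁) ≤ √(e₀ ⬝ᵥ P *ᵥ e₀) + √5 * τ * √(R ⬝ᵥ R) := by
  have h := energy_step hPs hD hτ hb₀ hb₁ hstep
  have hnn : ∀ v : Fin (N + 1) → ℝ, 0 ≤ v ⬝ᵥ P *ᵥ v := fun v =>
    le_trans (mul_nonneg (by norm_num)
      (by simpa [dotProduct] using Finset.sum_nonneg fun i _ => mul_self_nonneg (v i))) (hP v)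
  set x₁ := √(e₁ ⬝ᵥ P *ᵥ e₁) with hx₁
  set x₀ := √(e₀ ⬝ᵥ P *ᵥ e₀) with hx₀
  set ρ := √(R ⬝ᵥ R) with hρ
  have hρ0 : 0 ≤ ρ := Real.sqrt_nonneg _
  have hx1 : 0 ≤ x₁ := Real.sqrt_nonneg _
  have hx0 : 0 ≤ x₀ := Real.sqrt_nonneg _
  have hR : (e₁ + e₀) ⬝ᵥ R ≤ √5 * (x₁ + x₀) * ρ := by
    rw [add_dotProduct]
    have h1 := dotProduct_le_sqrt_mul_sqrt e₁ R
    have h0 := dotProduct_le_sqrt_mul_sqrt e₀ R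
    have h1' := mul_le_mul_of_nonneg_right (sqrt_dotProduct_le hP e₁) hρ0
    have h0' := mul_le_mul_of_nonneg_right (sqrt_dotProduct_le hP e₀) hρ0
    calc _ ≤ √5 * x₁ * ρ + √5 * x₀ * ρ := by linarith
      _ = _ := by ring
  have hsq : x₁ ^ 2 - x₀ ^ 2 ≤ τ * (√5 * (x₁ + x₀) * ρ) := by
    rw [hx₁, hx₀, Real.sq_sqrt (hnn _), Real.sq_sqrt (hnn _)]
    exact h.trans (mul_le_mul_of_nonneg_left hR hτ)
  by_contra! hlt
  have h5 : 0 ≤ √5 * τ * ρ := by positivity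
  have hpos : 0 < x₁ + x₀ := by linarith
  nlinarith [mul_pos hpos (show 0 < x₁ - x₀ - √5 * τ * ρ by linarith)]

/-- The constant 5 is √5 from the energy step times √5 from returning from the P-energy to the
Euclidean norm; M τ is the final time. -/
lemma gridNorm_le_of_step (hPs : Pᵀ = P)
    (hP : ∀ v : Fin (N + 1) → ℝ, 1 / 5 * (v ⬝ᵥ v) ≤ v ⬝ᵥ P *ᵥ v)
    (hD : ∀ v, v ⬝ᵥ D *ᵥ v ≤ 0) {τ h r : ℝ} (hτ : 0 ≤ τ) (hh : 0 ≤ h) {M : ℕ}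
    {e : Fin (M + 1) → Fin (N + 1) → ℝ} {R : Fin M → Fin (N + 1) → ℝ} (he0 : e 0 = 0)
    (hb : ∀ m, e m 0 = 0 ∧ e m (Fin.last N) = 0)
    (hstep : ∀ m i, i ≠ 0 → i ≠ Fin.last N → (P *ᵥ (e m.succ - e m.castSucc)) i =
      τ / 2 * (D *ᵥ (e m.succ + e m.castSucc)) i + τ * R m i)
    (hR : ∀ m i, |R m i| ≤ r) (hr : 0 ≤ r) (m : Fin (M + 1)) :
    gridNorm h N (e m) ≤ 5 * (M * τ) * √(h * (N + 1)) * r := by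
  have hρ : ∀ m, √(R m ⬝ᵥ R m) ≤ √(N + 1) * r := by
    intro m
    rw [← Real.sqrt_sq hr, ← Real.sqrt_mul (by positivity)]
    refine Real.sqrt_le_sqrt ?_
    have : R m ⬝ᵥ R m ≤ ∑ _i : Fin (N + 1), r ^ 2 := by
      rw [dotProduct]
      refine Finset.sum_le_sum fun i _ => ?_
      rw [← sq, ← sq_abs]
      exact pow_le_pow_left₀ (abs_nonneg _) (hR m i) 2
    simpa using this
  have key : ∀ m : Fin (M + 1), √(e m ⬝ᵥ P *ᵥ e m) ≤ m * (√5 * τ * (√(N + 1) * r)) := by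
    intro m
    induction m using Fin.induction with
    | zero => simp [he0]
    | succ m ih =>
      have h1 := sqrt_energy_step hPs hP hD hτ (hb m.castSucc) (hb m.succ) (hstep m)
      have h2 : √5 * τ * √(R m ⬝ᵥ R m) ≤ √5 * τ * (√(N + 1) * r) :=
        mul_le_mul_of_nonneg_left (hρ m) (by positivity)
      rw [Fin.val_castSucc] at ih
      rw [Fin.val_succ]
      push_cast
      linarith
  have hmM : ((m : ℕ) : ℝ) ≤ M := by exact_mod_cast Nat.lt_succ_iff.1 m.isLt
  have h1 : gridNorm h N (e m) ≤ √(h * (e m ⬝ᵥ e m)) := by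
    refine Real.sqrt_le_sqrt (mul_le_mul_of_nonneg_left ?_ hh)
    refine Finset.sum_le_sum fun i _ => ?_
    split_ifs
    · rw [sq]
    · exact mul_self_nonneg _
  refine h1.trans ?_
  rw [Real.sqrt_mul hh, Real.sqrt_mul hh]
  have h5 : √5 * √5 = 5 := Real.mul_self_sqrt (by norm_num)
  calc √h * √(e m ⬝ᵥ e m) ≤ √h * (√5 * (M * (√5 * τ * (√(N + 1) * r)))) := by
        gcongr
        refine (sqrt_dotProduct_le hP (e m)).trans ?_
        gcongr
        refine (key m).trans ?_
        gcongr
    _ = (√5 * √5) * (M * τ) * (√h * √(N + 1)) * r := by ring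
    _ = _ := by rw [h5]

/-- Replacing the boundary rows by those of the identity gives a square system. A kernel vector
vanishes at the end points, so testing with itself and the two signs force it to be zero. -/
lemma existsUnique_step (hP : ∀ v : Fin (N + 1) → ℝ, 1 / 5 * (v ⬝ᵥ v) ≤ v ⬝ᵥ P *ᵥ v)
    (hD : ∀ v, v ⬝ᵥ D *ᵥ v ≤ 0) {τ : ℝ} (hτ : 0 ≤ τ) (g : Fin (N + 1) → ℝ) :
    ∃! v : Fin (N + 1) → ℝ, (∀ i, i ≠ 0 → i ≠ Fin.last N →
      (P *ᵥ v) i - τ / 2 * (D *ᵥ v) i = g i) ∧ v 0 = g 0 ∧ v (Fin.last N) = g (Fin.last N) := by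
  set A : Matrix (Fin (N + 1)) (Fin (N + 1)) ℝ := Matrix.of fun i j =>
    if i ≠ 0 ∧ i ≠ Fin.last N then P i j - τ / 2 * D i j else (1 : Matrix _ _ ℝ) i j with hA
  have hAi : ∀ v i, i ≠ 0 → i ≠ Fin.last N →
      (A *ᵥ v) i = (P *ᵥ v) i - τ / 2 * (D *ᵥ v) i := by
    intro v i h0 hl
    simp only [mulVec, dotProduct, hA, Matrix.of_apply, h0, hl, ne_eq, not_false_eq_true,
      and_self, if_true, Finset.mul_sum, ← Finset.sum_sub_distrib]
    exact Finset.sum_congr rfl fun j _ => by ring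
  have hAb : ∀ v i, (i = 0 ∨ i = Fin.last N) → (A *ᵥ v) i = v i := by
    intro v i hi
    have hi' : ¬(i ≠ 0 ∧ i ≠ Fin.last N) := by tauto
    have e : A i = (1 : Matrix _ _ ℝ) i := by
      ext j
      rw [hA, Matrix.of_apply, if_neg hi']
    rw [mulVec, e, ← mulVec, one_mulVec]
  have hiff : ∀ v, A *ᵥ v = g ↔ (∀ i, i ≠ 0 → i ≠ Fin.last N →
      (P *ᵥ v) i - τ / 2 * (D *ᵥ v) i = g i) ∧ v 0 = g 0 ∧ v (Fin.last N) = g (Fin.last N) := by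
    intro v
    constructor
    · intro h
      refine ⟨fun i h0 hl => ?_, ?_, ?_⟩
      · rw [← hAi v i h0 hl, h]
      · rw [← hAb v 0 (Or.inl rfl), h]
      · rw [← hAb v _ (Or.inr rfl), h]
    · rintro ⟨h, h0, hl⟩
      ext i
      by_cases hi0 : i = 0
      · rw [hAb v i (Or.inl hi0), hi0, h0]
      · by_cases hil : i = Fin.last N
        · rw [hAb v i (Or.inr hil), hil, hl]
        · rw [hAi v i hi0 hil, h i hi0 hil]
  have hker : ∀ v, A *ᵥ v = 0 → v = 0 := by
    intro v hv
    have e : v ⬝ᵥ P *ᵥ v = τ / 2 * (v ⬝ᵥ D *ᵥ v) := by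
      simp only [dotProduct, Finset.mul_sum]
      refine Finset.sum_congr rfl fun i _ => ?_
      have hvi := congrFun hv i
      by_cases hi : i = 0 ∨ i = Fin.last N
      · rw [hAb v i hi] at hvi
        simp [hvi]
      · push Not at hi
        rw [hAi v i hi.1 hi.2] at hvi
        simp only [Pi.zero_apply] at hvi
        linear_combination v i * hvi
    have h1 := hP v
    have h2 := hD v
    have h3 : v ⬝ᵥ v ≤ 0 := by
      rw [e] at h1
      nlinarith
    have h4 : 0 ≤ v ⬝ᵥ v := by
      simpa [dotProduct] using Finset.sum_nonneg fun i _ => mul_self_nonneg (v i)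
    exact dotProduct_self_eq_zero.1 (le_antisymm h3 h4)
  have hinj : Function.Injective A.mulVec := by
    intro v w hvw
    have := hker (v - w) (by rw [mulVec_sub]; exact sub_eq_zero.2 hvw)
    exact sub_eq_zero.1 this
  obtain ⟨v, hv⟩ := mulVec_surjective_iff_isUnit.2 (mulVec_injective_iff_isUnit.1 hinj) g
  exact ⟨v, (hiff v).1 hv, fun w hw => hinj (((hiff w).2 hw).trans hv.symm)⟩

end energy

/-! ### Quadrature errors in time. -/

/-- As a function of the right end point, the error and its derivative both vanish at t₀, and its
second derivative is −(t − t₀)/2 · φ₃. Two mean value inequalities suffice; the constant is not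
sharp. -/
lemma trapezoid_le {φ φ₁ φ₂ φ₃ : ℝ → ℝ} {S : Set ℝ} {t₀ t₁ B : ℝ} (h01 : t₀ ≤ t₁)
    (hS : Icc t₀ t₁ ⊆ S) (h0 : ∀ t ∈ S, HasDerivWithinAt φ (φ₁ t) S t)
    (h1 : ∀ t ∈ S, HasDerivWithinAt φ₁ (φ₂ t) S t) (h2 : ∀ t ∈ S, HasDerivWithinAt φ₂ (φ₃ t) S t)
    (hB : ∀ t ∈ S, |φ₃ t| ≤ B) :
    |φ t₁ - φ t₀ - (t₁ - t₀) / 2 * (φ₁ t₀ + φ₁ t₁)| ≤ B / 2 * (t₁ - t₀) ^ 3 := by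
  set τ := t₁ - t₀ with hτ
  have hτ0 : 0 ≤ τ := sub_nonneg.2 h01
  have m0 : t₀ ∈ Icc t₀ t₁ := left_mem_Icc.2 h01
  have m1 : t₁ ∈ Icc t₀ t₁ := right_mem_Icc.2 h01
  have hB0 : 0 ≤ B := (abs_nonneg _).trans (hB t₀ (hS m0))
  set δ : ℝ → ℝ := fun t => (φ₁ t - φ₁ t₀) / 2 - (t - t₀) / 2 * φ₂ t with hδ
  have hlin : ∀ t, HasDerivWithinAt (fun t : ℝ => (t - t₀) / 2) (1 / 2) (Icc t₀ t₁) t := fun t =>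
    ((hasDerivWithinAt_id t _).sub_const t₀).div_const 2
  have dδ : ∀ t ∈ Icc t₀ t₁, HasDerivWithinAt δ (-((t - t₀) / 2 * φ₃ t)) (Icc t₀ t₁) t := by
    intro t ht
    have a1 := (((h1 t (hS ht)).mono hS).sub_const (φ₁ t₀)).div_const 2
    have a2 := (hlin t).mul ((h2 t (hS ht)).mono hS)
    exact (a1.sub a2).congr_deriv (by ring)
  have bδ' : ∀ t ∈ Icc t₀ t₁, ‖-((t - t₀) / 2 * φ₃ t)‖ ≤ τ / 2 * B := by
    intro t ht
    rw [norm_neg, norm_mul, Real.norm_eq_abs, Real.norm_eq_abs,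
      abs_of_nonneg (by linarith [ht.1])]
    exact mul_le_mul (by linarith [ht.2]) (hB t (hS ht)) (abs_nonneg _) (by linarith)
  have hδ0 : δ t₀ = 0 := by simp [hδ]
  have bδ : ∀ t ∈ Icc t₀ t₁, ‖δ t‖ ≤ τ / 2 * B * τ := by
    intro t ht
    have h := (convex_Icc t₀ t₁).norm_image_sub_le_of_norm_hasDerivWithin_le dδ bδ' m0 ht
    rw [hδ0, sub_zero] at h
    refine h.trans (mul_le_mul_of_nonneg_left ?_ (by positivity))
    rw [Real.norm_eq_abs, abs_of_nonneg (by linarith [ht.1])]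
    linarith [ht.2]
  set ε : ℝ → ℝ := fun t => φ t - φ t₀ - (t - t₀) / 2 * (φ₁ t₀ + φ₁ t) with hε
  have dε : ∀ t ∈ Icc t₀ t₁, HasDerivWithinAt ε (δ t) (Icc t₀ t₁) t := by
    intro t ht
    have a1 := ((h0 t (hS ht)).mono hS).sub_const (φ t₀)
    have a2 := (hlin t).mul (((h1 t (hS ht)).mono hS).const_add (φ₁ t₀))
    exact (a1.sub a2).congr_deriv (by simp only [hδ]; ring)
  have h := (convex_Icc t₀ t₁).norm_image_sub_le_of_norm_hasDerivWithin_le dε bδ m0 m1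
  have hε0 : ε t₀ = 0 := by simp [hε]
  rw [hε0, sub_zero, Real.norm_eq_abs, Real.norm_eq_abs, abs_of_nonneg (sub_nonneg.2 h01)] at h
  refine h.trans_eq ?_
  rw [← hτ]
  ring

/-- The tangent at the midpoint is subtracted first: its contributions at the two end points cancel,
and the rest is quadratic. -/
lemma midpoint_le {ψ ψ₁ ψ₂ : ℝ → ℝ} {S : Set ℝ} {t₀ t₁ B : ℝ} (h01 : t₀ ≤ t₁)
    (hS : Icc t₀ t₁ ⊆ S) (h0 : ∀ t ∈ S, HasDerivWithinAt ψ (ψ₁ t) S t)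
    (h1 : ∀ t ∈ S, HasDerivWithinAt ψ₁ (ψ₂ t) S t) (hB : ∀ t ∈ S, |ψ₂ t| ≤ B) :
    |ψ t₀ + ψ t₁ - 2 * ψ ((t₁ + t₀) / 2)| ≤ 2 * B * (t₁ - t₀) ^ 2 := by
  set s := (t₁ + t₀) / 2 with hs
  have m0 : t₀ ∈ Icc t₀ t₁ := left_mem_Icc.2 h01
  have m1 : t₁ ∈ Icc t₀ t₁ := right_mem_Icc.2 h01
  have ms : s ∈ Icc t₀ t₁ := ⟨by rw [hs]; linarith, by rw [hs]; linarith⟩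
  have hB0 : 0 ≤ B := (abs_nonneg _).trans (hB t₀ (hS m0))
  have hdist : ∀ t ∈ Icc t₀ t₁, ‖t - s‖ ≤ t₁ - t₀ := fun t ht => by
    rw [Real.norm_eq_abs, abs_le]
    constructor <;> linarith [ht.1, ht.2, ms.1, ms.2]
  set χ : ℝ → ℝ := fun t => ψ t - (t - s) * ψ₁ s with hχ
  have dχ : ∀ t ∈ Icc t₀ t₁, HasDerivWithinAt χ (ψ₁ t - ψ₁ s) (Icc t₀ t₁) t := by
    intro t ht
    have a1 := (((hasDerivWithinAt_id t (Icc t₀ t₁)).sub_const s).mul_const (ψ₁ s))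
    exact (((h0 t (hS ht)).mono hS).sub a1).congr_deriv (by ring)
  have bχ : ∀ t ∈ Icc t₀ t₁, ‖ψ₁ t - ψ₁ s‖ ≤ B * (t₁ - t₀) := by
    intro t ht
    refine ((convex_Icc t₀ t₁).norm_image_sub_le_of_norm_hasDerivWithin_le
      (fun x hx => (h1 x (hS hx)).mono hS) (fun x hx => hB x (hS hx)) ms ht).trans ?_
    exact mul_le_mul_of_nonneg_left (hdist t ht) hB0
  have key : ∀ t ∈ Icc t₀ t₁, |χ t - ψ s| ≤ B * (t₁ - t₀) ^ 2 := by
    intro t ht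
    have h := (convex_Icc t₀ t₁).norm_image_sub_le_of_norm_hasDerivWithin_le dχ bχ ms ht
    have hχs : χ s = ψ s := by simp [hχ]
    rw [hχs] at h
    refine h.trans ((mul_le_mul_of_nonneg_left (hdist t ht)
      (mul_nonneg hB0 (sub_nonneg.2 h01))).trans_eq (by ring))
  have k0 := abs_le.1 (key t₀ m0)
  have k1 := abs_le.1 (key t₁ m1)
  have hsum : ψ t₀ + ψ t₁ - 2 * ψ s = (χ t₀ - ψ s) + (χ t₁ - ψ s) := by
    simp only [hχ]
    rw [hs]
    ring
  rw [hsum, abs_le]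
  constructor <;> linarith [k0.1, k0.2, k1.1, k1.2]

lemma hasDerivWithinAt_derivWithin_of_contDiffOn {S : Set ℝ} (hu : UniqueDiffOn ℝ S) {n : ℕ}
    {f : ℝ → ℝ} (hf : ContDiffOn ℝ (n + 1 : ℕ) f S) :
    (∀ t ∈ S, HasDerivWithinAt f (derivWithin f S t) S t) ∧
      ContDiffOn ℝ n (derivWithin f S) S := by
  have hf' : ContDiffOn ℝ ((n : WithTop ℕ∞) + 1) f S := by exact_mod_cast hf
  have h := (contDiffOn_succ_iff_derivWithin hu).1 hf'
  exact ⟨fun t ht => (h.1 t ht).hasDerivWithinAt, h.2.2⟩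

lemma TimeSmooth.exists_trapezoid {a b T : ℝ} (hT : 0 < T) {g : ℝ → ℝ → ℝ}
    (h : TimeSmooth a b T 3 g) : ∃ B, 0 ≤ B ∧ ∀ x ∈ Icc a b, ∀ t₀ ∈ Icc 0 T, ∀ t₁ ∈ Icc 0 T,
      t₀ ≤ t₁ → ∀ d₀ d₁, HasDerivWithinAt (fun s => g x s) d₀ (Icc 0 T) t₀ →
      HasDerivWithinAt (fun s => g x s) d₁ (Icc 0 T) t₁ →
      |g x t₁ - g x t₀ - (t₁ - t₀) / 2 * (d₀ + d₁)| ≤ B * (t₁ - t₀) ^ 3 := by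
  obtain ⟨h1, B, hB⟩ := h
  refine ⟨|B| / 2, by positivity, fun x hx t₀ ht₀ t₁ ht₁ h01 d₀ d₁ hd₀ hd₁ => ?_⟩
  have hu : UniqueDiffOn ℝ (Icc 0 T) := uniqueDiffOn_Icc hT
  obtain ⟨g1, c1⟩ := hasDerivWithinAt_derivWithin_of_contDiffOn hu (n := 2) (h1 x hx)
  obtain ⟨g2, c2⟩ := hasDerivWithinAt_derivWithin_of_contDiffOn hu (n := 1) c1
  obtain ⟨g3, -⟩ := hasDerivWithinAt_derivWithin_of_contDiffOn hu (n := 0) c2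
  have := trapezoid_le h01 (Icc_subset_Icc ht₀.1 ht₁.2) g1 g2 g3 (B := |B|) fun t ht => by
    have h3 := hB x hx t ht
    rw [iteratedDerivWithin_succ', iteratedDerivWithin_succ', iteratedDerivWithin_one] at h3
    exact h3.trans (le_abs_self B)
  rwa [hd₀.derivWithin (hu t₀ ht₀), hd₁.derivWithin (hu t₁ ht₁)] at this

lemma TimeSmooth.exists_midpoint {a b T : ℝ} (hT : 0 < T) {g : ℝ → ℝ → ℝ}
    (h : TimeSmooth a b T 2 g) : ∃ B, 0 ≤ B ∧ ∀ x ∈ Icc a b, ∀ t₀ ∈ Icc 0 T, ∀ t₁ ∈ Icc 0 T,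
      t₀ ≤ t₁ → |g x t₀ + g x t₁ - 2 * g x ((t₁ + t₀) / 2)| ≤ B * (t₁ - t₀) ^ 2 := by
  obtain ⟨h1, B, hB⟩ := h
  refine ⟨2 * |B|, by positivity, fun x hx t₀ ht₀ t₁ ht₁ h01 => ?_⟩
  have hu : UniqueDiffOn ℝ (Icc 0 T) := uniqueDiffOn_Icc hT
  obtain ⟨g1, c1⟩ := hasDerivWithinAt_derivWithin_of_contDiffOn hu (n := 1) (h1 x hx)
  obtain ⟨g2, -⟩ := hasDerivWithinAt_derivWithin_of_contDiffOn hu (n := 0) c1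
  exact midpoint_le h01 (Icc_subset_Icc ht₀.1 ht₁.2) g1 g2 (B := |B|) fun t ht => by
    have h3 := hB x hx t ht
    rw [iteratedDerivWithin_succ', iteratedDerivWithin_one] at h3
    exact h3.trans (le_abs_self B)

/-! ### Matrix rows as power series coefficients, and the spatial error on the grid. -/

lemma triMatrix_mulVec {c : ℝ} {N l : ℕ} (hl : l + 2 ≤ N) (V : ℕ → ℝ) :
    (triMatrix c N *ᵥ fun j => V j) ⟨l + 1, by omega⟩ =
      V (l + 1) + c * (V l - 2 * V (l + 1) + V (l + 2)) := by
  have e : (triMatrix c N *ᵥ fun j => V j) ⟨l + 1, by omega⟩ =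
      ∑ j ∈ Finset.range (N + 1), ((if j = l + 1 then (1 - 2 * c) * V (l + 1) else 0) +
        ((if j = l then c * V l else 0) + (if j = l + 2 then c * V (l + 2) else 0))) := by
    rw [← Fin.sum_univ_eq_sum_range (fun j => (if j = l + 1 then (1 - 2 * c) * V (l + 1) else 0) +
        ((if j = l then c * V l else 0) + (if j = l + 2 then c * V (l + 2) else 0)))]
    simp only [mulVec, dotProduct, triMatrix, Matrix.of_apply, Fin.ext_iff]
    refine Finset.sum_congr rfl fun j _ => ?_
    by_cases h1 : (j : ℕ) = l + 1
    · simp [h1]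
    · by_cases h2 : (j : ℕ) = l
      · simp [h2]
      · by_cases h3 : (j : ℕ) = l + 2
        · simp [h3]
        · rw [if_neg (by omega), if_neg (by omega), if_neg h1, if_neg h2, if_neg h3]
          ring
  rw [e]
  simp only [Finset.sum_add_distrib, Finset.sum_ite_eq', Finset.mem_range]
  rw [if_pos (by omega), if_pos (by omega), if_pos (by omega)]
  ring

lemma leftMatrix_mulVec {α : ℝ} (h₁ : 1 ≤ α) (h₂ : α ≤ 2) (h : ℝ) {N i : ℕ} (hi : i + 1 ≤ N)
    (V : ℕ → ℝ) : (leftMatrix α h N *ᵥ fun j => V j) ⟨i, by omega⟩ =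
      1 / h ^ α * PowerSeries.coeff (i + 1) (weightPS α * PowerSeries.mk V) := by
  simp only [mulVec, dotProduct, leftMatrix_apply h₁ h₂, mul_assoc]
  rw [← Finset.mul_sum, Fin.sum_univ_eq_sum_range (fun j => toeplitzEntry α i j * V j),
    mul_comm (weightPS α), PowerSeries.coeff_mul, Finset.Nat.sum_antidiagonal_eq_sum_range_succ
    (fun i j => PowerSeries.coeff i (PowerSeries.mk V) * PowerSeries.coeff j (weightPS α))]
  congr 1
  symm
  refine (Finset.sum_subset_zero_on_sdiff (Finset.range_mono (by omega)) ?_ ?_)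
  · intro j hj
    simp only [Finset.mem_sdiff, Finset.mem_range] at hj
    rw [toeplitzEntry, if_neg (by omega), zero_mul]
  · intro j hj
    have := Finset.mem_range.1 hj
    rw [toeplitzEntry, if_pos (by omega), PowerSeries.coeff_mk, mul_comm]

/-- Reversing the order of the nodes carries a Toeplitz matrix to its transpose. -/
lemma leftMatrix_transpose_mulVec {α : ℝ} (h₁ : 1 ≤ α) (h₂ : α ≤ 2) (h : ℝ) {N i : ℕ}
    (hi0 : 1 ≤ i) (hi : i ≤ N) (V : ℕ → ℝ) :
    ((leftMatrix α h N)ᵀ *ᵥ fun j => V j) ⟨i, by omega⟩ =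
      1 / h ^ α * PowerSeries.coeff (N - i + 1)
        (weightPS α * PowerSeries.mk fun j => V (N - j)) := by
  rw [← leftMatrix_mulVec h₁ h₂ h (N := N) (i := N - i) (by omega)]
  simp only [mulVec, dotProduct, leftMatrix_apply h₁ h₂, transpose_apply]
  rw [Fin.sum_univ_eq_sum_range (fun j => 1 / h ^ α * toeplitzEntry α j i * V j),
    Fin.sum_univ_eq_sum_range (fun j => 1 / h ^ α * toeplitzEntry α (N - i) j * V (N - j)),
    ← Finset.sum_range_reflect]
  refine Finset.sum_congr rfl fun j hj => ?_
  have := Finset.mem_range.1 hj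
  have e : toeplitzEntry α (N - j) i = toeplitzEntry α (N - i) j := by
    rw [toeplitzEntry, toeplitzEntry]
    by_cases hc : i ≤ N - j + 1
    · rw [if_pos hc, if_pos (by omega)]
      congr 2
      omega
    · rw [if_neg hc, if_neg (by omega)]
  rw [show N + 1 - 1 - j = N - j by omega, e]

lemma coeff_mul_congr {P G G' : PowerSeries ℝ} {n : ℕ}
    (h : ∀ j ≤ n, PowerSeries.coeff j G = PowerSeries.coeff j G') :
    PowerSeries.coeff n (P * G) = PowerSeries.coeff n (P * G') := by
  rw [PowerSeries.coeff_mul, PowerSeries.coeff_mul]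
  refine Finset.sum_congr rfl fun x hx => ?_
  have hx2 := Finset.HasAntidiagonal.mem_antidiagonal.1 hx
  rw [h x.2 (by omega)]

lemma meshSize_pos {a b : ℝ} (hab : a < b) {N : ℕ} (hN : 0 < N) : 0 < meshSize a b N :=
  div_pos (sub_pos.2 hab) (by exact_mod_cast hN)

lemma meshSize_le {a b : ℝ} (hab : a < b) {N : ℕ} (hN : 0 < N) : meshSize a b N ≤ b - a :=
  div_le_self (sub_pos.2 hab).le (by exact_mod_cast hN)

lemma mul_meshSize (a b : ℝ) {N : ℕ} (hN : 0 < N) : N * meshSize a b N = b - a := by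
  have : (N : ℝ) ≠ 0 := by exact_mod_cast hN.ne'
  rw [meshSize]
  field_simp

lemma mul_meshSize_le {a b : ℝ} (hab : a < b) {N j : ℕ} (hN : 0 < N) (hj : j ≤ N) :
    j * meshSize a b N ≤ b - a := by
  rw [← mul_meshSize a b hN]
  have := meshSize_pos hab hN
  have hj' : (j : ℝ) ≤ N := by exact_mod_cast hj
  gcongr

lemma node_mem {a b : ℝ} (hab : a < b) {N j : ℕ} (hN : 0 < N) (hj : j ≤ N) :
    node a b N j ∈ Icc a b := by
  have h1 := mul_meshSize_le hab hN hj
  have h2 : 0 ≤ j * meshSize a b N := mul_nonneg (Nat.cast_nonneg _) (meshSize_pos hab hN).le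
  exact ⟨by rw [node]; linarith, by rw [node]; linarith⟩

lemma node_sub {a b : ℝ} {N j : ℕ} (hN : 0 < N) (hj : j ≤ N) :
    node a b N (N - j) = b - j * meshSize a b N := by
  have := mul_meshSize a b hN
  rw [node, Nat.cast_sub hj]
  linarith

lemma node_zero (a b : ℝ) (N : ℕ) : node a b N 0 = a := by simp [node]

lemma node_self (a b : ℝ) {N : ℕ} (hN : 0 < N) : node a b N N = b := by
  rw [node, mul_meshSize a b hN]
  ring

/-- The assumed smoothness covers the remainder V^(α+3) of the dyadic argument, already for p = 2.
-/
lemma add_three_le_order {α : ℝ} {p : ℕ} (hp : 2 ≤ p) : α + 3 ≤ (p + ⌈α⌉₊ + 1 : ℕ) := by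
  have h1 := Nat.le_ceil α
  have h2 : (2 : ℝ) ≤ p := by exact_mod_cast hp
  push_cast
  linarith

lemma exists_left_consistency {α a b T : ℝ} (h₁ : 1 ≤ α) (h₂ : α ≤ 2) (hab : a < b)
    {p k : ℕ} {c : ℝ} (hpc : (p = 2 ∧ c = 0) ∨ (p = 3 ∧ c = a₂ α 1)) (hk : α + 3 ≤ k)
    {u L : ℝ → ℝ → ℝ} (hu : SpaceSmooth a b T k (Iic b) u)
    (hL : ∀ x ∈ Icc a b, ∀ t ∈ Icc 0 T, IsLeftGLDeriv α a (fun y => u y t) x (L x t)) :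
    ∃ C, 0 ≤ C ∧ ∀ N : ℕ, 0 < N → ∀ t ∈ Icc 0 T, ∀ (l : ℕ) (hl : l + 2 ≤ N),
      |(leftMatrix α (meshSize a b N) N *ᵥ fun j => u (node a b N j) t) ⟨l + 1, by omega⟩ -
        (L (node a b N (l + 1)) t + c * (L (node a b N l) t - 2 * L (node a b N (l + 1)) t +
          L (node a b N (l + 2)) t))| ≤ C * meshSize a b N ^ p := by
  obtain ⟨B, hB⟩ := hu.exists_diffBound_left
  obtain ⟨C, hC0, hC⟩ := exists_spatial_consistency h₁ h₂ hpc hk (sub_pos.2 hab)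
  refine ⟨C * |B|, by positivity, fun N hN t ht l hl => ?_⟩
  set h := meshSize a b N with hh
  have hh0 : 0 < h := meshSize_pos hab hN
  have hG : ∀ j, j ≤ N → IsLeftGLDeriv α 0
      (fun y => (Icc a b).indicator (fun x => u x t) (a + y)) (j * h) (L (node a b N j) t) := by
    intro j hj
    have hm := node_mem hab hN hj
    have := (hL _ hm t ht).indicator hm
    rwa [show node a b N j - a = j * h by rw [node, hh]; ring] at this
  have h3 := hC _ B (hB t ht) h hh0 (meshSize_le hab hN) l _ _ _
    (mul_meshSize_le hab hN hl) (hG l (by omega)) (hG (l + 1) (by omega)) (hG (l + 2) hl)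
  have e : PowerSeries.coeff (l + 2) (weightPS α * gridPS
      (fun y => (Icc a b).indicator (fun x => u x t) (a + y)) h) =
      PowerSeries.coeff (l + 2) (weightPS α * PowerSeries.mk fun j => u (node a b N j) t) := by
    refine coeff_mul_congr fun j hj => ?_
    rw [gridPS, PowerSeries.coeff_mk, PowerSeries.coeff_mk]
    exact indicator_of_mem (node_mem hab hN (hj.trans hl)) _
  rw [e] at h3
  rw [leftMatrix_mulVec h₁ h₂ h (by omega) (fun j => u (node a b N j) t)]
  refine h3.trans ?_
  have := le_abs_self B
  gcongr

lemma exists_right_consistency {α a b T : ℝ} (h₁ : 1 ≤ α) (h₂ : α ≤ 2) (hab : a < b)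
    {p k : ℕ} {c : ℝ} (hpc : (p = 2 ∧ c = 0) ∨ (p = 3 ∧ c = a₂ α 1)) (hk : α + 3 ≤ k)
    {u R : ℝ → ℝ → ℝ} (hu : SpaceSmooth a b T k (Ici a) u)
    (hR : ∀ x ∈ Icc a b, ∀ t ∈ Icc 0 T, IsRightGLDeriv α b (fun y => u y t) x (R x t)) :
    ∃ C, 0 ≤ C ∧ ∀ N : ℕ, 0 < N → ∀ t ∈ Icc 0 T, ∀ (l : ℕ) (hl : l + 2 ≤ N),
      |((leftMatrix α (meshSize a b N) N)ᵀ *ᵥ fun j => u (node a b N j) t) ⟨l + 1, by omega⟩ -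
        (R (node a b N (l + 1)) t + c * (R (node a b N l) t - 2 * R (node a b N (l + 1)) t +
          R (node a b N (l + 2)) t))| ≤ C * meshSize a b N ^ p := by
  obtain ⟨B, hB⟩ := hu.exists_diffBound_right
  obtain ⟨C, hC0, hC⟩ := exists_spatial_consistency h₁ h₂ hpc hk (sub_pos.2 hab)
  refine ⟨C * |B|, by positivity, fun N hN t ht l hl => ?_⟩
  set h := meshSize a b N with hh
  have hh0 : 0 < h := meshSize_pos hab hN
  have hG : ∀ j, j ≤ N → IsLeftGLDeriv α 0
      (fun y => (Icc a b).indicator (fun x => u x t) (b - y)) (j * h)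
        (R (node a b N (N - j)) t) := by
    intro j hj
    have hm := node_mem (j := N - j) hab hN (Nat.sub_le _ _)
    have := (hR _ hm t ht).indicator hm
    rwa [show b - node a b N (N - j) = j * h by rw [node_sub hN hj, hh]; ring] at this
  set l' := N - (l + 2) with hl'
  have h3 := hC _ B (hB t ht) h hh0 (meshSize_le hab hN) l' _ _ _
    (mul_meshSize_le hab hN (show l' + 2 ≤ N by omega)) (hG l' (by omega))
    (hG (l' + 1) (by omega)) (hG (l' + 2) (by omega))
  rw [show N - l' = l + 2 by omega, show N - (l' + 1) = l + 1 by omega,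
    show N - (l' + 2) = l by omega] at h3
  have e : PowerSeries.coeff (l' + 2) (weightPS α * gridPS
      (fun y => (Icc a b).indicator (fun x => u x t) (b - y)) h) =
      PowerSeries.coeff (l' + 2)
        (weightPS α * PowerSeries.mk fun j => u (node a b N (N - j)) t) := by
    refine coeff_mul_congr fun j hj => ?_
    have hjN : j ≤ N := by omega
    rw [gridPS, PowerSeries.coeff_mk, PowerSeries.coeff_mk]
    have hm := node_mem (j := N - j) hab hN (Nat.sub_le _ _)
    rw [node_sub hN hjN] at hm ⊢
    exact indicator_of_mem hm _
  rw [e] at h3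
  rw [leftMatrix_transpose_mulVec h₁ h₂ h (by omega) (by omega) (fun j => u (node a b N j) t),
    show N - (l + 1) + 1 = l' + 2 by omega]
  -- Reflection exchanges the two neighbours, and the second difference is symmetric in them.
  rw [show ∀ x y z : ℝ, y + c * (x - 2 * y + z) = y + c * (z - 2 * y + x) by intros; ring]
  refine h3.trans ?_
  have := le_abs_self B
  gcongr

/-- Smoothness and the derivative are available only for a nonzero coefficient, so each side is
treated by cases; for a zero coefficient the values L or R are arbitrary and cancel. -/
lemma exists_diffusion_consistency {α a b T K₁ K₂ : ℝ} (h₁ : 1 ≤ α) (h₂ : α ≤ 2) (hab : a < b)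
    {p k : ℕ} {c : ℝ} (hpc : (p = 2 ∧ c = 0) ∨ (p = 3 ∧ c = a₂ α 1)) (hk : α + 3 ≤ k)
    {u L R : ℝ → ℝ → ℝ} (hleft : K₁ ≠ 0 → SpaceSmooth a b T k (Iic b) u)
    (hright : K₂ ≠ 0 → SpaceSmooth a b T k (Ici a) u)
    (hL : K₁ ≠ 0 → ∀ x ∈ Icc a b, ∀ t ∈ Icc 0 T,
      IsLeftGLDeriv α a (fun y => u y t) x (L x t))
    (hR : K₂ ≠ 0 → ∀ x ∈ Icc a b, ∀ t ∈ Icc 0 T,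
      IsRightGLDeriv α b (fun y => u y t) x (R x t)) :
    ∃ C, 0 ≤ C ∧ ∀ N : ℕ, 0 < N → ∀ t ∈ Icc 0 T, ∀ (l : ℕ) (hl : l + 2 ≤ N),
      |(diffusionMatrix α K₁ K₂ (meshSize a b N) N *ᵥ fun j => u (node a b N j) t)
          ⟨l + 1, by omega⟩ -
        (triMatrix c N *ᵥ fun j => K₁ * L (node a b N j) t + K₂ * R (node a b N j) t)
          ⟨l + 1, by omega⟩| ≤ C * meshSize a b N ^ p := by
  have hleft' : ∃ C, 0 ≤ C ∧ ∀ N : ℕ, 0 < N → ∀ t ∈ Icc 0 T, ∀ (l : ℕ) (hl : l + 2 ≤ N),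
      |K₁ * (leftMatrix α (meshSize a b N) N *ᵥ fun j => u (node a b N j) t) ⟨l + 1, by omega⟩ -
        K₁ * (L (node a b N (l + 1)) t + c * (L (node a b N l) t -
          2 * L (node a b N (l + 1)) t + L (node a b N (l + 2)) t))| ≤
        C * meshSize a b N ^ p := by
    by_cases hK : K₁ = 0
    · exact ⟨0, le_rfl, fun N hN t ht l hl => by simp [hK]⟩
    · obtain ⟨C, hC0, hC⟩ := exists_left_consistency h₁ h₂ hab hpc hk (hleft hK) (hL hK)
      refine ⟨|K₁| * C, by positivity, fun N hN t ht l hl => ?_⟩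
      rw [← mul_sub, abs_mul, mul_assoc]
      exact mul_le_mul_of_nonneg_left (hC N hN t ht l hl) (abs_nonneg _)
  have hright' : ∃ C, 0 ≤ C ∧ ∀ N : ℕ, 0 < N → ∀ t ∈ Icc 0 T, ∀ (l : ℕ) (hl : l + 2 ≤ N),
      |K₂ * ((leftMatrix α (meshSize a b N) N)ᵀ *ᵥ fun j => u (node a b N j) t)
          ⟨l + 1, by omega⟩ -
        K₂ * (R (node a b N (l + 1)) t + c * (R (node a b N l) t -
          2 * R (node a b N (l + 1)) t + R (node a b N (l + 2)) t))| ≤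
        C * meshSize a b N ^ p := by
    by_cases hK : K₂ = 0
    · exact ⟨0, le_rfl, fun N hN t ht l hl => by simp [hK]⟩
    · obtain ⟨C, hC0, hC⟩ := exists_right_consistency h₁ h₂ hab hpc hk (hright hK) (hR hK)
      refine ⟨|K₂| * C, by positivity, fun N hN t ht l hl => ?_⟩
      rw [← mul_sub, abs_mul, mul_assoc]
      exact mul_le_mul_of_nonneg_left (hC N hN t ht l hl) (abs_nonneg _)
  obtain ⟨C₁, hC₁, hl1⟩ := hleft'
  obtain ⟨C₂, hC₂, hr1⟩ := hright'
  refine ⟨C₁ + C₂, by positivity, fun N hN t ht l hl => ?_⟩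
  have t1 := hl1 N hN t ht l hl
  have t2 := hr1 N hN t ht l hl
  rw [triMatrix_mulVec hl fun j => K₁ * L (node a b N j) t + K₂ * R (node a b N j) t,
    diffusionMatrix, add_mulVec, smul_mulVec, smul_mulVec, Pi.add_apply, Pi.smul_apply,
    Pi.smul_apply, smul_eq_mul, smul_eq_mul, add_mul]
  refine le_trans (le_of_eq ?_) ((abs_add_le _ _).trans (add_le_add t1 t2))
  congr 1
  ring

lemma abs_triMatrix_mulVec_le {c : ℝ} (hc0 : 0 ≤ c) (hc : c ≤ 1 / 5) {N l : ℕ} (hl : l + 2 ≤ N)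
    {V : ℕ → ℝ} {D : ℝ} (hV : ∀ j ≤ N, |V j| ≤ D) :
    |(triMatrix c N *ᵥ fun j => V j) ⟨l + 1, by omega⟩| ≤ 2 * D := by
  rw [triMatrix_mulVec hl]
  have a0 := hV l (by omega)
  have a1 := hV (l + 1) (by omega)
  have a2 := hV (l + 2) (by omega)
  have hD : 0 ≤ D := (abs_nonneg _).trans a0
  have a3 : |V l - 2 * V (l + 1) + V (l + 2)| ≤ 4 * D := by
    rw [abs_le] at *
    constructor <;> linarith
  calc _ ≤ |V (l + 1)| + c * |V l - 2 * V (l + 1) + V (l + 2)| := by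
        refine (abs_add_le _ _).trans_eq ?_
        rw [abs_mul, abs_of_nonneg hc0]
    _ ≤ D + 1 / 5 * (4 * D) := by gcongr
    _ ≤ 2 * D := by linarith

/-! ### Truncation error. -/

/-- The local truncation error of the scheme at the time level `m`, zero at the end points. -/
def truncationError (p : ℕ) (α a b T K₁ K₂ : ℝ) (f u : ℝ → ℝ → ℝ) (N M : ℕ) (m : ℕ)
    (i : Fin (N + 1)) : ℝ :=
  if i ≠ 0 ∧ i ≠ Fin.last N then
    1 / meshSize 0 T M *
      ((precMatrix α p N *ᵥ ((fun j : Fin (N + 1) => u (node a b N j) (node 0 T M (m + 1))) -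
          fun j : Fin (N + 1) => u (node a b N j) (node 0 T M m))) i -
        meshSize 0 T M / 2 * (diffusionMatrix α K₁ K₂ (meshSize a b N) N *ᵥ
          ((fun j : Fin (N + 1) => u (node a b N j) (node 0 T M (m + 1))) +
            fun j : Fin (N + 1) => u (node a b N j) (node 0 T M m))) i -
        meshSize 0 T M * (precMatrix α p N *ᵥ
          fun j => f (node a b N j) ((node 0 T M (m + 1) + node 0 T M m) / 2)) i)
  else 0

lemma exists_abs_truncationError_le {p : ℕ} (hp : p = 2 ∨ p = 3) {α a b T K₁ K₂ : ℝ}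
    (h₁ : 1 ≤ α) (h₂ : α ≤ 2) (hab : a < b) (hT : 0 < T) {f : ℝ → ℝ → ℝ} {s₀ φ₁ φ₂ : ℝ → ℝ}
    {u : ℝ → ℝ → ℝ} (hu : IsSolution α a b T K₁ K₂ f s₀ φ₁ φ₂ u)
    (hleft : K₁ ≠ 0 → SpaceSmooth a b T (p + ⌈α⌉₊ + 1) (Iic b) u)
    (hright : K₂ ≠ 0 → SpaceSmooth a b T (p + ⌈α⌉₊ + 1) (Ici a) u)
    (hut : TimeSmooth a b T 3 u) (hft : TimeSmooth a b T 2 f) :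
    ∃ C, 0 ≤ C ∧ ∀ N M : ℕ, 0 < N → 0 < M → ∀ m < M, ∀ i,
      |truncationError p α a b T K₁ K₂ f u N M m i| ≤
        C * (meshSize 0 T M ^ 2 + meshSize a b N ^ p) := by
  obtain ⟨c, hpc, hc0, hc, hprec⟩ := exists_precMatrix_eq h₁ h₂ hp
  -- Dummy values outside the domain make L and R total functions after `choose`.
  have heq : ∀ x t, ∃ L R : ℝ, x ∈ Icc a b → t ∈ Icc 0 T →
      (K₁ ≠ 0 → IsLeftGLDeriv α a (fun y => u y t) x L) ∧
      (K₂ ≠ 0 → IsRightGLDeriv α b (fun y => u y t) x R) ∧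
      HasDerivWithinAt (fun s => u x s) (K₁ * L + K₂ * R + f x t) (Icc 0 T) t := by
    intro x t
    by_cases hxt : x ∈ Icc a b ∧ t ∈ Icc 0 T
    · obtain ⟨L, R, h⟩ := hu.equation x hxt.1 t hxt.2
      exact ⟨L, R, fun _ _ => h⟩
    · exact ⟨0, 0, fun hx ht => absurd ⟨hx, ht⟩ hxt⟩
  choose L R hLR using heq
  obtain ⟨C₁, hC₁, hspace⟩ := exists_diffusion_consistency (K₁ := K₁) (K₂ := K₂) h₁ h₂ hab hpc
    (add_three_le_order (α := α) (show 2 ≤ p by omega)) hleft hright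
    (fun hK x hx t ht => (hLR x t hx ht).1 hK) (fun hK x hx t ht => (hLR x t hx ht).2.1 hK)
  obtain ⟨C₂, hC₂, htrap⟩ := hut.exists_trapezoid hT
  obtain ⟨C₃, hC₃, hmid⟩ := hft.exists_midpoint hT
  refine ⟨C₁ + 2 * C₂ + C₃, by positivity, fun N M hN hM m hm i => ?_⟩
  set h := meshSize a b N with hh
  set τ := meshSize 0 T M with hτ
  have hτ0 : 0 < τ := meshSize_pos hT hM
  have hh0 : 0 < h := meshSize_pos hab hN
  rw [truncationError]
  split_ifs with hi
  swap
  · rw [abs_zero]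
    positivity
  obtain ⟨l, hl, rfl⟩ : ∃ (l : ℕ) (hl : l + 2 ≤ N), i = ⟨l + 1, by omega⟩ := by
    have hi0 : (i : ℕ) ≠ 0 := fun h => hi.1 (Fin.ext h)
    have hil : (i : ℕ) ≠ N := fun h => hi.2 (Fin.ext h)
    have := i.isLt
    exact ⟨i - 1, by omega, Fin.ext (by simp; omega)⟩
  set t₀ := node 0 T M m with ht₀
  set t₁ := node 0 T M (m + 1) with ht₁
  have m0 : t₀ ∈ Icc 0 T := node_mem hT hM hm.le
  have m1 : t₁ ∈ Icc 0 T := node_mem hT hM hm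
  have h10 : t₁ - t₀ = τ := by
    rw [ht₁, ht₀, node, node, hτ]
    push_cast
    ring
  have h01 : t₀ ≤ t₁ := by linarith
  set P := triMatrix c N
  set D := diffusionMatrix α K₁ K₂ h N
  set q : ℝ → ℕ → ℝ := fun t j => K₁ * L (node a b N j) t + K₂ * R (node a b N j) t with hq
  set A : ℕ → ℝ := fun j => u (node a b N j) t₁ - u (node a b N j) t₀ -
    τ / 2 * ((q t₀ j + f (node a b N j) t₀) + (q t₁ j + f (node a b N j) t₁)) with hA
  set F : ℕ → ℝ := fun j => f (node a b N j) t₀ + f (node a b N j) t₁ -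
    2 * f (node a b N j) ((t₁ + t₀) / 2) with hF
  have bA : ∀ j ≤ N, |A j| ≤ C₂ * τ ^ 3 := by
    intro j hj
    have hx := node_mem hab hN hj
    have := htrap _ hx t₀ m0 t₁ m1 h01 _ _ (hLR _ _ hx m0).2.2 (hLR _ _ hx m1).2.2
    rwa [h10] at this
  have bF : ∀ j ≤ N, |F j| ≤ C₃ * τ ^ 2 := by
    intro j hj
    have := hmid _ (node_mem hab hN hj) t₀ m0 t₁ m1 h01
    rwa [h10] at this
  have bPA := abs_triMatrix_mulVec_le hc0 hc hl bA
  have bPF := abs_triMatrix_mulVec_le hc0 hc hl bF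
  have s0 := hspace N hN t₀ m0 l hl
  have s1 := hspace N hN t₁ m1 l hl
  set ι : Fin (N + 1) := ⟨l + 1, by omega⟩
  -- The increment of u splits into the trapezoidal error A, the averaged diffusion q, the midpoint
  -- error F and the source at the half step. After applying P the last cancels, and the averaged q
  -- is compared with the discrete diffusion through Y₀ and Y₁.
  have hdec : (fun j : Fin (N + 1) => u (node a b N j) t₁) -
      (fun j : Fin (N + 1) => u (node a b N j) t₀) =
      (fun j : Fin (N + 1) => A j) + ((τ / 2) • ((fun j : Fin (N + 1) => q t₀ j) +
        (fun j : Fin (N + 1) => q t₁ j)) + ((τ / 2) • (fun j : Fin (N + 1) => F j) +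
        τ • fun j : Fin (N + 1) => f (node a b N j) ((t₁ + t₀) / 2))) := by
    ext j
    simp only [Pi.add_apply, Pi.sub_apply, Pi.smul_apply, smul_eq_mul, hA, hF]
    ring
  rw [hprec, hdec]
  simp only [mulVec_add, mulVec_smul, Pi.add_apply, Pi.smul_apply, smul_eq_mul]
  set Y₀ := (D *ᵥ fun j => u (node a b N j) t₀) ι - (P *ᵥ fun j => q t₀ j) ι with hY₀
  set Y₁ := (D *ᵥ fun j => u (node a b N j) t₁) ι - (P *ᵥ fun j => q t₁ j) ι with hY₁
  set PA := (P *ᵥ fun j => A j) ι with hPA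
  set PF := (P *ᵥ fun j => F j) ι with hPF
  have e : ∀ X : ℝ, PA + (τ / 2 * ((P *ᵥ fun j => q t₀ j) ι + (P *ᵥ fun j => q t₁ j) ι) +
      (τ / 2 * PF + τ * X)) - τ / 2 * ((D *ᵥ fun j => u (node a b N j) t₁) ι +
        (D *ᵥ fun j => u (node a b N j) t₀) ι) - τ * X =
      PA + τ / 2 * PF - τ / 2 * Y₁ - τ / 2 * Y₀ := by
    intro X
    rw [hY₀, hY₁]
    ring
  rw [e, abs_mul, abs_of_pos (one_div_pos.2 hτ0), one_div, inv_mul_le_iff₀ hτ0]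
  have hbound : |PA + τ / 2 * PF - τ / 2 * Y₁ - τ / 2 * Y₀| ≤
      2 * (C₂ * τ ^ 3) + τ / 2 * (2 * (C₃ * τ ^ 2)) + τ / 2 * (C₁ * h ^ p) +
        τ / 2 * (C₁ * h ^ p) := by
    have hτ2 : 0 ≤ τ / 2 := by linarith
    have z1 := mul_le_mul_of_nonneg_left bPF hτ2
    have z2 := mul_le_mul_of_nonneg_left s1 hτ2
    have z3 := mul_le_mul_of_nonneg_left s0 hτ2
    refine (abs_sub _ _).trans (add_le_add ((abs_sub _ _).trans (add_le_add
      ((abs_add_le _ _).trans (add_le_add bPA ?_)) ?_)) ?_)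
    all_goals rw [abs_mul, abs_of_nonneg hτ2]
    · exact z1
    · exact z2
    · exact z3
  refine hbound.trans ?_
  have p1 : 0 ≤ τ * τ ^ 2 := by positivity
  have p2 : 0 ≤ τ * h ^ p := by positivity
  nlinarith [mul_nonneg hC₁ p1, mul_nonneg hC₂ p2, mul_nonneg hC₃ p2]

lemma le_dotProduct_precMatrix_mulVec {α : ℝ} {p N : ℕ} (hp : p = 2 ∨ p = 3) (h₁ : 1 ≤ α)
    (h₂ : α ≤ 2) (v : Fin (N + 1) → ℝ) : 1 / 5 * (v ⬝ᵥ v) ≤ v ⬝ᵥ precMatrix α p N *ᵥ v := by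
  obtain ⟨c, -, hc0, hc, hprec⟩ := exists_precMatrix_eq h₁ h₂ hp
  have h0 : 0 ≤ v ⬝ᵥ v := by
    simpa [dotProduct] using Finset.sum_nonneg fun i _ => mul_self_nonneg (v i)
  rw [hprec]
  refine le_trans ?_ (le_dotProduct_triMatrix_mulVec hc0 N v)
  exact mul_le_mul_of_nonneg_right (by linarith) h0

/-! ### Unique solvability of the scheme and convergence. -/

section scheme
variable {p : ℕ} {α a b T K₁ K₂ : ℝ} {f : ℝ → ℝ → ℝ} {s₀ φ₁ φ₂ : ℝ → ℝ}

/-- The levels are built recursively from the one-step solver. At level 0 the end nodes are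
prescribed by both initial and boundary data, hence the two compatibility hypotheses. -/
lemma existsUnique_isCNSolution (hp : p = 2 ∨ p = 3) (h₁ : 1 ≤ α) (h₂ : α ≤ 2) (hab : a < b)
    (hT : 0 < T) (hK₁ : 0 ≤ K₁) (hK₂ : 0 ≤ K₂) (ha0 : s₀ a = φ₁ 0) (hb0 : s₀ b = φ₂ 0)
    {N M : ℕ} (hN : 0 < N) (hM : 0 < M) :
    ∃! U : Fin (M + 1) → Fin (N + 1) → ℝ,
      IsCNSolution p α a b T K₁ K₂ f s₀ φ₁ φ₂ N M U := by
  set h := meshSize a b N with hh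
  set τ := meshSize 0 T M with hτ
  have hτ0 : 0 < τ := meshSize_pos hT hM
  have hh0 : 0 < h := meshSize_pos hab hN
  set P := precMatrix α p N
  set D := diffusionMatrix α K₁ K₂ h N
  have hP : ∀ v : Fin (N + 1) → ℝ, 1 / 5 * (v ⬝ᵥ v) ≤ v ⬝ᵥ P *ᵥ v :=
    le_dotProduct_precMatrix_mulVec hp h₁ h₂
  have hD : ∀ v, v ⬝ᵥ D *ᵥ v ≤ 0 :=
    dotProduct_diffusionMatrix_mulVec_nonpos h₁ h₂ hK₁ hK₂ hh0.le N
  have hlast : (0 : Fin (N + 1)) ≠ Fin.last N := fun h => by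
    have := congrArg Fin.val h
    simp at this
    omega
  set rhs : ℕ → (Fin (N + 1) → ℝ) → Fin (N + 1) → ℝ := fun m v i =>
    if i = 0 then φ₁ (node 0 T M (m + 1)) else if i = Fin.last N then φ₂ (node 0 T M (m + 1))
    else (P *ᵥ v) i + τ / 2 * (D *ᵥ v) i + τ * (P *ᵥ
      fun j => f (node a b N j) ((node 0 T M (m + 1) + node 0 T M m) / 2)) i with hrhs
  have hstep : ∀ (m : ℕ) (v w : Fin (N + 1) → ℝ),
      ((∀ i, i ≠ 0 → i ≠ Fin.last N → (P *ᵥ (w - v)) i = τ / 2 * (D *ᵥ (w + v)) i +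
        τ * (P *ᵥ fun j => f (node a b N j) ((node 0 T M (m + 1) + node 0 T M m) / 2)) i) ∧
        w 0 = φ₁ (node 0 T M (m + 1)) ∧ w (Fin.last N) = φ₂ (node 0 T M (m + 1))) ↔
      (∀ i, i ≠ 0 → i ≠ Fin.last N → (P *ᵥ w) i - τ / 2 * (D *ᵥ w) i = rhs m v i) ∧
        w 0 = rhs m v 0 ∧ w (Fin.last N) = rhs m v (Fin.last N) := by
    intro m v w
    have r0 : rhs m v 0 = φ₁ (node 0 T M (m + 1)) := by simp [hrhs]
    have rl : rhs m v (Fin.last N) = φ₂ (node 0 T M (m + 1)) := by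
      simp only [hrhs, if_neg hlast.symm, if_true]
    rw [r0, rl]
    refine and_congr_left fun _ => forall_congr' fun i => forall_congr' fun hi0 =>
      forall_congr' fun hil => ?_
    simp only [hrhs, if_neg hi0, if_neg hil, mulVec_sub, mulVec_add, Pi.sub_apply, Pi.add_apply]
    constructor <;> intro h <;> linarith
  choose S hS hSu using fun (m : ℕ) (v : Fin (N + 1) → ℝ) =>
    existsUnique_step hP hD hτ0.le (rhs m v)
  set y : ℕ → Fin (N + 1) → ℝ := fun m =>
    Nat.rec (fun i => s₀ (node a b N i)) (fun m v => S m v) m with hy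
  have hy0 : y 0 = fun i : Fin (N + 1) => s₀ (node a b N i) := rfl
  have hys : ∀ m, y (m + 1) = S m (y m) := fun m => rfl
  have hyS : ∀ m, _ := fun m => (hstep m (y m) (y (m + 1))).2 (hS m (y m))
  refine ⟨fun m => y m, ⟨?_, ?_, ?_, ?_⟩, ?_⟩
  · intro m i hi0 hil
    simpa using (hyS m).1 i hi0 hil
  · intro i
    rfl
  · intro m
    obtain ⟨m, hm⟩ := m
    cases m with
    | zero => simpa [hy0, node_zero] using ha0
    | succ m => simpa using (hyS m).2.1
  · intro m
    obtain ⟨m, hm⟩ := m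
    cases m with
    | zero => simpa [hy0, node_zero, node_self a b hN] using hb0
    | succ m => simpa using (hyS m).2.2
  · intro U hU
    funext m
    induction m using Fin.induction with
    | zero =>
      ext i
      exact hU.initial i
    | succ m ih =>
      have h1 := (hstep m (U m.castSucc) (U m.succ)).1
        ⟨fun i hi0 hil => hU.step m i hi0 hil, by simpa using hU.left_boundary m.succ,
          by simpa using hU.right_boundary m.succ⟩
      have h2 := hSu m (U m.castSucc) (U m.succ) h1
      rw [h2, ih]
      rfl

end scheme

lemma exists_errorNorm_le {p : ℕ} (hp : p = 2 ∨ p = 3) {α a b T K₁ K₂ : ℝ}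
    (h₁ : 1 ≤ α) (h₂ : α ≤ 2) (hab : a < b) (hT : 0 < T) (hK₁ : 0 ≤ K₁) (hK₂ : 0 ≤ K₂)
    {f : ℝ → ℝ → ℝ} {s₀ φ₁ φ₂ : ℝ → ℝ} {u : ℝ → ℝ → ℝ}
    (hu : IsSolution α a b T K₁ K₂ f s₀ φ₁ φ₂ u)
    (hleft : K₁ ≠ 0 → SpaceSmooth a b T (p + ⌈α⌉₊ + 1) (Iic b) u)
    (hright : K₂ ≠ 0 → SpaceSmooth a b T (p + ⌈α⌉₊ + 1) (Ici a) u)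
    (hut : TimeSmooth a b T 3 u) (hft : TimeSmooth a b T 2 f) :
    ∃ C, 0 ≤ C ∧ ∀ N M : ℕ, 0 < N → 0 < M → ∀ U : Fin (M + 1) → Fin (N + 1) → ℝ,
      IsCNSolution p α a b T K₁ K₂ f s₀ φ₁ φ₂ N M U → ∀ m : Fin (M + 1),
        errorNorm a b T u N M U m ≤ C * (meshSize 0 T M ^ 2 + meshSize a b N ^ p) := by
  obtain ⟨c, -, -, -, hprec⟩ := exists_precMatrix_eq h₁ h₂ hp
  obtain ⟨C, hC, htrunc⟩ :=
    exists_abs_truncationError_le hp h₁ h₂ hab hT hu hleft hright hut hft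
  refine ⟨5 * T * √(2 * (b - a)) * C, by positivity, fun N M hN hM U hU m => ?_⟩
  have hτ0 : 0 < meshSize 0 T M := meshSize_pos hT hM
  have hh0 : 0 < meshSize a b N := meshSize_pos hab hN
  have key := gridNorm_le_of_step (P := precMatrix α p N)
    (D := diffusionMatrix α K₁ K₂ (meshSize a b N) N) (by rw [hprec, triMatrix_transpose])
    (le_dotProduct_precMatrix_mulVec hp h₁ h₂)
    (dotProduct_diffusionMatrix_mulVec_nonpos h₁ h₂ hK₁ hK₂ hh0.le N) hτ0.le hh0.le (M := M)
    (e := fun m i => u (node a b N i) (node 0 T M m) - U m i)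
    (R := fun m => truncationError p α a b T K₁ K₂ f u N M m)
    (r := C * (meshSize 0 T M ^ 2 + meshSize a b N ^ p))
    ?_ ?_ ?_ (fun m i => htrunc N M hN hM m m.isLt i) (by positivity) m
  · refine key.trans ?_
    rw [mul_meshSize 0 T hM, sub_zero, ← mul_assoc]
    -- The energy bound sums over all N + 1 nodes, and h(N + 1) = (b − a) + h with h ≤ b − a.
    have hle : meshSize a b N * (N + 1) ≤ 2 * (b - a) := by
      have := mul_meshSize a b hN
      have := meshSize_le hab hN
      linarith
    gcongr
  · ext i
    have hx := node_mem hab hN (Nat.le_of_lt_succ i.isLt)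
    simp [node_zero, hU.initial, hu.initial _ hx]
  · intro m
    have ht := node_mem hT hM (Nat.le_of_lt_succ m.isLt)
    simp [hU.left_boundary, hU.right_boundary, node_zero, node_self a b hN,
      hu.left_boundary _ ht, hu.right_boundary _ ht]
  · intro m i hi0 hil
    have hs := hU.step m i hi0 hil
    have e₁ : (fun i : Fin (N + 1) => u (node a b N i) (node 0 T M m.succ) - U m.succ i) -
        (fun i : Fin (N + 1) => u (node a b N i) (node 0 T M m.castSucc) - U m.castSucc i) =
        ((fun i : Fin (N + 1) => u (node a b N i) (node 0 T M (m + 1))) -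
          fun i : Fin (N + 1) => u (node a b N i) (node 0 T M m)) -
          (U m.succ - U m.castSucc) := by
      ext i
      simp only [Pi.sub_apply, Fin.val_succ, Fin.val_castSucc]
      ring
    have e₂ : (fun i : Fin (N + 1) => u (node a b N i) (node 0 T M m.succ) - U m.succ i) +
        (fun i : Fin (N + 1) => u (node a b N i) (node 0 T M m.castSucc) - U m.castSucc i) =
        ((fun i : Fin (N + 1) => u (node a b N i) (node 0 T M (m + 1))) +
          fun i : Fin (N + 1) => u (node a b N i) (node 0 T M m)) -
          (U m.succ + U m.castSucc) := by
      ext i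
      simp only [Pi.sub_apply, Pi.add_apply, Fin.val_succ, Fin.val_castSucc]
      ring
    rw [e₁, e₂, mulVec_sub, mulVec_sub _ (_ + _), Pi.sub_apply, Pi.sub_apply, hs,
      truncationError, if_pos ⟨hi0, hil⟩, ← mul_assoc, mul_one_div_cancel hτ0.ne']
    ring

end FracCN

end

theorem mainTheorem8
    (p : ℕ) (hp : p = 2 ∨ p = 3)
    (α a b T K₁ K₂ : ℝ) (hα₁ : 1 ≤ α) (hα₂ : α ≤ 2) (hab : a < b) (hT : 0 < T)
    (hK₁ : 0 ≤ K₁) (hK₂ : 0 ≤ K₂) (hK : K₁ + K₂ ≠ 0)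
    (f : ℝ → ℝ → ℝ) (s₀ φ₁ φ₂ : ℝ → ℝ)
    (hφ₁ : K₁ ≠ 0 → ∀ t ∈ Icc 0 T, φ₁ t = 0)
    (hφ₂ : K₂ ≠ 0 → ∀ t ∈ Icc 0 T, φ₂ t = 0)
    (u : ℝ → ℝ → ℝ)
    (hu : FracCN.IsSolution α a b T K₁ K₂ f s₀ φ₁ φ₂ u)
    (hleft : K₁ ≠ 0 → FracCN.SpaceSmooth a b T (p + ⌈α⌉₊ + 1) (Iic b) u)
    (hright : K₂ ≠ 0 → FracCN.SpaceSmooth a b T (p + ⌈α⌉₊ + 1) (Ici a) u)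
    (hut : FracCN.TimeSmooth a b T 3 u)
    (hft : FracCN.TimeSmooth a b T 2 f) :
    (∀ N M : ℕ, 0 < N → 0 < M →
      ∃! U : Fin (M + 1) → Fin (N + 1) → ℝ,
        FracCN.IsCNSolution p α a b T K₁ K₂ f s₀ φ₁ φ₂ N M U) ∧
    (∃ C : ℝ, ∀ N M : ℕ, 0 < N → 0 < M →
      ∀ U : Fin (M + 1) → Fin (N + 1) → ℝ,
        FracCN.IsCNSolution p α a b T K₁ K₂ f s₀ φ₁ φ₂ N M U →
        ∀ m : Fin (M + 1), FracCN.errorNorm a b T u N M U m ≤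
          C * (FracCN.meshSize 0 T M ^ 2 + FracCN.meshSize a b N ^ p)) ∧
    (∀ ε : ℝ, 0 < ε → ∃ δ : ℝ, 0 < δ ∧ ∀ N M : ℕ, 0 < N → 0 < M →
      FracCN.meshSize a b N < δ → FracCN.meshSize 0 T M < δ →
      ∀ U : Fin (M + 1) → Fin (N + 1) → ℝ,
        FracCN.IsCNSolution p α a b T K₁ K₂ f s₀ φ₁ φ₂ N M U →
        ∀ m : Fin (M + 1), FracCN.errorNorm a b T u N M U m < ε) := by
  obtain ⟨C, hC, hconv⟩ := FracCN.exists_errorNorm_le hp hα₁ hα₂ hab hT hK₁ hK₂ hu hleft hright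
    hut hft
  have h0 : (0 : ℝ) ∈ Icc 0 T := ⟨le_rfl, hT.le⟩
  have ha0 : s₀ a = φ₁ 0 := by
    rw [← hu.initial a ⟨le_rfl, hab.le⟩, hu.left_boundary 0 h0]
  have hb0 : s₀ b = φ₂ 0 := by
    rw [← hu.initial b ⟨hab.le, le_rfl⟩, hu.right_boundary 0 h0]
  -- Taking δ ≤ 1 allows τ² ≤ τ and h^p ≤ h; C + 1 in place of C keeps the denominator positive when
  -- C = 0.
  refine ⟨fun N M hN hM => FracCN.existsUnique_isCNSolution hp hα₁ hα₂ hab hT hK₁ hK₂ ha0 hb0 hN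
    hM, ⟨C, hconv⟩, fun ε hε => ⟨min 1 (ε / (2 * (C + 1))), by positivity, ?_⟩⟩
  intro N M hN hM hh hτ U hU m
  have hτ0 := FracCN.meshSize_pos hT hM
  have hh0 := FracCN.meshSize_pos hab hN
  obtain ⟨hh1, hhε⟩ := lt_min_iff.1 hh
  obtain ⟨hτ1, hτε⟩ := lt_min_iff.1 hτ
  have h2 : FracCN.meshSize 0 T M ^ 2 ≤ FracCN.meshSize 0 T M :=
    pow_le_of_le_one hτ0.le hτ1.le two_ne_zero
  have hp' : FracCN.meshSize a b N ^ p ≤ FracCN.meshSize a b N :=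
    pow_le_of_le_one hh0.le hh1.le (by omega)
  calc _ ≤ C * (FracCN.meshSize 0 T M ^ 2 + FracCN.meshSize a b N ^ p) := hconv N M hN hM U hU m
    _ ≤ (C + 1) * (FracCN.meshSize 0 T M + FracCN.meshSize a b N) := by
        gcongr
        linarith
    _ < (C + 1) * (ε / (2 * (C + 1)) + ε / (2 * (C + 1))) := by gcongr
    _ = ε := by
        field_simp
        ring
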